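/- **Conventions.** Condition (A) with parameter $M_4\in\mathbb{R}$: $A=(a_{ij})$ is an $n\times n$ real symmetric random matrix whose above-diagonal entries $a_{ij}$, $i<j$, are independent, identically distributed random variables with $\mathbb{E}a_{ij}=0$, $\mathbb{E}a_{ij}^2=1$, $\mathbb{E}a_{ij}^4\le M_4^4<\infty$, and whose diagonal entries are arbitrary fixed numbers. For $K>0$ let $\mathcal{E}_K=\{\|A\|\le 3K\sqrt n\}$, where $\|\cdot\|$ is the spectral norm. For $c_0,c_1\in(0,1)$, a vector of $\mathbb{R}^n$ is *sparse* if it has at most $c_0n$ nonzero coordinates; a unit vector is *compressible* if its Euclidean distance to the set of sparse vectors is at most $c_1$; $\mathrm{Incomp}(c_0,c_1)\subset S^{n-1}$ is the set of unit vectors that are not compressible. For a finite set $I$, a unit vector $x\in\mathbb{R}^I$ and $L\ge1$, $$D_L(x)=\inf\Big\{\theta>0:\ \mathrm{dist}(\theta x,\mathbb{Z}^I)<L\sqrt{\log_+(\theta/L)}\Big\},\qquad \log_+t=\max(0,\log t).$$ For a constant $c_{oo}$ with $\frac14c_0c_1^2\le c_{oo}\le\frac14$, a *spread assignment* assigns to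 every $x\in\mathrm{Incomp}(c_0,c_1)$ a set $\mathrm{spread}(x)\subseteq\{1,\dots,n\}$ of exactly $\lceil c_{oo}n\rceil$ elements with $\frac{c_1}{\sqrt{2n}}\le|x_k|\le\frac1{\sqrt{c_0n}}$ for all $k\in\mathrm{spread}(x)$ (for $c_{oo}\le\frac12c_0c_1^2$ such an assignment always exists). Relative to it, the *regularized LCD* is, for $0<\lambda<c_{oo}$, $$\widehat D_L(x,\lambda)=\max\Big\{D_L\big(x_I/\|x_I\|_2\big):\ I\subseteq\mathrm{spread}(x),\ |I|=\lceil\lambda n\rceil\Big\},$$ where $x_I\in\mathbb{R}^I$ is the restriction of $x$ to the coordinates in $I$. **Theorem (Structure theorem).** Let $K>0$ and $M_4\in\mathbb{R}$. For all sufficiently small $c_0,c_1$ (that is, for all $0<c_0\le \bar c_0$ and $0<c_1\le \bar c_1$, where $\bar c_0,\bar c_1\in(0,1)$ depend only on $K,M_4$) and every $c_{oo}\in[\frac14c_0c_1^2,\frac14]$ there exist $c>0$ and $L_0\ge1$, depending only on $K,M_4$ and the chosen constants $c_0,c_1,c_{oo}$, such that the following holds for every $n$, every random matrix $A$ satisfying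 (A), and every spread assignment. Let $u\in\mathbb{R}^n\setminus\{0\}$ be fixed and put $x_0=A^{-1}u/\|A^{-1}u\|_2$ whenever $A$ is invertible. Let $$L_0\le L\le n^{c},\qquad n^{-c}\le\lambda\le c_{oo}/3,$$ and consider the event $$\mathcal{E}=\Big\{x_0\in\mathrm{Incomp}(c_0,c_1)\ \text{ and }\ \widehat D_L(x_0,\lambda)\ge L^{-2}n^{c/\lambda}\Big\}.$$ Then $$\mathbb{P}\big(\mathcal{E}^c\cap\mathcal{E}_K\cap\{A\text{ is invertible}\}\big)\le 2e^{-cn}.$$ In particular, $\mathbb{P}(\mathcal{E}^c\cap\mathcal{E}_K)\le2e^{-cn}$ whenever $A$ is almost surely invertible. (If $\mathcal{E}$ is not measurable, the bound is for the outer probability.) -/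

import Mathlib

open MeasureTheory ProbabilityTheory

noncomputable section

namespace SymmetricRandomMatrix

/-- The random matrix assumptions with fourth moment parameter `M4`: `A` is real symmetric, its
above-diagonal entries are independent and identically distributed with mean zero, unit variance and
fourth moment at most `M4 ^ 4`, and its diagonal entries are arbitrary fixed numbers. -/
structure SatisfiesA {Ω : Type*} [MeasurableSpace Ω] (μ : Measure Ω) {n : ℕ}
    (A : Ω → Matrix (Fin n) (Fin n) ℝ) (M4 : ℝ) : Prop where
  symm : ∀ ω, (A ω).IsSymm
  measurable : ∀ i j, i < j → Measurable (fun ω => A ω i j)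
  indep : iIndepFun
    (fun (p : {p : Fin n × Fin n // p.1 < p.2}) (ω : Ω) => A ω p.1.1 p.1.2) μ
  identDistrib : ∀ i j k l, i < j → k < l →
    IdentDistrib (fun ω => A ω i j) (fun ω => A ω k l) μ μ
  integrable_pow_four : ∀ i j, i < j → Integrable (fun ω => A ω i j ^ 4) μ
  mean_zero : ∀ i j, i < j → ∫ ω, A ω i j ∂μ = 0
  second_moment : ∀ i j, i < j → ∫ ω, A ω i j ^ 2 ∂μ = 1
  fourth_moment : ∀ i j, i < j → ∫ ω, A ω i j ^ 4 ∂μ ≤ M4 ^ 4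
  diag_fixed : ∃ d : Fin n → ℝ, ∀ ω i, A ω i i = d i

/-- The spectral norm: the operator norm on Euclidean space. -/
def spectralNorm {n : ℕ} (A : Matrix (Fin n) (Fin n) ℝ) : ℝ :=
  ‖Matrix.toEuclideanCLM (n := Fin n) (𝕜 := ℝ) A‖

/-- The sparse vectors: those with at most `c0 * n` nonzero coordinates. -/
def sparse (n : ℕ) (c0 : ℝ) : Set (EuclideanSpace ℝ (Fin n)) :=
  {x | ((Finset.univ.filter (fun i => x i ≠ 0)).card : ℝ) ≤ c0 * n}

/-- The compressible unit vectors. -/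
def comp (n : ℕ) (c0 c1 : ℝ) : Set (EuclideanSpace ℝ (Fin n)) :=
  {x | ‖x‖ = 1 ∧ Metric.infDist x (sparse n c0) ≤ c1}

/-- The incompressible unit vectors. -/
def incomp (n : ℕ) (c0 c1 : ℝ) : Set (EuclideanSpace ℝ (Fin n)) :=
  {x | ‖x‖ = 1 ∧ x ∉ comp n c0 c1}

/-- The integer lattice `ℤ^ι` in `ℝ^ι`. -/
def integerLattice (ι : Type*) : Set (EuclideanSpace ℝ ι) :=
  {z | ∀ i, ∃ k : ℤ, z i = k}

/-- The least common denominator `D_L(x)`; here `Real.posLog t = max 0 (log t)`. The set whose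
infimum is taken is never empty when `0 < L`, as the distance to the lattice is bounded. -/
def lcd {ι : Type*} [Fintype ι] (L : ℝ) (x : EuclideanSpace ℝ ι) : ℝ :=
  sInf {θ : ℝ | 0 < θ ∧
    Metric.infDist (θ • x) (integerLattice ι) < L * Real.sqrt (Real.posLog (θ / L))}

/-- The restriction `x_I ∈ ℝ^I` of a vector `x`. -/
def restrict {n : ℕ} (x : EuclideanSpace ℝ (Fin n)) (I : Finset (Fin n)) :
    EuclideanSpace ℝ I :=
  WithLp.toLp 2 (fun i : I => x i)

/-- The normalization `x / ‖x‖` (zero for `x = 0`). -/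
def normalize {E : Type*} [NormedAddCommGroup E] [NormedSpace ℝ E] (x : E) : E :=
  ‖x‖⁻¹ • x

/-- A valid assignment of a set `spread x` to each incompressible `x`: it has exactly
`⌈coo * n⌉` elements and `c1 / √(2n) ≤ |x k| ≤ 1 / √(c0 n)` for every `k` in it. -/
def IsSpreadAssignment {n : ℕ} (c0 c1 coo : ℝ)
    (spread : EuclideanSpace ℝ (Fin n) → Finset (Fin n)) : Prop :=
  ∀ x ∈ incomp n c0 c1,
    (spread x).card = ⌈coo * n⌉₊ ∧
    ∀ k ∈ spread x, c1 / Real.sqrt (2 * n) ≤ |x k| ∧ |x k| ≤ 1 / Real.sqrt (c0 * n)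

/-- The regularized LCD of `x` relative to the assignment `spread`: the largest `D_L(x_I / ‖x_I‖)`
over all `I ⊆ spread x` with `|I| = ⌈lam * n⌉` (a maximum over a finite family). -/
def regLcd {n : ℕ} (spread : EuclideanSpace ℝ (Fin n) → Finset (Fin n)) (L lam : ℝ)
    (x : EuclideanSpace ℝ (Fin n)) : ℝ :=
  sSup {D : ℝ | ∃ I : Finset (Fin n), I ⊆ spread x ∧ I.card = ⌈lam * n⌉₊ ∧
    D = lcd L (normalize (restrict x I))}

/-- The vector `A⁻¹ u / ‖A⁻¹ u‖`. -/
def unitSolution {n : ℕ} (A : Matrix (Fin n) (Fin n) ℝ) (u : EuclideanSpace ℝ (Fin n)) :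
    EuclideanSpace ℝ (Fin n) :=
  normalize (Matrix.toEuclideanCLM (n := Fin n) (𝕜 := ℝ) A⁻¹ u)

end SymmetricRandomMatrix

end

/-!
The structure theorem for `x₀ = A⁻¹ u / ‖A⁻¹ u‖`: a union bound over nets of candidate directions.
On the event considered, `A x₀` is a multiple of `u` of bounded length, so if `x₀` is close to a
point `y` of a net then `A y` is close to one of few fixed vectors
(`measureReal_unitSolution_mem_le`). It suffices that nets are small compared with the small ball
probabilities `P(‖A y - v‖ ≤ ε √n)`.

*Small ball probabilities.* The weight `exp (-|w|² / 2)` is a Gaussian average of the characters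
`exp (i ⟨g, w⟩)`. Inserting `w = (A y - v) / ε` restricted to the rows outside a set `J`, the
independence of the entries above the diagonal factors the expectation, and keeping only the entries
`A i j` with `i ∉ J`, `j ∈ J` bounds the probability by a power of a one-dimensional Gaussian
integral of `∏ j ∈ J, |φ (g y j / ε)|`, with `φ` the characteristic function of an entry
(`SatisfiesA.measureReal_norm_sub_le`). The symmetry of `A` plays no role any more, and nothing has
to be conditioned on. The integral is bounded away from `1` unless `y_J` is small
(`exists_integral_prod_norm_charFun_le`), and it is of order `L ε / ‖y_J‖` when the least common
denominator of `y_J / ‖y_J‖` exceeds `‖y_J‖ / ε`, up to a factor that the Gaussian tail absorbs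
(`integral_prod_norm_charFun_le_of_lcd`).

*Compressible directions.* Near sparse vectors the net consists of points `h q`, `q ∈ ℤⁿ`, of small
`ℓ¹` norm. Their number is exponential with a rate that tends to `0` with the sparsity, and is
beaten by the exponential small ball bound (`exists_measureReal_unitSolution_mem_comp_le`).

*Incompressible directions.* They are split into level sets `D ≤ regLcd < 2 D` with `D` a power of
two. On a level set the small ball probability at scale `1 / D` is about `D⁻ⁿ`. The net of the level
set would have size `Dⁿ` without arithmetic information, but every block of `⌈lam n⌉` spread
coordinates is close to a multiple of an integer vector of length at most `D`, which saves a factor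
`√n` per coordinate (`exists_net_of_integer_approx`, `exists_net_levelSet`). All other losses are
powers of `Q ^ n` with `Q = n ^ c`, as `L ≤ Q`, `1 / lam ≤ Q` and `D ≤ Q ^ (1 / lam)`. The gain
`n ^ (-coo n / 4)` over the blocks dominates them for small `c`
(`SatisfiesA.measureReal_unitSolution_mem_levelSet_le`).
-/

namespace SymmetricRandomMatrix


/-! ### Characteristic functions of normalized laws -/

/-- A law on `ℝ` with fourth moment bounded by `M`, mean zero and unit
variance. -/
structure IsNormalizedLaw (ν : Measure ℝ) (M : ℝ) : Prop where
  integrable_pow_four : Integrable (fun x : ℝ => x ^ 4) ν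
  mean_zero : ∫ x, x ∂ν = 0
  second_moment : ∫ x, x ^ 2 ∂ν = 1
  fourth_moment : ∫ x, x ^ 4 ∂ν ≤ M

/-- The law of `ξ - ξ'` for independent `ξ`, `ξ'` of law `ν`. -/
noncomputable def symmetrization (ν : Measure ℝ) : Measure ℝ :=
  (ν.prod ν).map (fun p => p.1 - p.2)

instance (ν : Measure ℝ) [IsProbabilityMeasure ν] : IsProbabilityMeasure (symmetrization ν) :=
  Measure.isProbabilityMeasure_map (by fun_prop)

lemma charFun_symmetrization (ν : Measure ℝ) [IsProbabilityMeasure ν] (s : ℝ) :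
    charFun (symmetrization ν) s = ((‖charFun ν s‖ ^ 2 : ℝ) : ℂ) := by
  have h1 : charFun (symmetrization ν) s = charFun ν s * charFun ν (-s) := by
    rw [charFun_apply_real, symmetrization, integral_map (by fun_prop) (by fun_prop),
      charFun_apply_real, charFun_apply_real, ← integral_prod_mul]
    congr 1
    ext p
    rw [← Complex.exp_add]
    congr 1
    push_cast
    ring
  rw [h1, charFun_neg, Complex.mul_conj']
  push_cast
  rfl

lemma integrable_cos_mul (κ : Measure ℝ) [IsFiniteMeasure κ] (s : ℝ) :
    Integrable (fun z => Real.cos (s * z)) κ :=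
  Integrable.of_bound (by fun_prop) 1 (Filter.Eventually.of_forall fun z => by
    simpa using Real.abs_cos_le_one _)

lemma re_charFun (κ : Measure ℝ) [IsFiniteMeasure κ] (s : ℝ) :
    (charFun κ s).re = ∫ z, Real.cos (s * z) ∂κ := by
  rw [charFun_apply_real]
  have hi : Integrable (fun z : ℝ => Complex.exp (s * z * Complex.I)) κ :=
    Integrable.of_bound (by fun_prop) 1 (Filter.Eventually.of_forall fun z => by
      rw [← Complex.ofReal_mul, Complex.norm_exp_ofReal_mul_I])
  have := integral_re hi
  simp only [RCLike.re_eq_complex_re] at this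
  rw [← this]
  congr 1
  ext z
  rw [← Complex.ofReal_mul, Complex.exp_ofReal_mul_I_re]

lemma norm_charFun_sq (ν : Measure ℝ) [IsProbabilityMeasure ν] (s : ℝ) :
    ‖charFun ν s‖ ^ 2 = ∫ z, Real.cos (s * z) ∂(symmetrization ν) := by
  rw [← re_charFun, charFun_symmetrization, Complex.ofReal_re]

lemma norm_charFun_le_exp (ν : Measure ℝ) [IsProbabilityMeasure ν] (s : ℝ) :
    ‖charFun ν s‖ ≤ Real.exp (-(1 / 2) * ∫ z, (1 - Real.cos (s * z)) ∂(symmetrization ν)) := by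
  have h : ∫ z, (1 - Real.cos (s * z)) ∂(symmetrization ν) = 1 - ‖charFun ν s‖ ^ 2 := by
    rw [integral_sub (integrable_const _) (integrable_cos_mul _ _), norm_charFun_sq]
    simp
  rw [h]
  refine (sq_le_sq₀ (norm_nonneg _) (Real.exp_pos _).le).1 ?_
  have e : Real.exp (-(1 / 2) * (1 - ‖charFun ν s‖ ^ 2)) ^ 2 =
      Real.exp (‖charFun ν s‖ ^ 2 - 1) := by
    rw [← Real.exp_nat_mul]
    congr 1
    push_cast
    ring
  rw [e]
  linarith [Real.add_one_le_exp (‖charFun ν s‖ ^ 2 - 1)]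

lemma prod_norm_charFun_le_exp (ν : Measure ℝ) [IsProbabilityMeasure ν] {ι : Type*}
    (J : Finset ι) (a : ι → ℝ) :
    ∏ j ∈ J, ‖charFun ν (a j)‖ ≤
      Real.exp (-(1 / 2) * ∫ z, ∑ j ∈ J, (1 - Real.cos (a j * z)) ∂(symmetrization ν)) := by
  have hi : ∀ j ∈ J, Integrable (fun z => 1 - Real.cos (a j * z)) (symmetrization ν) :=
    fun j _ => (integrable_const _).sub (integrable_cos_mul _ _)
  rw [integral_finsetSum _ hi, Finset.mul_sum, Real.exp_sum]
  exact Finset.prod_le_prod (fun _ _ => norm_nonneg _) fun j _ => norm_charFun_le_exp ν (a j)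

namespace IsNormalizedLaw

variable {ν : Measure ℝ} {M : ℝ} [IsProbabilityMeasure ν]

lemma integrable_pow (h : IsNormalizedLaw ν M) {k : ℕ} (hk : k ≤ 4) :
    Integrable (fun x : ℝ => x ^ k) ν := by
  refine Integrable.mono' ((integrable_const (1 : ℝ)).add h.integrable_pow_four) (by fun_prop)
    (Filter.Eventually.of_forall fun x => ?_)
  simp only [Real.norm_eq_abs, abs_pow, Pi.add_apply]
  rw [← Even.pow_abs (by decide : Even 4)]
  rcases le_total |x| 1 with hx | hx
  · have := pow_le_one₀ (n := k) (abs_nonneg x) hx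
    have := pow_nonneg (abs_nonneg x) 4
    linarith
  · have := pow_le_pow_right₀ hx hk
    linarith

lemma integrable_symm_pow_four (h : IsNormalizedLaw ν M) :
    Integrable (fun z : ℝ => z ^ 4) (symmetrization ν) := by
  rw [symmetrization, integrable_map_measure (by fun_prop) (by fun_prop)]
  have h1 : Integrable (fun p : ℝ × ℝ => p.1 ^ 4) (ν.prod ν) :=
    h.integrable_pow_four.comp_fst ν
  have h2 : Integrable (fun p : ℝ × ℝ => p.2 ^ 4) (ν.prod ν) :=
    h.integrable_pow_four.comp_snd ν
  refine Integrable.mono' ((h1.add h2).const_mul 8) (by fun_prop)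
    (Filter.Eventually.of_forall fun p => ?_)
  simp only [Function.comp, Real.norm_eq_abs, abs_pow, Pi.add_apply,
    Even.pow_abs (by decide : Even 4)]
  nlinarith [sq_nonneg (p.1 ^ 2 - p.2 ^ 2), sq_nonneg (p.1 + p.2), sq_nonneg (p.1 - p.2),
    sq_nonneg ((p.1 + p.2) ^ 2), mul_nonneg (sq_nonneg (p.1 + p.2)) (sq_nonneg (p.1 - p.2))]

lemma integrable_symm_pow_two (h : IsNormalizedLaw ν M) :
    Integrable (fun z : ℝ => z ^ 2) (symmetrization ν) := by
  refine Integrable.mono' ((integrable_const (1 : ℝ)).add h.integrable_symm_pow_four)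
    (by fun_prop) (Filter.Eventually.of_forall fun x => ?_)
  simp only [Real.norm_eq_abs, abs_pow, Pi.add_apply, sq_abs]
  nlinarith [sq_nonneg (x ^ 2 - 1), sq_nonneg x]

lemma integral_symm_pow_two (h : IsNormalizedLaw ν M) :
    ∫ z, z ^ 2 ∂(symmetrization ν) = 2 := by
  rw [symmetrization, integral_map (by fun_prop) (by fun_prop)]
  have h1 : Integrable (fun p : ℝ × ℝ => p.1 ^ 2) (ν.prod ν) :=
    (h.integrable_pow (by norm_num : 2 ≤ 4)).comp_fst ν
  have h2 : Integrable (fun p : ℝ × ℝ => p.2 ^ 2) (ν.prod ν) :=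
    (h.integrable_pow (by norm_num : 2 ≤ 4)).comp_snd ν
  have hi : Integrable (fun x : ℝ => x) ν := by
    simpa using h.integrable_pow (by norm_num : 1 ≤ 4)
  have h3 : Integrable (fun p : ℝ × ℝ => p.1 * p.2) (ν.prod ν) := hi.mul_prod hi
  have e : (fun p : ℝ × ℝ => (p.1 - p.2) ^ 2) =
      fun p => (p.1 ^ 2 + p.2 ^ 2) - 2 * (p.1 * p.2) := by
    ext p; ring
  have h12 : Integrable (fun p : ℝ × ℝ => p.1 ^ 2 + p.2 ^ 2) (ν.prod ν) := h1.add h2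
  rw [e, integral_sub h12 (h3.const_mul 2), integral_add h1 h2, integral_const_mul,
    integral_prod_mul (fun x : ℝ => x) (fun x : ℝ => x), h.mean_zero,
    integral_fun_fst (fun x : ℝ => x ^ 2), integral_fun_snd (fun x : ℝ => x ^ 2),
    h.second_moment]
  norm_num

lemma integral_symm_pow_four_le (h : IsNormalizedLaw ν M) :
    ∫ z, z ^ 4 ∂(symmetrization ν) ≤ 16 * M := by
  rw [symmetrization, integral_map (by fun_prop) (by fun_prop)]
  have h1 : Integrable (fun p : ℝ × ℝ => p.1 ^ 4) (ν.prod ν) :=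
    h.integrable_pow_four.comp_fst ν
  have h2 : Integrable (fun p : ℝ × ℝ => p.2 ^ 4) (ν.prod ν) :=
    h.integrable_pow_four.comp_snd ν
  have h3 : ∫ p : ℝ × ℝ, 8 * (p.1 ^ 4 + p.2 ^ 4) ∂(ν.prod ν) ≤ 16 * M := by
    rw [integral_const_mul, integral_add h1 h2, integral_fun_fst (fun x : ℝ => x ^ 4),
      integral_fun_snd (fun x : ℝ => x ^ 4)]
    have := h.fourth_moment
    simp only [probReal_univ, one_smul]
    linarith
  refine le_trans (integral_mono_of_nonneg (Filter.Eventually.of_forall fun p => by positivity)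
    ((h1.add h2).const_mul 8) (Filter.Eventually.of_forall fun p => ?_)) h3
  simp only [Pi.add_apply]
  nlinarith [sq_nonneg (p.1 ^ 2 - p.2 ^ 2), sq_nonneg (p.1 + p.2), sq_nonneg (p.1 - p.2),
    sq_nonneg ((p.1 + p.2) ^ 2), mul_nonneg (sq_nonneg (p.1 + p.2)) (sq_nonneg (p.1 - p.2))]

/-- A Paley–Zygmund type bound: the symmetrized variable lies in a fixed annulus with probability
bounded below. -/
lemma le_symmetrization_annulus (h : IsNormalizedLaw ν M) {B : ℝ} (hB : 0 < B)
    (hMB : 32 * M ≤ B ^ 2) :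
    1 / (2 * B ^ 2) ≤ (symmetrization ν).real {z | 1 ≤ |z| ∧ |z| ≤ B} := by
  set κ := symmetrization ν
  set S : Set ℝ := {z | 1 ≤ |z| ∧ |z| ≤ B}
  have hS : MeasurableSet S :=
    (measurableSet_le (f := fun _ : ℝ => (1 : ℝ)) measurable_const measurable_norm).inter
      (measurableSet_le (g := fun _ : ℝ => B) measurable_norm measurable_const)
  have hind : Integrable (S.indicator fun _ => (1 : ℝ)) κ := (integrable_const _).indicator hS
  -- below the annulus `z² ≤ 1`, above it `z² ≤ z⁴ / B²`
  have key : ∀ z : ℝ, z ^ 2 ≤ 1 + z ^ 4 / B ^ 2 + B ^ 2 * S.indicator (fun _ => (1 : ℝ)) z := by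
    intro z
    have hq : 0 ≤ z ^ 4 / B ^ 2 := by positivity
    by_cases hz : z ∈ S
    · have : |z| ^ 2 ≤ B ^ 2 := pow_le_pow_left₀ (abs_nonneg z) hz.2 2
      rw [sq_abs] at this
      simp only [Set.indicator_of_mem hz]
      linarith
    · simp only [Set.indicator_of_notMem hz, mul_zero, add_zero]
      by_cases h1 : |z| ≤ 1
      · have : |z| ^ 2 ≤ 1 := pow_le_one₀ (abs_nonneg z) h1
        rw [sq_abs] at this
        linarith
      · have h2 : B < |z| := by
          by_contra h3
          exact hz ⟨(not_le.1 h1).le, not_lt.1 h3⟩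
        have h3 : B ^ 2 ≤ |z| ^ 2 := pow_le_pow_left₀ hB.le h2.le 2
        rw [sq_abs] at h3
        have : z ^ 2 ≤ z ^ 4 / B ^ 2 := by
          rw [le_div_iff₀ (by positivity)]
          nlinarith [sq_nonneg z]
        linarith
  have hint := integral_mono h.integrable_symm_pow_two
    (((integrable_const (1 : ℝ)).add (h.integrable_symm_pow_four.div_const (B ^ 2))).add
      (hind.const_mul (B ^ 2))) key
  have e1 : ∫ z, ((1 : ℝ) + z ^ 4 / B ^ 2 + B ^ 2 * S.indicator (fun _ => (1 : ℝ)) z) ∂κ =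
      1 + (∫ z, z ^ 4 ∂κ) / B ^ 2 + B ^ 2 * κ.real S := by
    have h14 : Integrable (fun z : ℝ => 1 + z ^ 4 / B ^ 2) κ :=
      (integrable_const (1 : ℝ)).add (h.integrable_symm_pow_four.div_const (B ^ 2))
    rw [integral_add h14 (hind.const_mul (B ^ 2)),
      integral_add (integrable_const (1 : ℝ)) (h.integrable_symm_pow_four.div_const (B ^ 2)),
      integral_const_mul, integral_div, integral_indicator_const _ hS]
    simp [κ]
  simp only [Pi.add_apply] at hint
  rw [e1, h.integral_symm_pow_two] at hint
  have h5 : (∫ z, z ^ 4 ∂κ) / B ^ 2 ≤ 1 / 2 := by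
    rw [div_le_iff₀ (by positivity)]
    linarith [h.integral_symm_pow_four_le]
  rw [div_le_iff₀ (by positivity)]
  linarith

end IsNormalizedLaw


/-! ### Small ball probabilities for `A y` -/

lemma prod_prod_lt_le_prod_crossing {n : ℕ} (J : Finset (Fin n)) (ψ : Fin n → Fin n → ℝ)
    (hs : ∀ i j, ψ i j = ψ j i) (h0 : ∀ i j, 0 ≤ ψ i j) (h1 : ∀ i j, ψ i j ≤ 1) :
    ∏ p : {p : Fin n × Fin n // p.1 < p.2}, ψ p.1.1 p.1.2 ≤
      ∏ i, ∏ j, if i ∉ J ∧ j ∈ J then ψ i j else 1 := by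
  have hL : ∏ p : {p : Fin n × Fin n // p.1 < p.2}, ψ p.1.1 p.1.2 =
      ∏ i, ∏ j, if i < j then ψ i j else 1 := by
    rw [← Fintype.prod_prod_type' (fun i j => if i < j then ψ i j else 1), ← Finset.prod_filter]
    exact (Finset.prod_subtype _ (by simp) (fun p : Fin n × Fin n => ψ p.1 p.2)).symm
  have hR : (∏ i, ∏ j, if i ∉ J ∧ j ∈ J then ψ i j else 1) =
      ∏ i, ∏ j, ((if i < j ∧ i ∉ J ∧ j ∈ J then ψ i j else 1) *
        (if i < j ∧ j ∉ J ∧ i ∈ J then ψ i j else 1)) := by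
    simp only [Finset.prod_mul_distrib]
    have hc : (∏ i, ∏ j, if i < j ∧ j ∉ J ∧ i ∈ J then ψ i j else 1) =
        ∏ i, ∏ j, if j < i ∧ i ∉ J ∧ j ∈ J then ψ i j else 1 := by
      rw [Finset.prod_comm]
      simp only [hs]
    rw [hc]
    simp only [← Finset.prod_mul_distrib]
    refine Finset.prod_congr rfl fun i _ => Finset.prod_congr rfl fun j _ => ?_
    rcases lt_trichotomy i j with h | h | h
    · simp [h, h.not_gt]
    · subst h
      simp
    · simp [h, h.not_gt]
  rw [hL, hR]
  refine Finset.prod_le_prod (fun i _ => Finset.prod_nonneg fun j _ => ?_) fun i _ =>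
    Finset.prod_le_prod (fun j _ => ?_) fun j _ => ?_
  · split_ifs <;> simp [h0]
  · split_ifs <;> simp [h0]
  · by_cases h : i < j <;> by_cases hi : i ∈ J <;> by_cases hj : j ∈ J <;>
      simp [h, hi, hj, h1]

lemma sum_sum_eq_diag_add_sum_lt {n : ℕ} (F : Fin n → Fin n → ℝ) :
    ∑ i, ∑ j, F i j = ∑ i, F i i +
      ∑ p : {p : Fin n × Fin n // p.1 < p.2}, (F p.1.1 p.1.2 + F p.1.2 p.1.1) := by
  have hL : ∑ p : {p : Fin n × Fin n // p.1 < p.2}, (F p.1.1 p.1.2 + F p.1.2 p.1.1) =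
      ∑ i, ∑ j, if i < j then F i j + F j i else 0 := by
    rw [← Fintype.sum_prod_type' (fun i j => if i < j then F i j + F j i else 0),
      ← Finset.sum_filter]
    exact (Finset.sum_subtype _ (by simp) (fun p : Fin n × Fin n => F p.1 p.2 + F p.2 p.1)).symm
  have h2 : (∑ i, ∑ j, if i < j then F i j + F j i else 0) =
      (∑ i, ∑ j, if i < j then F i j else 0) + ∑ i, ∑ j, if j < i then F i j else 0 := by
    rw [Finset.sum_comm (f := fun i j => if j < i then F i j else 0)]
    simp only [← Finset.sum_add_distrib]
    refine Finset.sum_congr rfl fun i _ => Finset.sum_congr rfl fun j _ => ?_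
    split_ifs <;> simp
  have h3 : ∑ i, F i i = ∑ i, ∑ j, if i = j then F i j else 0 := by simp
  rw [hL, h2, h3]
  simp only [← Finset.sum_add_distrib]
  refine Finset.sum_congr rfl fun i _ => Finset.sum_congr rfl fun j _ => ?_
  rcases lt_trichotomy i j with h | h | h
  · simp [h, h.not_gt, h.ne]
  · simp [h]
  · simp [h, h.not_gt, h.ne']

section

variable {Ω : Type*} [MeasurableSpace Ω] {μ : Measure Ω} {n : ℕ}
  {A : Ω → Matrix (Fin n) (Fin n) ℝ} {M4 : ℝ} {ν : Measure ℝ}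

lemma toEuclideanCLM_apply_apply (B : Matrix (Fin n) (Fin n) ℝ) (y : EuclideanSpace ℝ (Fin n))
    (i : Fin n) : Matrix.toEuclideanCLM (n := Fin n) (𝕜 := ℝ) B y i = ∑ j, B i j * y j := by
  simp [Matrix.mulVec, dotProduct]

lemma SatisfiesA.measurable_entry (hA : SatisfiesA μ A M4) (i j : Fin n) :
    Measurable fun ω => A ω i j := by
  rcases lt_trichotomy i j with h | h | h
  · exact hA.measurable i j h
  · obtain ⟨d, hd⟩ := hA.diag_fixed
    subst h
    simp only [hd]
    exact measurable_const
  · have : (fun ω => A ω i j) = fun ω => A ω j i := by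
      ext ω
      exact (hA.symm ω).apply j i
    rw [this]
    exact hA.measurable j i h

variable [IsProbabilityMeasure μ]

/-- The characteristic function of `G ⬝ A y` is at most the product of the contributions of the
entries `A i j` with `i` in the support of `G` and `j` outside. Only these entries are kept from
the full product over the independent above-diagonal entries. -/
lemma SatisfiesA.norm_integral_exp_le (hA : SatisfiesA μ A M4)
    (hν : ∀ i j, i < j → μ.map (fun ω => A ω i j) = ν) (J : Finset (Fin n))
    (G y : Fin n → ℝ) (hG : ∀ j ∈ J, G j = 0) :
    ‖∫ ω, Complex.exp (((∑ i, G i * ∑ j, A ω i j * y j : ℝ) : ℂ) * Complex.I) ∂μ‖ ≤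
      ∏ i, ∏ j, if i ∉ J ∧ j ∈ J then ‖charFun ν (G i * y j)‖ else 1 := by
  obtain ⟨d, hd⟩ := hA.diag_fixed
  set c : {p : Fin n × Fin n // p.1 < p.2} → ℝ :=
    fun p => G p.1.1 * y p.1.2 + G p.1.2 * y p.1.1 with hc
  set X : {p : Fin n × Fin n // p.1 < p.2} → Ω → ℝ := fun p ω => c p * A ω p.1.1 p.1.2 with hX
  have hXm : ∀ p, Measurable (X p) := fun p => (hA.measurable _ _ p.2).const_mul _
  have hXi : iIndepFun X μ :=
    hA.indep.comp (fun p x => c p * x) fun p => measurable_const_mul _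
  have hsum : ∀ ω, ∑ i, G i * ∑ j, A ω i j * y j =
      ∑ i, G i * (d i * y i) + ∑ p, X p ω := by
    intro ω
    simp only [Finset.mul_sum]
    rw [sum_sum_eq_diag_add_sum_lt]
    simp only [hd, hX, hc]
    congr 1
    refine Finset.sum_congr rfl fun p _ => ?_
    rw [(hA.symm ω).apply p.1.1 p.1.2]
    ring
  have hfac : ∫ ω, Complex.exp (((∑ i, G i * ∑ j, A ω i j * y j : ℝ) : ℂ) * Complex.I) ∂μ =
      Complex.exp (((∑ i, G i * (d i * y i) : ℝ) : ℂ) * Complex.I) *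
        charFun (μ.map (fun ω => ∑ p, X p ω)) 1 := by
    rw [charFun_apply_real, integral_map (by fun_prop) (by fun_prop), ← integral_const_mul]
    congr 1
    ext ω
    rw [hsum, ← Complex.exp_add]
    congr 1
    push_cast
    ring
  rw [hfac, norm_mul, Complex.norm_exp_ofReal_mul_I, one_mul,
    hXi.charFun_map_fun_sum_eq_prod (fun p => (hXm p).aemeasurable), Finset.prod_apply, norm_prod]
  have hφ : ∀ p, charFun (μ.map (X p)) 1 = charFun ν (c p) := by
    intro p
    rw [hX, charFun_map_mul_comp (hA.measurable _ _ p.2).aemeasurable, hν _ _ p.2, mul_one]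
  simp only [hφ]
  by_cases hP : Nonempty {p : Fin n × Fin n // p.1 < p.2}
  · obtain ⟨p0⟩ := hP
    have : IsProbabilityMeasure ν := by
      rw [← hν _ _ p0.2]
      exact Measure.isProbabilityMeasure_map (hA.measurable _ _ p0.2).aemeasurable
    refine (prod_prod_lt_le_prod_crossing J (fun i j => ‖charFun ν (G i * y j + G j * y i)‖)
      (fun i j => by rw [add_comm]) (fun _ _ => norm_nonneg _)
      fun _ _ => norm_charFun_le_one _).trans (le_of_eq ?_)
    refine Finset.prod_congr rfl fun i _ => Finset.prod_congr rfl fun j _ => ?_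
    split_ifs with h
    · rw [hG j h.2]
      simp
    · rfl
  · have hno : ∀ i j : Fin n, i = j := by
      intro i j
      by_contra hij
      rcases lt_or_gt_of_ne hij with h | h
      · exact hP ⟨⟨(i, j), h⟩⟩
      · exact hP ⟨⟨(j, i), h⟩⟩
    have : IsEmpty {p : Fin n × Fin n // p.1 < p.2} := not_nonempty_iff.1 hP
    simp only [Finset.univ_eq_empty, Finset.prod_empty]
    refine le_of_eq (Eq.symm (Finset.prod_eq_one fun i _ => Finset.prod_eq_one fun j _ => ?_))
    rw [if_neg]
    rintro ⟨h1, h2⟩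
    exact h1 (hno i j ▸ h2)

lemma exp_neg_sq_eq_integral_gaussian (w : ℝ) :
    Complex.exp (-(w : ℂ) ^ 2 / 2) =
      ∫ g, Complex.exp (((g * w : ℝ) : ℂ) * Complex.I) ∂(gaussianReal 0 1) := by
  have h := charFun_gaussianReal (μ := 0) (v := 1) w
  rw [charFun_apply_real] at h
  simp only [Complex.ofReal_mul]
  simp_rw [mul_comm (_ : ℂ) (w : ℂ)]
  rw [h]
  congr 1
  push_cast
  ring

/-- A Gaussian Fourier bound: the Gaussian weight `exp (-‖A y - v‖² / (2 ε²))`, restricted to the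
rows outside `J`, is an average of characters, so its expectation is controlled by characteristic
functions of the entries and no conditioning on the remaining entries is needed. -/
theorem SatisfiesA.measureReal_norm_sub_le (hA : SatisfiesA μ A M4)
    (hν : ∀ i j, i < j → μ.map (fun ω => A ω i j) = ν) (J : Finset (Fin n))
    (y v : EuclideanSpace ℝ (Fin n)) {ε : ℝ} (hε : 0 < ε) (ρ : ℝ) :
    μ.real {ω | ‖Matrix.toEuclideanCLM (n := Fin n) (𝕜 := ℝ) (A ω) y - v‖ ≤ ρ} ≤
      Real.exp (ρ ^ 2 / (2 * ε ^ 2)) *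
        (∫ g, ∏ j ∈ J, ‖charFun ν (g * (y j / ε))‖ ∂(gaussianReal 0 1)) ^ (Jᶜ).card := by
  set γ : Measure ℝ := gaussianReal 0 1 with hγ
  set w : Ω → Fin n → ℝ := fun ω i => if i ∈ J then 0 else (∑ j, A ω i j * y j - v i) / ε with hw
  have hAm : ∀ i j, Measurable fun ω => A ω i j := hA.measurable_entry
  have hwm : ∀ i, Measurable fun ω => w ω i := by
    intro i
    by_cases h : i ∈ J
    · simp only [hw, h, if_true]
      exact measurable_const
    · simp only [hw, h, if_false]
      fun_prop
  set f : Ω → ℝ := fun ω => Real.exp (-(∑ i, w ω i ^ 2) / 2) with hf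
  have hfm : Measurable f := by fun_prop
  have hf1 : ∀ ω, f ω ≤ 1 := fun ω => by
    rw [hf, Real.exp_le_one_iff]
    have : 0 ≤ ∑ i, w ω i ^ 2 := Finset.sum_nonneg fun i _ => sq_nonneg _
    linarith
  have hfi : Integrable f μ := Integrable.of_bound hfm.aestronglyMeasurable 1
    (Filter.Eventually.of_forall fun ω => by
      rw [Real.norm_eq_abs, abs_of_pos (Real.exp_pos _)]
      exact hf1 ω)
  -- Markov's inequality
  have hmarkov : μ.real {ω | ‖Matrix.toEuclideanCLM (n := Fin n) (𝕜 := ℝ) (A ω) y - v‖ ≤ ρ} ≤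
      Real.exp (ρ ^ 2 / (2 * ε ^ 2)) * ∫ ω, f ω ∂μ := by
    have h1 := mul_meas_ge_le_integral_of_nonneg
      (Filter.Eventually.of_forall fun ω => (Real.exp_pos _).le : 0 ≤ᵐ[μ] f) hfi
      (Real.exp (-(ρ ^ 2 / (2 * ε ^ 2))))
    have h2 : {ω | ‖Matrix.toEuclideanCLM (n := Fin n) (𝕜 := ℝ) (A ω) y - v‖ ≤ ρ} ⊆
        {ω | Real.exp (-(ρ ^ 2 / (2 * ε ^ 2))) ≤ f ω} := by
      intro ω hω
      have hω' := pow_le_pow_left₀ (norm_nonneg _) (show ‖_‖ ≤ ρ from hω) 2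
      rw [EuclideanSpace.real_norm_sq_eq] at hω'
      have h3 : ∑ i, w ω i ^ 2 ≤ ρ ^ 2 / ε ^ 2 := by
        rw [le_div_iff₀ (by positivity), Finset.sum_mul]
        refine le_trans (Finset.sum_le_sum fun i _ => ?_) hω'
        rw [PiLp.sub_apply, toEuclideanCLM_apply_apply]
        by_cases h : i ∈ J
        · simp only [hw, h, if_true]
          rw [zero_pow two_ne_zero, zero_mul]
          positivity
        · simp only [hw, h, if_false]
          rw [div_pow, div_mul_cancel₀ _ (by positivity)]
      refine Real.exp_le_exp.2 ?_
      have h4 : ρ ^ 2 / (2 * ε ^ 2) = ρ ^ 2 / ε ^ 2 / 2 := by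
        field_simp
      rw [h4]
      linarith
    have h5 := measureReal_mono h2 (μ := μ)
    calc _ ≤ μ.real {ω | Real.exp (-(ρ ^ 2 / (2 * ε ^ 2))) ≤ f ω} := h5
      _ = Real.exp (ρ ^ 2 / (2 * ε ^ 2)) * (Real.exp (-(ρ ^ 2 / (2 * ε ^ 2))) *
          μ.real {ω | Real.exp (-(ρ ^ 2 / (2 * ε ^ 2))) ≤ f ω}) := by
        rw [← mul_assoc, ← Real.exp_add, add_neg_cancel, Real.exp_zero, one_mul]
      _ ≤ _ := mul_le_mul_of_nonneg_left h1 (Real.exp_pos _).le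
  refine hmarkov.trans (mul_le_mul_of_nonneg_left ?_ (Real.exp_pos _).le)
  -- the Gaussian weight as an average of characters
  set H : Ω → (Fin n → ℝ) → ℂ := fun ω g =>
    Complex.exp (((∑ i, g i * w ω i : ℝ) : ℂ) * Complex.I) with hH
  have hfH : ∀ ω, (f ω : ℂ) = ∫ g, H ω g ∂(Measure.pi fun _ : Fin n => γ) := by
    intro ω
    have h1 : ∀ g : Fin n → ℝ,
        H ω g = ∏ i, Complex.exp (((g i * w ω i : ℝ) : ℂ) * Complex.I) := by
      intro g
      rw [← Complex.exp_sum, ← Finset.sum_mul]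
      simp only [hH]
      push_cast
      rfl
    simp only [h1]
    rw [integral_fintype_prod_eq_prod
      (fun i x => Complex.exp (((x * w ω i : ℝ) : ℂ) * Complex.I))]
    simp only [hγ, ← exp_neg_sq_eq_integral_gaussian]
    rw [← Complex.exp_sum]
    simp only [hf, Complex.ofReal_exp]
    congr 1
    push_cast
    rw [← Finset.sum_div, Finset.sum_neg_distrib]
  have hHnorm : ∀ ω g, ‖H ω g‖ = 1 := fun ω g => Complex.norm_exp_ofReal_mul_I _
  have hHm : Measurable (Function.uncurry H) := by
    have : Measurable fun p : Ω × (Fin n → ℝ) => ∑ i, p.2 i * w p.1 i := by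
      refine Finset.measurable_sum _ fun i _ => Measurable.mul (by fun_prop) ?_
      exact (hwm i).comp measurable_fst
    simp only [hH, Function.uncurry_def]
    fun_prop
  have hHi : Integrable (Function.uncurry H) (μ.prod (Measure.pi fun _ : Fin n => γ)) :=
    Integrable.of_bound hHm.aestronglyMeasurable 1
      (Filter.Eventually.of_forall fun p => (hHnorm p.1 p.2).le)
  have hswap : ((∫ ω, f ω ∂μ : ℝ) : ℂ) =
      ∫ g, ∫ ω, H ω g ∂μ ∂(Measure.pi fun _ : Fin n => γ) := by
    rw [← integral_complex_ofReal]
    simp only [hfH]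
    exact integral_integral_swap hHi
  -- the factor of the row `i`
  set ψ : Fin n → ℝ → ℝ := fun i g =>
    ∏ j, if i ∉ J ∧ j ∈ J then ‖charFun ν (g * (y j / ε))‖ else 1 with hψ
  have hrow : ∀ g : Fin n → ℝ, ‖∫ ω, H ω g ∂μ‖ ≤ ∏ i, ψ i (g i) := by
    intro g
    set G : Fin n → ℝ := fun i => if i ∈ J then 0 else g i / ε with hG
    have h1 : ∀ ω, H ω g = Complex.exp (((-∑ i, G i * v i : ℝ) : ℂ) * Complex.I) *
        Complex.exp (((∑ i, G i * ∑ j, A ω i j * y j : ℝ) : ℂ) * Complex.I) := by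
      intro ω
      rw [← Complex.exp_add, ← add_mul, ← Complex.ofReal_add]
      simp only [hH]
      congr 3
      rw [← Finset.sum_neg_distrib, ← Finset.sum_add_distrib]
      refine Finset.sum_congr rfl fun i _ => ?_
      by_cases h : i ∈ J
      · simp [hw, hG, h]
      · simp only [hw, hG, h, if_false]
        ring
    simp only [h1]
    rw [integral_const_mul, norm_mul, Complex.norm_exp_ofReal_mul_I, one_mul]
    refine (hA.norm_integral_exp_le hν J G y fun j hj => by simp [hG, hj]).trans (le_of_eq ?_)
    refine Finset.prod_congr rfl fun i _ => Finset.prod_congr rfl fun j _ => ?_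
    split_ifs with h
    · simp only [hG, h.1, if_false]
      rw [div_mul_eq_mul_div, mul_div_assoc]
    · rfl
  by_cases hn : Nonempty {p : Fin n × Fin n // p.1 < p.2}
  swap
  · -- at most one index: one of `J` and its complement is empty
    have hno : ∀ i j : Fin n, i = j := by
      intro i j
      by_contra hij
      rcases lt_or_gt_of_ne hij with h | h
      · exact hn ⟨⟨(i, j), h⟩⟩
      · exact hn ⟨⟨(j, i), h⟩⟩
    have h1 : ∫ ω, f ω ∂μ ≤ 1 := by
      have := integral_mono hfi (integrable_const (1 : ℝ)) hf1
      simpa using this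
    refine h1.trans (le_of_eq ?_)
    rcases J.eq_empty_or_nonempty with hJ | ⟨j, hj⟩
    · simp [hJ]
    · have : Jᶜ = ∅ := by
        ext i
        simp [hno i j, hj]
      simp [this]
  obtain ⟨p0⟩ := hn
  have hνp : IsProbabilityMeasure ν := by
    rw [← hν _ _ p0.2]
    exact Measure.isProbabilityMeasure_map (hA.measurable _ _ p0.2).aemeasurable
  have hψm : ∀ i, Measurable (ψ i) := by
    intro i
    refine Finset.measurable_prod _ fun j _ => ?_
    split_ifs
    · exact (measurable_charFun.comp (measurable_id.mul_const _)).norm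
    · exact measurable_const
  have hψ0 : ∀ i x, 0 ≤ ψ i x := fun i x => Finset.prod_nonneg fun j _ => by
    split_ifs <;> simp
  have hψ1 : ∀ i x, ψ i x ≤ 1 := fun i x => Finset.prod_le_one
    (fun j _ => by split_ifs <;> simp) fun j _ => by
      split_ifs
      · exact norm_charFun_le_one _
      · exact le_rfl
  have hfinal : ∫ ω, f ω ∂μ ≤ ∏ i, ∫ x, ψ i x ∂γ := by
    have h1 : ∫ ω, f ω ∂μ = ‖((∫ ω, f ω ∂μ : ℝ) : ℂ)‖ := by
      rw [Complex.norm_real, Real.norm_eq_abs, abs_of_nonneg]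
      exact integral_nonneg fun ω => (Real.exp_pos _).le
    rw [h1, hswap, ← integral_fintype_prod_eq_prod (𝕜 := ℝ) (fun i x => ψ i x)]
    refine norm_integral_le_of_norm_le ?_ (Filter.Eventually.of_forall hrow)
    refine Integrable.of_bound ?_ 1 (Filter.Eventually.of_forall fun g => ?_)
    · exact (Finset.measurable_prod _ fun i _ =>
        (hψm i).comp (measurable_pi_apply i)).aestronglyMeasurable
    · rw [Real.norm_eq_abs, abs_of_nonneg (Finset.prod_nonneg fun i _ => hψ0 i _)]
      exact Finset.prod_le_one (fun i _ => hψ0 i _) fun i _ => hψ1 i _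
  refine hfinal.trans (le_of_eq ?_)
  have h2 : ∀ i, ∫ x, ψ i x ∂γ =
      if i ∈ Jᶜ then ∫ g, ∏ j ∈ J, ‖charFun ν (g * (y j / ε))‖ ∂γ else 1 := by
    intro i
    by_cases h : i ∈ J
    · simp [hψ, h]
    · simp [hψ, h, Finset.prod_ite]
  simp only [h2]
  rw [Finset.prod_ite_mem, Finset.univ_inter, Finset.prod_const]

end


/-! ### Gaussian averages of characteristic functions -/

lemma half_sq_sub_half_pow_four_le_one_sub_cos (u : ℝ) :
    u ^ 2 / 2 - u ^ 4 / 2 ≤ 1 - Real.cos u := by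
  rcases le_total |u| 1 with h | h
  · have h1 := (abs_le.1 (Real.cos_bound h)).2
    rw [Even.pow_abs (by decide : Even 4)] at h1
    nlinarith [pow_nonneg (sq_nonneg u) 2]
  · have h1 : 1 ≤ u ^ 2 := by
      rw [← sq_abs]
      exact one_le_pow₀ h
    nlinarith [Real.cos_le_one u]

lemma eight_mul_sub_round_sq_le (t : ℝ) :
    8 * (t - round t) ^ 2 ≤ 1 - Real.cos (2 * Real.pi * t) := by
  have h1 : Real.cos (2 * Real.pi * t) = Real.cos (2 * Real.pi * (t - round t)) := by
    rw [← Real.cos_sub_int_mul_two_pi _ (round t)]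
    congr 1
    ring
  have h2 := abs_sub_round t
  have h3 := Real.cos_le_one_sub_mul_cos_sq (x := 2 * Real.pi * (t - round t)) (by
    rw [abs_mul, abs_of_pos Real.two_pi_pos]
    nlinarith [Real.pi_pos])
  have h4 : 2 / Real.pi ^ 2 * (2 * Real.pi * (t - round t)) ^ 2 = 8 * (t - round t) ^ 2 := by
    have := Real.pi_ne_zero
    field_simp
    ring
  rw [h1]
  linarith

lemma infDist_integerLattice_sq_le {ι : Type*} [Fintype ι] (x : EuclideanSpace ℝ ι) (t : ℝ) :
    8 * Metric.infDist (t • x) (integerLattice ι) ^ 2 ≤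
      ∑ j, (1 - Real.cos (2 * Real.pi * (t * x j))) := by
  set z : EuclideanSpace ℝ ι := WithLp.toLp 2 fun j => (round (t * x j) : ℝ) with hz
  have hzm : z ∈ integerLattice ι := fun j => ⟨round (t * x j), rfl⟩
  have h1 := Metric.infDist_le_dist_of_mem (x := t • x) hzm
  have h2 := pow_le_pow_left₀ Metric.infDist_nonneg h1 2
  rw [EuclideanSpace.dist_eq, Real.sq_sqrt (Finset.sum_nonneg fun _ _ => sq_nonneg _)] at h2
  refine (mul_le_mul_of_nonneg_left h2 (by norm_num)).trans ?_
  rw [Finset.mul_sum]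
  refine Finset.sum_le_sum fun j _ => ?_
  rw [Real.dist_eq, sq_abs]
  exact eight_mul_sub_round_sq_le _

lemma le_infDist_of_lt_lcd {ι : Type*} [Fintype ι] {L t : ℝ} {x : EuclideanSpace ℝ ι}
    (ht : 0 < t) (h : t < lcd L x) :
    L * Real.sqrt (Real.posLog (t / L)) ≤ Metric.infDist (t • x) (integerLattice ι) := by
  by_contra hlt
  exact notMem_of_lt_csInf h ⟨0, fun s hs => hs.1.le⟩ ⟨ht, not_le.1 hlt⟩

lemma gaussianReal_abs_ge_le {s : ℝ} (hs : 0 ≤ s) :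
    (gaussianReal 0 1).real {g | s ≤ |g|} ≤ 2 * Real.exp (-(s ^ 2 / 2)) := by
  set γ := gaussianReal 0 1 with hγ
  have hid : γ.map (fun g : ℝ => g) = gaussianReal 0 1 := Measure.map_id
  have h1 := measure_ge_le_exp_mul_mgf (μ := γ) (X := fun g : ℝ => g) s hs
    (integrable_exp_mul_gaussianReal s)
  have h2 := measure_le_le_exp_mul_mgf (μ := γ) (X := fun g : ℝ => g) (-s) (neg_nonpos.2 hs)
    (integrable_exp_mul_gaussianReal (-s))
  rw [mgf_gaussianReal hid, ← Real.exp_add] at h1 h2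
  have h3 : {g : ℝ | s ≤ |g|} ⊆ {g | s ≤ g} ∪ {g | g ≤ -s} := by
    intro g hg
    rcases le_abs.1 (show s ≤ |g| from hg) with h | h
    · exact Or.inl h
    · exact Or.inr (by simpa using le_neg.1 h)
  have h4 := (measureReal_mono (μ := γ) h3).trans (measureReal_union_le _ _)
  have e1 : -s * s + (0 * s + ((1 : NNReal) : ℝ) * s ^ 2 / 2) = -(s ^ 2 / 2) := by
    push_cast
    ring
  have e2 : - -s * -s + (0 * -s + ((1 : NNReal) : ℝ) * (-s) ^ 2 / 2) = -(s ^ 2 / 2) := by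
    push_cast
    ring
  rw [e1] at h1
  rw [e2] at h2
  linarith

lemma integral_gaussianReal_inv_one_add_sq_le {a : ℝ} (ha : 0 < a) :
    Integrable (fun g : ℝ => 2 * (1 + (g / a) ^ 2)⁻¹) (gaussianReal 0 1) ∧
    ∫ g, 2 * (1 + (g / a) ^ 2)⁻¹ ∂(gaussianReal 0 1) ≤ 2 * Real.pi * a := by
  have hb : ∀ g : ℝ, (1 + (g / a) ^ 2)⁻¹ ≤ 1 := fun g =>
    inv_le_one_of_one_le₀ (by nlinarith [sq_nonneg (g / a)])
  have h0 : ∀ g : ℝ, 0 ≤ (1 + (g / a) ^ 2)⁻¹ := fun g => by positivity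
  refine ⟨Integrable.of_bound (by fun_prop) 2 (Filter.Eventually.of_forall fun g => ?_), ?_⟩
  · rw [Real.norm_eq_abs, abs_of_nonneg (by linarith [h0 g])]
    linarith [hb g]
  · have hint : Integrable fun g : ℝ => 2 * (1 + (g / a) ^ 2)⁻¹ :=
      (integrable_inv_one_add_sq.comp_div ha.ne').const_mul 2
    have hpdf : ∀ g, gaussianPDFReal 0 1 g ≤ 1 := by
      intro g
      rw [gaussianPDFReal_def]
      have h1 : (√(2 * Real.pi * ((1 : NNReal) : ℝ)))⁻¹ ≤ 1 := by
        refine inv_le_one_of_one_le₀ ?_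
        rw [Real.one_le_sqrt]
        push_cast
        linarith [Real.pi_gt_three]
      have h2 : Real.exp (-(g - 0) ^ 2 / (2 * ((1 : NNReal) : ℝ))) ≤ 1 := by
        rw [Real.exp_le_one_iff]
        push_cast
        nlinarith [sq_nonneg g]
      exact mul_le_one₀ h1 (Real.exp_pos _).le h2
    rw [integral_gaussianReal_eq_integral_smul one_ne_zero]
    calc ∫ g, gaussianPDFReal 0 1 g • (2 * (1 + (g / a) ^ 2)⁻¹)
        ≤ ∫ g : ℝ, 2 * (1 + (g / a) ^ 2)⁻¹ := by
          refine integral_mono_of_nonneg (Filter.Eventually.of_forall fun g => ?_) hint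
            (Filter.Eventually.of_forall fun g => ?_)
          · exact mul_nonneg (gaussianPDFReal_nonneg _ _ _) (by linarith [h0 g])
          · exact mul_le_of_le_one_left (by linarith [h0 g]) (hpdf g)
      _ = 2 * Real.pi * a := by
          rw [integral_const_mul, Measure.integral_comp_div (fun g : ℝ => (1 + g ^ 2)⁻¹) a,
            integral_univ_inv_one_add_sq, abs_of_pos ha, smul_eq_mul]
          ring

lemma integrable_prod_norm_charFun {ι : Type*} (κ ν : Measure ℝ) [IsFiniteMeasure κ]
    [IsProbabilityMeasure ν] (J : Finset ι) (a : ι → ℝ) :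
    Integrable (fun g => ∏ j ∈ J, ‖charFun ν (g * a j)‖) κ := by
  refine Integrable.of_bound ?_ 1 (Filter.Eventually.of_forall fun g => ?_)
  · exact (Finset.measurable_prod _ fun i _ =>
      (measurable_charFun.comp (measurable_id.mul_const _)).norm).aestronglyMeasurable
  · rw [Real.norm_eq_abs, abs_of_nonneg (Finset.prod_nonneg fun i _ => norm_nonneg _)]
    exact Finset.prod_le_one (fun i _ => norm_nonneg _) fun i _ => norm_charFun_le_one _

/-- A linear form in independent normalized variables whose coefficients are not small has a
nontrivial small ball probability: its characteristic function is bounded away from one, uniformly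
in the law, on a set of positive Gaussian measure. -/
theorem exists_integral_prod_norm_charFun_le (M : ℝ) :
    ∃ δ : ℝ, 0 < δ ∧ ∀ ν : Measure ℝ, IsProbabilityMeasure ν → IsNormalizedLaw ν M →
      ∀ (ι : Type) (J : Finset ι) (a : ι → ℝ), 1 / 8 ≤ ∑ j ∈ J, a j ^ 2 →
        (∀ j ∈ J, |a j| ≤ 2) →
        ∫ g, ∏ j ∈ J, ‖charFun ν (g * a j)‖ ∂(gaussianReal 0 1) ≤ 1 - δ := by
  set γ := gaussianReal 0 1 with hγ
  set M1 : ℝ := max (16 * M) 1 with hM1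
  have hM1p : 1 ≤ M1 := le_max_right _ _
  -- for `|g| ≤ g0` the fourth order term of the cosine is at most half of the quadratic one
  set g0 : ℝ := 1 / (2 * M1) with hg0
  have hg0p : 0 < g0 := by positivity
  set S : Set ℝ := Set.Icc (g0 / 2) g0 with hS
  set η : ℝ := 1 - Real.exp (-(g0 ^ 2 / 128)) with hη
  have hηp : 0 < η := by
    have : Real.exp (-(g0 ^ 2 / 128)) < 1 := by
      rw [Real.exp_lt_one_iff]
      have : 0 < g0 ^ 2 / 128 := by positivity
      linarith
    linarith
  have hSp : 0 < γ.real S := by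
    rw [measureReal_def, ENNReal.toReal_pos_iff]
    refine ⟨pos_iff_ne_zero.2 fun h => ?_, measure_lt_top _ _⟩
    have h1 := gaussianReal_absolutelyContinuous' 0 one_ne_zero h
    rw [hS, Real.volume_Icc, ENNReal.ofReal_eq_zero] at h1
    linarith
  refine ⟨γ.real S * η, by positivity, fun ν _ hν ι J a ha ha2 => ?_⟩
  have hpt : ∀ g, ∏ j ∈ J, ‖charFun ν (g * a j)‖ ≤ 1 - S.indicator (fun _ => η) g := by
    intro g
    by_cases hg : g ∈ S
    · rw [Set.indicator_of_mem hg]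
      refine (prod_norm_charFun_le_exp ν J _).trans ?_
      have h1 : g0 ^ 2 / 4 ≤ g ^ 2 := by
        have := pow_le_pow_left₀ (by positivity) hg.1 2
        nlinarith
      have h2 : g ^ 2 ≤ g0 ^ 2 :=
        pow_le_pow_left₀ (le_trans (by positivity) hg.1) hg.2 2
      have hterm : ∀ j ∈ J, (g * a j) ^ 2 / 2 ≤
          ∫ z, (1 - Real.cos (g * a j * z)) ∂(symmetrization ν) := by
        intro j hj
        set s := g * a j with hs
        have hs2 : s ^ 2 * M1 ≤ 1 := by
          have h3 : a j ^ 2 ≤ 4 := by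
            have := pow_le_pow_left₀ (abs_nonneg _) (ha2 j hj) 2
            rw [sq_abs] at this
            linarith
          have h4 : s ^ 2 ≤ g0 ^ 2 * 4 := by
            rw [hs, mul_pow]
            exact mul_le_mul h2 h3 (sq_nonneg _) (sq_nonneg _)
          have h5 : g0 ^ 2 * 4 * M1 = 1 / M1 := by
            rw [hg0]
            field_simp
            norm_num
          have h6 : 1 / M1 ≤ 1 := by
            rw [div_le_one (by positivity)]
            exact hM1p
          nlinarith
        have h3 : Integrable (fun z : ℝ => s ^ 2 / 2 * z ^ 2) (symmetrization ν) :=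
          hν.integrable_symm_pow_two.const_mul _
        have h4 : Integrable (fun z : ℝ => s ^ 4 / 2 * z ^ 4) (symmetrization ν) :=
          hν.integrable_symm_pow_four.const_mul _
        have h5 := integral_mono (h3.sub h4)
          ((integrable_const (1 : ℝ)).sub (integrable_cos_mul (symmetrization ν) s))
          (fun z => by
            have := half_sq_sub_half_pow_four_le_one_sub_cos (s * z)
            simp only [Pi.sub_apply]
            calc _ = (s * z) ^ 2 / 2 - (s * z) ^ 4 / 2 := by ring
              _ ≤ _ := this)
        simp only [Pi.sub_apply] at h5
        rw [integral_sub h3 h4, integral_const_mul, integral_const_mul,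
          hν.integral_symm_pow_two] at h5
        have h6 : ∫ z, z ^ 4 ∂(symmetrization ν) ≤ M1 :=
          hν.integral_symm_pow_four_le.trans (le_max_left _ _)
        have h7 : s ^ 4 / 2 * ∫ z, z ^ 4 ∂(symmetrization ν) ≤ s ^ 4 / 2 * M1 :=
          mul_le_mul_of_nonneg_left h6 (by positivity)
        have h8 : s ^ 4 / 2 * M1 ≤ s ^ 2 / 2 := by
          nlinarith [sq_nonneg s]
        linarith
      have hi : ∀ j ∈ J, Integrable (fun z => 1 - Real.cos (g * a j * z)) (symmetrization ν) :=
        fun j _ => (integrable_const _).sub (integrable_cos_mul _ _)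
      rw [integral_finsetSum _ hi]
      have h3 := Finset.sum_le_sum hterm
      have h4 : ∑ j ∈ J, (g * a j) ^ 2 / 2 = g ^ 2 / 2 * ∑ j ∈ J, a j ^ 2 := by
        rw [Finset.mul_sum]
        exact Finset.sum_congr rfl fun j _ => by ring
      rw [h4] at h3
      have h5 : g0 ^ 2 / 64 ≤ g ^ 2 / 2 * ∑ j ∈ J, a j ^ 2 := by nlinarith [sq_nonneg g]
      rw [hη, sub_sub_cancel, Real.exp_le_exp]
      linarith
    · rw [Set.indicator_of_notMem hg, sub_zero]
      exact Finset.prod_le_one (fun i _ => norm_nonneg _) fun i _ => norm_charFun_le_one _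
  have hSi : Integrable (S.indicator fun _ => η) γ :=
    (integrable_const η).indicator measurableSet_Icc
  have h := integral_mono (integrable_prod_norm_charFun γ ν J a)
    ((integrable_const (1 : ℝ)).sub hSi) hpt
  simp only [Pi.sub_apply] at h
  rw [integral_sub (integrable_const _) hSi, integral_indicator_const _ measurableSet_Icc] at h
  simpa using h

/-- The arithmetic bound: below the least common denominator the characteristic function of the
linear form decays polynomially, and frequencies beyond it are cut off by the Gaussian weight. -/
theorem integral_prod_norm_charFun_le_of_lcd {ν : Measure ℝ} [IsProbabilityMeasure ν] {M B : ℝ}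
    (hν : IsNormalizedLaw ν M) (hB : 0 < B) (hMB : 32 * M ≤ B ^ 2) {ι : Type*} [Fintype ι]
    (x : EuclideanSpace ℝ ι) {L D b : ℝ} (hL : 0 < L) (hBL : B ≤ L) (hb : 0 < b) (hD : 0 ≤ D)
    (hlcd : D ≤ lcd L x) :
    ∫ g, ∏ j, ‖charFun ν (g * (b * x j))‖ ∂(gaussianReal 0 1) ≤
      4 * Real.pi ^ 2 * L / b + 2 * Real.exp (-((2 * Real.pi * D / (b * B)) ^ 2 / 2)) := by
  set γ := gaussianReal 0 1 with hγ
  set s : ℝ := 2 * Real.pi * D / (b * B) with hs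
  set a : ℝ := 2 * Real.pi * L / b with ha
  have hpi := Real.pi_pos
  have hap : 0 < a := by positivity
  set κ := symmetrization ν with hκ
  set S : Set ℝ := {z | 1 ≤ |z| ∧ |z| ≤ B} with hS
  have hSm : MeasurableSet S :=
    (measurableSet_le (f := fun _ : ℝ => (1 : ℝ)) measurable_const measurable_norm).inter
      (measurableSet_le (g := fun _ : ℝ => B) measurable_norm measurable_const)
  have hp : 1 / (2 * B ^ 2) ≤ κ.real S := hν.le_symmetrization_annulus hB hMB
  set T : Set ℝ := {g | s ≤ |g|} with hT
  have hTm : MeasurableSet T :=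
    measurableSet_le (f := fun _ : ℝ => s) measurable_const measurable_norm
  have hpt : ∀ g, ∏ j, ‖charFun ν (g * (b * x j))‖ ≤
      2 * (1 + (g / a) ^ 2)⁻¹ + T.indicator (fun _ => 1) g := by
    intro g
    have h0 : 0 ≤ 2 * (1 + (g / a) ^ 2)⁻¹ := by positivity
    have hle1 : ∏ j, ‖charFun ν (g * (b * x j))‖ ≤ 1 :=
      Finset.prod_le_one (fun i _ => norm_nonneg _) fun i _ => norm_charFun_le_one _
    by_cases hgT : g ∈ T
    · rw [Set.indicator_of_mem hgT]
      linarith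
    rw [Set.indicator_of_notMem hgT, add_zero]
    have hgs : |g| < s := not_le.1 hgT
    by_cases hga : |g| ≤ a
    · have : (1 : ℝ) ≤ 2 * (1 + (g / a) ^ 2)⁻¹ := by
        have h1 : (g / a) ^ 2 ≤ 1 := by
          rw [← sq_abs, abs_div, abs_of_pos hap]
          exact pow_le_one₀ (by positivity) ((div_le_one hap).2 hga)
        rw [← div_eq_mul_inv, one_le_div (by positivity)]
        linarith
      linarith
    have hga' : a < |g| := not_le.1 hga
    set t : ℝ := |g| / a with ht
    have ht1 : 1 < t := (one_lt_div hap).2 hga'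
    -- for `z` in the annulus the frequency lies between the scale `L` and the denominator
    have hz : ∀ z ∈ S, 8 * L ^ 2 * Real.log t ≤ ∑ j, (1 - Real.cos (g * (b * x j) * z)) := by
      intro z hz
      set θ : ℝ := |g| * b * |z| / (2 * Real.pi) with hθ
      have hg0 : 0 < |g| := hap.trans hga'
      have hz0 : 0 < |z| := lt_of_lt_of_le one_pos hz.1
      have hθ0 : 0 < θ := by positivity
      have hθD : θ < lcd L x := by
        refine lt_of_lt_of_le ?_ hlcd
        have h1 : |g| * |z| < s * B :=
          mul_lt_mul hgs hz.2 hz0 (le_trans (abs_nonneg g) hgs.le)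
        have h2 : s * B = 2 * Real.pi * D / b := by
          rw [hs]
          field_simp
        rw [h2, lt_div_iff₀ hb] at h1
        rw [hθ, div_lt_iff₀ (by positivity)]
        linarith
      have h1 := le_infDist_of_lt_lcd hθ0 hθD
      have h2 := infDist_integerLattice_sq_le x θ
      have h3 : t ≤ θ / L := by
        have : θ / L = t * |z| := by
          rw [hθ, ht, ha]
          field_simp
        rw [this]
        exact le_mul_of_one_le_right (by positivity) hz.1
      have h4 : Real.log t ≤ Real.posLog (θ / L) :=
        (Real.log_le_log (by positivity) h3).trans (by simp [Real.posLog])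
      have h5 := pow_le_pow_left₀ (by positivity) h1 2
      rw [mul_pow, Real.sq_sqrt Real.posLog_nonneg] at h5
      have h6 : ∀ j, Real.cos (2 * Real.pi * (θ * x j)) = Real.cos (g * (b * x j) * z) := by
        intro j
        rw [← Real.cos_abs, ← Real.cos_abs (g * (b * x j) * z)]
        congr 1
        rw [hθ]
        simp only [abs_mul, abs_div, abs_abs, abs_of_pos hb, abs_of_pos hpi, abs_two]
        field_simp
      simp only [h6] at h2
      have h7 : L ^ 2 * Real.log t ≤ L ^ 2 * Real.posLog (θ / L) :=
        mul_le_mul_of_nonneg_left h4 (by positivity)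
      linarith
    have hlog : 0 < Real.log t := Real.log_pos ht1
    have hWi : Integrable (fun z => ∑ j, (1 - Real.cos (g * (b * x j) * z))) κ :=
      integrable_finsetSum _ fun j _ => (integrable_const (1 : ℝ)).sub (integrable_cos_mul κ _)
    have hint : κ.real S * (8 * L ^ 2 * Real.log t) ≤
        ∫ z, ∑ j, (1 - Real.cos (g * (b * x j) * z)) ∂κ := by
      have h1 := integral_mono ((integrable_const (8 * L ^ 2 * Real.log t)).indicator hSm) hWi
        (fun z => by
          by_cases hzS : z ∈ S
          · rw [Set.indicator_of_mem hzS]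
            exact hz z hzS
          · rw [Set.indicator_of_notMem hzS]
            exact Finset.sum_nonneg fun j _ => sub_nonneg.2 (Real.cos_le_one _))
      rwa [integral_indicator_const _ hSm, smul_eq_mul] at h1
    -- the annulus has probability at least `1 / (2 B²)` and `B ≤ L`
    have hfour : 4 * Real.log t ≤ κ.real S * (8 * L ^ 2 * Real.log t) := by
      have h1 : B ^ 2 ≤ L ^ 2 := pow_le_pow_left₀ hB.le hBL 2
      have h2 : 1 ≤ κ.real S * (2 * B ^ 2) := by
        rwa [div_le_iff₀ (by positivity)] at hp
      have h3 : 1 ≤ κ.real S * (2 * L ^ 2) :=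
        h2.trans (mul_le_mul_of_nonneg_left (by linarith) measureReal_nonneg)
      nlinarith
    refine (prod_norm_charFun_le_exp ν Finset.univ _).trans ?_
    have h1 : Real.exp (-(1 / 2) * ∫ z, ∑ j, (1 - Real.cos (g * (b * x j) * z)) ∂κ) ≤
        Real.exp (-(2 * Real.log t)) := Real.exp_le_exp.2 (by linarith)
    refine h1.trans ?_
    have h2 : Real.exp (-(2 * Real.log t)) = (t ^ 2)⁻¹ := by
      rw [Real.exp_neg, mul_comm, Real.exp_mul, Real.exp_log (by positivity)]
      norm_num
    have h3 : (g / a) ^ 2 = t ^ 2 := by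
      rw [ht, div_pow g, div_pow |g|, sq_abs]
    rw [h2, h3, ← div_eq_mul_inv, inv_eq_one_div, div_le_div_iff₀ (by positivity) (by positivity)]
    nlinarith
  obtain ⟨hi1, hle⟩ := integral_gaussianReal_inv_one_add_sq_le hap
  have hTi : Integrable (T.indicator fun _ => (1 : ℝ)) γ := (integrable_const 1).indicator hTm
  have h := integral_mono (integrable_prod_norm_charFun γ ν Finset.univ fun j => b * x j)
    (hi1.add hTi) hpt
  simp only [Pi.add_apply] at h
  rw [integral_add hi1 hTi, integral_indicator_const _ hTm] at h
  have h2 := gaussianReal_abs_ge_le (s := s) (by positivity)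
  have h3 : 2 * Real.pi * a = 4 * Real.pi ^ 2 * L / b := by
    rw [ha]
    ring
  rw [smul_eq_mul, mul_one] at h
  linarith


/-! ### Counting integer points and union bounds -/

lemma sum_Icc_pow_natAbs {r : ℝ} (hr : r ≠ 1) (R : ℕ) :
    ∑ k ∈ Finset.Icc (-(R : ℤ)) R, r ^ k.natAbs = (1 + r - 2 * r ^ (R + 1)) / (1 - r) := by
  have h1 : 1 - r ≠ 0 := sub_ne_zero.2 hr.symm
  induction R with
  | zero =>
    simp
    field_simp
    ring
  | succ R ih =>
    have h : Finset.Icc (-((R + 1 : ℕ) : ℤ)) ((R + 1 : ℕ) : ℤ) =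
        insert ((R + 1 : ℕ) : ℤ) (insert (-((R + 1 : ℕ) : ℤ)) (Finset.Icc (-(R : ℤ)) R)) := by
      ext k
      simp only [Finset.mem_Icc, Finset.mem_insert]
      push_cast
      omega
    rw [h, Finset.sum_insert, Finset.sum_insert, ih]
    · rw [Int.natAbs_neg, Int.natAbs_natCast]
      field_simp
      ring
    · simp
    · simp only [Finset.mem_insert, Finset.mem_Icc, not_or]
      push_cast
      omega

/-- Integer points of an `ℓ¹` ball, counted by comparison with the exponential weight
`exp (-s ∑ |q i|)`. -/
lemma exists_finset_card_le_of_sum_abs_le (ι : Type*) [Fintype ι] (M : ℝ) {s : ℝ} (hs : 0 < s) :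
    ∃ F : Finset (ι → ℤ), (∀ q : ι → ℤ, ∑ i, |(q i : ℝ)| ≤ M → q ∈ F) ∧
      (F.card : ℝ) ≤ Real.exp (s * M) * (1 + 2 / (Real.exp s - 1)) ^ Fintype.card ι := by
  classical
  set R : ℕ := ⌊M⌋₊ with hR
  set Box : Finset (ι → ℤ) := Fintype.piFinset fun _ => Finset.Icc (-(R : ℤ)) R with hBox
  refine ⟨Box.filter fun q => ∑ i, |(q i : ℝ)| ≤ M, fun q hq => ?_, ?_⟩
  · refine Finset.mem_filter.2 ⟨Fintype.mem_piFinset.2 fun i => ?_, hq⟩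
    have h1 : |(q i : ℝ)| ≤ M :=
      (Finset.single_le_sum (fun j _ => abs_nonneg (q j : ℝ)) (Finset.mem_univ i)).trans hq
    have h2 : ((q i).natAbs : ℝ) ≤ M := by
      rwa [Nat.cast_natAbs, Int.cast_abs]
    have h3 : (q i).natAbs ≤ R := Nat.le_floor h2
    rw [Finset.mem_Icc]
    omega
  · set r : ℝ := Real.exp (-s) with hr
    have hr0 : 0 < r := Real.exp_pos _
    have hr1 : r < 1 := Real.exp_lt_one_iff.2 (neg_lt_zero.2 hs)
    have hw : ∀ q : ι → ℤ, Real.exp (-(s * ∑ i, |(q i : ℝ)|)) = ∏ i, r ^ (q i).natAbs := by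
      intro q
      rw [Finset.mul_sum, ← Finset.sum_neg_distrib, Real.exp_sum]
      refine Finset.prod_congr rfl fun i _ => ?_
      rw [hr, ← Real.exp_nat_mul, Nat.cast_natAbs, Int.cast_abs]
      congr 1
      ring
    calc ((Box.filter fun q => ∑ i, |(q i : ℝ)| ≤ M).card : ℝ)
        = ∑ q ∈ Box.filter fun q => ∑ i, |(q i : ℝ)| ≤ M, (1 : ℝ) := by simp
      _ ≤ ∑ q ∈ Box.filter fun q => ∑ i, |(q i : ℝ)| ≤ M,
            Real.exp (s * M) * ∏ i, r ^ (q i).natAbs := by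
          refine Finset.sum_le_sum fun q hq => ?_
          rw [← hw, ← Real.exp_add]
          refine Real.one_le_exp ?_
          have := mul_le_mul_of_nonneg_left (Finset.mem_filter.1 hq).2 hs.le
          linarith
      _ ≤ ∑ q ∈ Box, Real.exp (s * M) * ∏ i, r ^ (q i).natAbs :=
          Finset.sum_le_sum_of_subset_of_nonneg (Finset.filter_subset _ _) fun q _ _ => by
            positivity
      _ = Real.exp (s * M) * ∏ _i : ι, ∑ k ∈ Finset.Icc (-(R : ℤ)) R, r ^ k.natAbs := by
          rw [← Finset.mul_sum, Finset.prod_univ_sum]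
      _ ≤ _ := by
          rw [Finset.prod_const, Finset.card_univ]
          refine mul_le_mul_of_nonneg_left (pow_le_pow_left₀
            (Finset.sum_nonneg fun _ _ => by positivity) ?_ _) (Real.exp_pos _).le
          rw [sum_Icc_pow_natAbs hr1.ne]
          have h1 : 1 + 2 / (Real.exp s - 1) = (1 + r) / (1 - r) := by
            have e : Real.exp s = r⁻¹ := by rw [hr, Real.exp_neg, inv_inv]
            have h2 : 1 - r ≠ 0 := by linarith
            rw [e]
            field_simp
            ring
          rw [h1]
          refine div_le_div_of_nonneg_right ?_ (by linarith)
          have : 0 < r ^ (R + 1) := by positivity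
          linarith

/-- The choice of weight `s = 1 / ρ` in the count of integer points with `∑ |q i| ≤ ρ |ι|`. -/
lemma exists_finset_card_le_exp_one_mul (ι : Type*) [Fintype ι] {ρ : ℝ} (hρ : 0 < ρ) :
    ∃ F : Finset (ι → ℤ),
      (∀ q : ι → ℤ, ∑ i, |(q i : ℝ)| ≤ ρ * Fintype.card ι → q ∈ F) ∧
      (F.card : ℝ) ≤ (3 * (1 + 2 * ρ)) ^ Fintype.card ι := by
  obtain ⟨F, h1, h2⟩ := exists_finset_card_le_of_sum_abs_le ι (ρ * Fintype.card ι)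
    (one_div_pos.2 hρ)
  refine ⟨F, h1, h2.trans ?_⟩
  have h3 : 1 / ρ * (ρ * Fintype.card ι) = Fintype.card ι * 1 := by
    field_simp
  have h4 := Real.add_one_le_exp (1 / ρ)
  have h5 : 2 / (Real.exp (1 / ρ) - 1) ≤ 2 * ρ := by
    have h6 : 0 < 1 / ρ := by positivity
    rw [div_le_iff₀ (by linarith)]
    have h7 : 2 * ρ * (1 / ρ) = 2 := by field_simp
    have h8 : 2 * ρ * (1 / ρ) ≤ 2 * ρ * (Real.exp (1 / ρ) - 1) :=
      mul_le_mul_of_nonneg_left (by linarith) (by positivity)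
    linarith
  have h9 : 0 < Real.exp (1 / ρ) - 1 := by
    have h6 : 0 < 1 / ρ := by positivity
    linarith
  rw [h3, Real.exp_nat_mul, ← mul_pow]
  refine pow_le_pow_left₀ (by positivity) ?_ _
  exact mul_le_mul (by linarith [Real.exp_one_lt_d9]) (by linarith) (by positivity) (by norm_num)

/-- A net of a set `S` can be moved into `S`: each net point that is close to a point of `S` is
replaced by such a point. Two points of `S` are then compared through a common net point. -/
lemma exists_finset_subset_of_cover {X Y : Type*} (S : Set X) (F : Finset Y)
    (R : X → Y → Prop) (h : ∀ x ∈ S, ∃ y ∈ F, R x y) :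
    ∃ F' : Finset X, (∀ x ∈ F', x ∈ S) ∧ F'.card ≤ F.card ∧
      ∀ x ∈ S, ∃ x' ∈ F', ∃ y, R x y ∧ R x' y := by
  classical
  rcases S.eq_empty_or_nonempty with rfl | ⟨x0, hx0⟩
  · exact ⟨∅, by simp, by simp, by simp⟩
  set g : Y → X := fun y => if hy : ∃ x ∈ S, R x y then hy.choose else x0 with hg
  refine ⟨F.image g, fun x hx => ?_, Finset.card_image_le, fun x hx => ?_⟩
  · obtain ⟨y, _, rfl⟩ := Finset.mem_image.1 hx
    by_cases hy : ∃ x ∈ S, R x y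
    · simp only [hg, hy, dif_pos]
      exact hy.choose_spec.1
    · simp only [hg, hy, dif_neg, not_false_iff]
      exact hx0
  · obtain ⟨y, hyF, hy⟩ := h x hx
    have hex : ∃ x ∈ S, R x y := ⟨x, hx, hy⟩
    refine ⟨g y, Finset.mem_image_of_mem g hyF, y, hy, ?_⟩
    simp only [hg, hex, dif_pos]
    exact hex.choose_spec.2

section

variable {Ω : Type*} [MeasurableSpace Ω] {μ : Measure Ω} [IsProbabilityMeasure μ] {n : ℕ}

lemma toEuclideanCLM_unitSolution {B : Matrix (Fin n) (Fin n) ℝ} (hB : IsUnit B.det)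
    {u : EuclideanSpace ℝ (Fin n)} (hu : u ≠ 0) :
    ‖unitSolution B u‖ = 1 ∧ ∃ τ : ℝ, 0 ≤ τ ∧
      Matrix.toEuclideanCLM (n := Fin n) (𝕜 := ℝ) B (unitSolution B u) = τ • normalize u := by
  set T := Matrix.toEuclideanCLM (n := Fin n) (𝕜 := ℝ) B with hT
  set w := Matrix.toEuclideanCLM (n := Fin n) (𝕜 := ℝ) B⁻¹ u with hw
  have hTw : T w = u := by
    rw [hT, hw, ← mul_apply_eq_comp, ← map_mul, Matrix.mul_nonsing_inv _ hB, map_one,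
      one_apply_eq_self]
  have hw0 : w ≠ 0 := fun h => hu (by rw [← hTw, h, map_zero])
  have hwn : ‖w‖ ≠ 0 := norm_ne_zero_iff.2 hw0
  have hun : ‖u‖ ≠ 0 := norm_ne_zero_iff.2 hu
  refine ⟨?_, ‖w‖⁻¹ * ‖u‖, by positivity, ?_⟩
  · rw [unitSolution, normalize, norm_smul, norm_inv, norm_norm, inv_mul_cancel₀ hwn]
  · rw [unitSolution, normalize, map_smul, hTw, normalize, smul_smul, mul_assoc,
      mul_inv_cancel₀ hun, mul_one]

/-- The union bound over a net of candidate directions and over a net of the segment of possible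
values of `A x` in the direction of `u`. -/
lemma measureReal_unitSolution_mem_le {A : Ω → Matrix (Fin n) (Fin n) ℝ} {K η P : ℝ}
    (hK : 0 < K) (hη : 0 < η) (hn : 0 < n) {u : EuclideanSpace ℝ (Fin n)} (hu : u ≠ 0)
    (S : Set (EuclideanSpace ℝ (Fin n))) (F : Finset (EuclideanSpace ℝ (Fin n)))
    (hF : ∀ x ∈ S, ‖x‖ = 1 → ∃ y ∈ F, ‖x - y‖ ≤ η)
    (hP0 : 0 ≤ P)
    (hP : ∀ y ∈ F, ∀ v, μ.real {ω | ‖Matrix.toEuclideanCLM (n := Fin n) (𝕜 := ℝ) (A ω) y - v‖ ≤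
      6 * K * η * Real.sqrt n} ≤ P) :
    μ.real ({ω | unitSolution (A ω) u ∈ S} ∩
      {ω | spectralNorm (A ω) ≤ 3 * K * Real.sqrt n} ∩ {ω | IsUnit (A ω).det}) ≤
      F.card * ((1 / η + 1) * P) := by
  have hsn : 0 < Real.sqrt n := Real.sqrt_pos.2 (by exact_mod_cast hn)
  set a : ℝ := 3 * K * η * Real.sqrt n with ha
  have hap : 0 < a := by positivity
  set N : ℕ := ⌊1 / η⌋₊ + 1 with hN
  set U : EuclideanSpace ℝ (Fin n) → ℕ → Set Ω := fun y j =>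
    {ω | ‖Matrix.toEuclideanCLM (n := Fin n) (𝕜 := ℝ) (A ω) y - ((j : ℝ) * a) • normalize u‖ ≤
      6 * K * η * Real.sqrt n} with hU
  have hsub : ({ω | unitSolution (A ω) u ∈ S} ∩
      {ω | spectralNorm (A ω) ≤ 3 * K * Real.sqrt n} ∩ {ω | IsUnit (A ω).det}) ⊆
      ⋃ y ∈ F, ⋃ j ∈ Finset.range N, U y j := by
    rintro ω ⟨⟨hS, hnorm⟩, hdet⟩
    simp only [Set.mem_ofPred_eq, spectralNorm] at hS hnorm hdet
    obtain ⟨hx1, τ, hτ0, hτ⟩ := toEuclideanCLM_unitSolution hdet hu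
    set T := Matrix.toEuclideanCLM (n := Fin n) (𝕜 := ℝ) (A ω) with hT
    set x := unitSolution (A ω) u with hx
    have hûn : ‖normalize u‖ = 1 := by
      rw [normalize, norm_smul, norm_inv, norm_norm, inv_mul_cancel₀ (norm_ne_zero_iff.2 hu)]
    obtain ⟨y, hyF, hy⟩ := hF x hS hx1
    have hτle : τ ≤ 3 * K * Real.sqrt n := by
      have h1 := T.le_opNorm x
      rw [hτ, norm_smul, hûn, hx1, mul_one, mul_one, Real.norm_eq_abs, abs_of_nonneg hτ0] at h1
      exact h1.trans hnorm
    have hja : τ / a ≤ 1 / η := by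
      rw [div_le_div_iff₀ hap hη, one_mul, ha]
      nlinarith
    refine Set.mem_biUnion hyF (Set.mem_biUnion (x := ⌊τ / a⌋₊) ?_ ?_)
    · simp only [hN, Finset.coe_range, Set.mem_Iio]
      exact Nat.lt_succ_of_le (Nat.floor_le_floor hja)
    · have h1 : (⌊τ / a⌋₊ : ℝ) * a ≤ τ :=
        (le_div_iff₀ hap).1 (Nat.floor_le (by positivity))
      have h2 : τ ≤ (⌊τ / a⌋₊ : ℝ) * a + a := by
        have := (div_lt_iff₀ hap).1 (Nat.lt_floor_add_one (τ / a))
        linarith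
      have h3 : T y - ((⌊τ / a⌋₊ : ℝ) * a) • normalize u =
          (τ - (⌊τ / a⌋₊ : ℝ) * a) • normalize u - T (x - y) := by
        rw [map_sub, hτ, sub_smul]
        abel
      have h4 : ‖T (x - y)‖ ≤ a := by
        refine (T.le_opNorm _).trans ?_
        calc ‖T‖ * ‖x - y‖ ≤ (3 * K * Real.sqrt n) * η :=
              mul_le_mul hnorm hy (norm_nonneg _) (by positivity)
          _ = a := by rw [ha]; ring
      simp only [hU, Set.mem_ofPred_eq]
      rw [h3]
      refine (norm_sub_le _ _).trans ?_
      rw [norm_smul, hûn, mul_one, Real.norm_eq_abs, abs_of_nonneg (by linarith)]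
      have : 6 * K * η * Real.sqrt n = a + a := by rw [ha]; ring
      linarith
  refine (measureReal_mono hsub (measure_ne_top μ _)).trans
    ((measureReal_biUnion_finset_le _ _).trans ?_)
  rw [← nsmul_eq_mul]
  refine Finset.sum_le_card_nsmul _ _ _ fun y hy => ?_
  refine (measureReal_biUnion_finset_le _ _).trans ?_
  refine (Finset.sum_le_card_nsmul _ _ P fun j _ => hP y hy _).trans ?_
  rw [Finset.card_range, nsmul_eq_mul]
  refine mul_le_mul_of_nonneg_right ?_ hP0
  rw [hN]
  push_cast
  have := Nat.floor_le (show 0 ≤ 1 / η by positivity)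
  linarith

end


/-! ### Compressible vectors -/

lemma sum_abs_le_sqrt_card_mul {ι : Type*} (s : Finset ι) (f : ι → ℝ) {R : ℝ} (hR : 0 ≤ R)
    (h : ∑ i ∈ s, f i ^ 2 ≤ R ^ 2) : ∑ i ∈ s, |f i| ≤ Real.sqrt s.card * R := by
  refine abs_le_of_sq_le_sq ?_ (by positivity) |> fun h => (le_abs_self _).trans h
  rw [mul_pow, Real.sq_sqrt (by positivity)]
  refine sq_sum_le_card_mul_sum_sq.trans ?_
  simp only [sq_abs]
  exact mul_le_mul_of_nonneg_left h (by positivity)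

lemma abs_sub_round_mul_le {h : ℝ} (hh : 0 < h) (t : ℝ) :
    |t - h * round (t / h)| ≤ h / 2 ∧ |(round (t / h) : ℝ)| ≤ |t| / h + 1 := by
  have h1 := abs_sub_round (t / h)
  have h2 : t - h * round (t / h) = h * (t / h - round (t / h)) := by
    field_simp
  constructor
  · rw [h2, abs_mul, abs_of_pos hh]
    nlinarith
  · have h3 := abs_sub_abs_le_abs_sub (round (t / h) : ℝ) (t / h)
    rw [abs_sub_comm, abs_div, abs_of_pos hh] at h3
    linarith

section

variable {Ω : Type*} [MeasurableSpace Ω] {μ : Measure Ω} [IsProbabilityMeasure μ] {n : ℕ}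
  {A : Ω → Matrix (Fin n) (Fin n) ℝ} {M4 : ℝ}

lemma SatisfiesA.exists_law (hA : SatisfiesA μ A M4) (hn : 2 ≤ n) :
    ∃ ν : Measure ℝ, IsProbabilityMeasure ν ∧ IsNormalizedLaw ν (M4 ^ 4) ∧
      ∀ i j, i < j → μ.map (fun ω => A ω i j) = ν := by
  set i0 : Fin n := ⟨0, by omega⟩
  set i1 : Fin n := ⟨1, by omega⟩
  have h01 : i0 < i1 := by simp [i0, i1]
  have hm : AEMeasurable (fun ω => A ω i0 i1) μ := (hA.measurable _ _ h01).aemeasurable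
  refine ⟨μ.map (fun ω => A ω i0 i1), Measure.isProbabilityMeasure_map hm, ⟨?_, ?_, ?_, ?_⟩,
    fun i j hij => (hA.identDistrib i j i0 i1 hij h01).map_eq⟩
  · rw [integrable_map_measure (by fun_prop) hm]
    exact hA.integrable_pow_four i0 i1 h01
  · rw [integral_map hm (by fun_prop)]
    exact hA.mean_zero i0 i1 h01
  · rw [integral_map hm (by fun_prop)]
    exact hA.second_moment i0 i1 h01
  · rw [integral_map hm (by fun_prop)]
    exact hA.fourth_moment i0 i1 h01

/-- For a fixed vector `y`, the half of the coordinates that carries at least half of the norm is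
tested against the other half of the rows. -/
lemma SatisfiesA.measureReal_norm_sub_le_exp (hA : SatisfiesA μ A M4) (hn : 2 ≤ n)
    {ν : Measure ℝ} (hν : ∀ i j, i < j → μ.map (fun ω => A ω i j) = ν) {δ : ℝ} (hδ0 : 0 < δ)
    (hδ : ∀ (J : Finset (Fin n)) (a : Fin n → ℝ), 1 / 8 ≤ ∑ j ∈ J, a j ^ 2 →
        (∀ j ∈ J, |a j| ≤ 2) →
        ∫ g, ∏ j ∈ J, ‖charFun ν (g * a j)‖ ∂(gaussianReal 0 1) ≤ 1 - δ)
    (y v : EuclideanSpace ℝ (Fin n)) (hy1 : 1 / 2 ≤ ‖y‖) (hy2 : ‖y‖ ≤ 2) {r : ℝ}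
    (hr : r ^ 2 ≤ δ * n / 4) :
    μ.real {ω | ‖Matrix.toEuclideanCLM (n := Fin n) (𝕜 := ℝ) (A ω) y - v‖ ≤ r} ≤
      Real.exp (-(δ * n / 8)) := by
  have key : ∃ J : Finset (Fin n), 1 / 8 ≤ ∑ j ∈ J, y j ^ 2 ∧ (n : ℝ) / 4 ≤ (Jᶜ).card := by
    set J0 : Finset (Fin n) := Finset.univ.filter fun i => (i : ℕ) < n / 2 with hJ0
    have hc : J0.card = n / 2 := by
      have h1 : J0 = (Finset.range (n / 2)).attachFin fun i hi => by
          rw [Finset.mem_range] at hi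
          omega := by
        ext i
        simp [hJ0]
      rw [h1, Finset.card_attachFin, Finset.card_range]
    have hc' : J0ᶜ.card = n - n / 2 := by
      rw [Finset.card_compl, Fintype.card_fin, hc]
    have hsum : ∑ j ∈ J0, y j ^ 2 + ∑ j ∈ J0ᶜ, y j ^ 2 = ‖y‖ ^ 2 := by
      rw [Finset.sum_add_sum_compl, EuclideanSpace.real_norm_sq_eq]
    by_cases h : 1 / 8 ≤ ∑ j ∈ J0, y j ^ 2
    · refine ⟨J0, h, ?_⟩
      rw [hc']
      have : n ≤ 4 * (n - n / 2) := by omega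
      have h2 : (n : ℝ) ≤ 4 * ((n - n / 2 : ℕ) : ℝ) := by exact_mod_cast this
      linarith
    · refine ⟨J0ᶜ, by nlinarith, ?_⟩
      rw [compl_compl, hc]
      have : n ≤ 4 * (n / 2) := by omega
      have h2 : (n : ℝ) ≤ 4 * ((n / 2 : ℕ) : ℝ) := by exact_mod_cast this
      linarith
  obtain ⟨J, hJ1, hJ2⟩ := key
  have hyj : ∀ j ∈ J, |y j| ≤ 2 := fun j _ => by
    have := PiLp.norm_apply_le y j
    rw [Real.norm_eq_abs] at this
    exact this.trans hy2
  have h1 := hA.measureReal_norm_sub_le hν J y v one_pos r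
  simp only [div_one, one_pow, mul_one] at h1
  refine h1.trans ?_
  have h2 := (hδ J (fun j => y j) hJ1 hyj).trans (Real.one_sub_le_exp_neg δ)
  have h3 : (∫ g, ∏ j ∈ J, ‖charFun ν (g * y j)‖ ∂(gaussianReal 0 1)) ^ (Jᶜ).card ≤
      Real.exp (-(δ * n / 4)) := by
    refine (pow_le_pow_left₀ (integral_nonneg fun g =>
      Finset.prod_nonneg fun _ _ => norm_nonneg _) h2 _).trans ?_
    rw [← Real.exp_nat_mul, Real.exp_le_exp]
    nlinarith
  calc _ ≤ Real.exp (r ^ 2 / 2) * Real.exp (-(δ * n / 4)) :=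
        mul_le_mul_of_nonneg_left h3 (Real.exp_pos _).le
    _ = Real.exp (r ^ 2 / 2 + -(δ * n / 4)) := (Real.exp_add _ _).symm
    _ ≤ _ := Real.exp_le_exp.2 (by linarith)

end

/-- A net of the compressible vectors, whose size is exponential with an arbitrarily small rate:
the points of `h ℤⁿ` near sparse vectors have small `ℓ¹` norm. -/
lemma exists_net_comp {n : ℕ} (hn : 0 < n) {η s t : ℝ} (hη : 0 < η) (hη1 : η ≤ 1 / 2)
    (hs : 0 < s) (ht : 0 < t) (ht1 : t ≤ 1) :
    ∃ F : Finset (EuclideanSpace ℝ (Fin n)),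
      (∀ x ∈ comp n (t ^ 2) (η / 4), ∃ y ∈ F, ‖x - y‖ ≤ η) ∧
      (∀ y ∈ F, 1 / 2 ≤ ‖y‖ ∧ ‖y‖ ≤ 2) ∧
      (F.card : ℝ) ≤ Real.exp (s * (n * (t * (4 / η + 1)))) *
        (1 + 2 / (Real.exp s - 1)) ^ n := by
  classical
  obtain ⟨F, hF, hcard⟩ :=
    exists_finset_card_le_of_sum_abs_le (Fin n) (n * (t * (4 / η + 1))) hs
  have hn' : (0 : ℝ) < n := by exact_mod_cast hn
  have hsn : 0 < Real.sqrt n := Real.sqrt_pos.2 hn'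
  have hsn2 : Real.sqrt n * Real.sqrt n = n := Real.mul_self_sqrt hn'.le
  set h : ℝ := η / (2 * Real.sqrt n) with hh
  have hhp : 0 < h := by positivity
  set Φ : (Fin n → ℤ) → EuclideanSpace ℝ (Fin n) :=
    fun q => WithLp.toLp 2 fun i => h * (q i : ℝ) with hΦ
  refine ⟨(F.image Φ).filter fun y => 1 / 2 ≤ ‖y‖ ∧ ‖y‖ ≤ 2, ?_, ?_, ?_⟩
  · rintro x ⟨hx1, hx2⟩
    have hne : (sparse n (t ^ 2)).Nonempty := ⟨0, by simp [sparse]; positivity⟩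
    obtain ⟨z, hz, hxz⟩ := (Metric.infDist_lt_iff hne).1
      (lt_of_le_of_lt hx2 (show η / 4 < η / 2 by linarith))
    rw [dist_eq_norm] at hxz
    set q : Fin n → ℤ := fun i => round (z i / h) with hq
    have hzn : ‖z‖ ≤ 2 := by
      have : ‖z‖ ≤ ‖x‖ + ‖x - z‖ := by
        rw [← norm_neg (x - z), neg_sub]
        calc ‖z‖ = ‖x + (z - x)‖ := by rw [add_sub_cancel]
          _ ≤ _ := norm_add_le _ _
      linarith
    have hzΦ : ‖z - Φ q‖ ≤ η / 2 := by
      refine abs_le_of_sq_le_sq ?_ (by positivity) |> fun h => (le_abs_self _).trans h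
      rw [EuclideanSpace.real_norm_sq_eq]
      have h1 : ∀ i, (z - Φ q) i ^ 2 ≤ h ^ 2 := by
        intro i
        rw [← sq_abs]
        refine pow_le_pow_left₀ (abs_nonneg _) ?_ 2
        have := (abs_sub_round_mul_le hhp (z i)).1
        rw [PiLp.sub_apply]
        simp only [hΦ, hq]
        linarith
      refine (Finset.sum_le_sum fun i _ => h1 i).trans (le_of_eq ?_)
      rw [Finset.sum_const, Finset.card_univ, Fintype.card_fin, nsmul_eq_mul, hh]
      field_simp
      nlinarith
    have hxΦ : ‖x - Φ q‖ ≤ η := by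
      calc ‖x - Φ q‖ = ‖(x - z) + (z - Φ q)‖ := by rw [sub_add_sub_cancel]
        _ ≤ ‖x - z‖ + ‖z - Φ q‖ := norm_add_le _ _
        _ ≤ η := by linarith
    have hqF : q ∈ F := by
      refine hF q ?_
      set I := Finset.univ.filter fun i => z i ≠ 0 with hI
      have hIc : (I.card : ℝ) ≤ t ^ 2 * n := hz
      have hsum : ∑ i, |(q i : ℝ)| = ∑ i ∈ I, |(q i : ℝ)| := by
        rw [hI, Finset.sum_filter]
        refine Finset.sum_congr rfl fun i _ => ?_
        by_cases hzi : z i = 0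
        · simp [hq, hzi]
        · simp [hzi]
      have hl1 : ∑ i ∈ I, |z i| ≤ Real.sqrt I.card * 2 := by
        refine sum_abs_le_sqrt_card_mul I (fun i => z i) zero_le_two ?_
        refine (Finset.sum_le_univ_sum_of_nonneg fun i => sq_nonneg _).trans ?_
        rw [← EuclideanSpace.real_norm_sq_eq]
        exact pow_le_pow_left₀ (norm_nonneg _) hzn 2
      have hsq : Real.sqrt I.card ≤ t * Real.sqrt n := by
        refine (Real.sqrt_le_sqrt hIc).trans (le_of_eq ?_)
        rw [Real.sqrt_mul (by positivity), Real.sqrt_sq ht.le]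
      have h1 : ∑ i ∈ I, |(q i : ℝ)| ≤ (∑ i ∈ I, |z i|) / h + I.card := by
        rw [Finset.sum_div, Finset.card_eq_sum_ones, Nat.cast_sum, ← Finset.sum_add_distrib]
        refine Finset.sum_le_sum fun i _ => ?_
        have := (abs_sub_round_mul_le hhp (z i)).2
        simpa [hq] using this
      have h2 : (∑ i ∈ I, |z i|) / h ≤ n * (t * (4 / η)) := by
        rw [div_le_iff₀ hhp]
        have h3 : n * (t * (4 / η)) * h = t * Real.sqrt n * 2 := by
          have key : ∀ w : ℝ, 0 < w → w * w * (t * (4 / η)) * (η / (2 * w)) = t * w * 2 := by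
            intro w hw
            field_simp
            norm_num
          rw [hh, ← key _ hsn, hsn2]
        rw [h3]
        linarith
      have h4 : t ^ 2 * n ≤ t * n := by nlinarith
      rw [hsum]
      linarith
    have hΦn := abs_norm_sub_norm_le x (Φ q)
    have hab := abs_le.1 (hΦn.trans hxΦ)
    refine ⟨Φ q, Finset.mem_filter.2 ⟨Finset.mem_image_of_mem _ hqF, ?_, ?_⟩, hxΦ⟩
    · linarith [hab.2]
    · linarith [hab.1]
  · intro y hy
    exact (Finset.mem_filter.1 hy).2
  · have h1 : ((F.image Φ).filter fun y => 1 / 2 ≤ ‖y‖ ∧ ‖y‖ ≤ 2).card ≤ F.card :=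
      (Finset.card_filter_le _ _).trans Finset.card_image_le
    have h2 : (((F.image Φ).filter fun y => 1 / 2 ≤ ‖y‖ ∧ ‖y‖ ≤ 2).card : ℝ) ≤ F.card := by
      exact_mod_cast h1
    rw [Fintype.card_fin] at hcard
    exact h2.trans hcard

/-- The normalized solution is compressible with exponentially small probability. -/
theorem exists_measureReal_unitSolution_mem_comp_le.{w} (K M4 : ℝ) (hK : 0 < K) :
    ∃ c0 ∈ Set.Ioo (0 : ℝ) 1, ∃ c1 ∈ Set.Ioo (0 : ℝ) 1, ∃ κ : ℝ, 0 < κ ∧ ∃ n0 : ℕ,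
      ∀ n : ℕ, n0 ≤ n → ∀ (Ω : Type w) [MeasurableSpace Ω] (μ : Measure Ω)
        [IsProbabilityMeasure μ] (A : Ω → Matrix (Fin n) (Fin n) ℝ), SatisfiesA μ A M4 →
      ∀ u : EuclideanSpace ℝ (Fin n), u ≠ 0 →
        μ.real ({ω | unitSolution (A ω) u ∈ comp n c0 c1} ∩
          {ω | spectralNorm (A ω) ≤ 3 * K * Real.sqrt n} ∩ {ω | IsUnit (A ω).det}) ≤
        Real.exp (-κ * n) := by
  obtain ⟨δ, hδ0, hδ⟩ := exists_integral_prod_norm_charFun_le (M4 ^ 4)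
  -- at this net scale the radius `6 K η √n` of the small ball event is at most `√(δ n / 4)`
  set η : ℝ := min (Real.sqrt δ / (12 * K)) (1 / 2) with hη
  have hsδ : 0 < Real.sqrt δ := Real.sqrt_pos.2 hδ0
  have hηp : 0 < η := lt_min (by positivity) (by norm_num)
  have hη1 : η ≤ 1 / 2 := min_le_right _ _
  have hη2 : 6 * K * η ≤ Real.sqrt δ / 2 := by
    have h1 : η ≤ Real.sqrt δ / (12 * K) := min_le_left _ _
    rw [le_div_iff₀ (by positivity)] at h1
    linarith
  -- the weight `s` makes the count of integer points subexponential up to the rate `δ / 64`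
  set s : ℝ := Real.log (1 + 128 / δ) with hs
  have hsp : 0 < s := Real.log_pos (by
    have : 0 < 128 / δ := by positivity
    linarith)
  have hes : 2 / (Real.exp s - 1) = δ / 64 := by
    rw [hs, Real.exp_log (by positivity)]
    field_simp
    norm_num
  set t : ℝ := min (1 / 2) (δ / (64 * s * (4 / η + 1))) with ht
  have htp : 0 < t := lt_min (by norm_num) (by positivity)
  have ht1 : t ≤ 1 / 2 := min_le_left _ _
  have ht2 : s * (t * (4 / η + 1)) ≤ δ / 64 := by
    have h1 : t ≤ δ / (64 * s * (4 / η + 1)) := min_le_right _ _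
    rw [le_div_iff₀ (by positivity)] at h1
    linarith
  refine ⟨t ^ 2, ⟨by positivity, by nlinarith⟩, η / 4, ⟨by positivity, by linarith⟩, δ / 32,
    by positivity, max 2 (⌈(1 / η + 1) * (16 / δ)⌉₊), ?_⟩
  intro n hn Ω _ μ _ A hA u hu
  have hn2 : 2 ≤ n := (le_max_left _ _).trans hn
  have hn3 : (1 / η + 1) * (16 / δ) ≤ n :=
    (Nat.le_ceil _).trans (by exact_mod_cast (le_max_right _ _).trans hn)
  obtain ⟨ν, hνp, hνl, hν⟩ := hA.exists_law hn2
  obtain ⟨F, hF1, hF2, hF3⟩ := exists_net_comp (n := n) (by omega) hηp hη1 hsp htp (by linarith)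
  refine (measureReal_unitSolution_mem_le hK hηp (by omega) hu _ F (fun x hx _ => hF1 x hx)
    (Real.exp_pos (-(δ * n / 8))).le fun y hy v =>
      hA.measureReal_norm_sub_le_exp hn2 hν hδ0 (hδ ν hνp hνl (Fin n)) y v (hF2 y hy).1
        (hF2 y hy).2 ?_).trans ?_
  · rw [mul_pow, Real.sq_sqrt (by positivity)]
    have h1 : (6 * K * η) ^ 2 ≤ (Real.sqrt δ / 2) ^ 2 :=
      pow_le_pow_left₀ (by positivity) hη2 2
    rw [div_pow, Real.sq_sqrt hδ0.le] at h1
    have : (0 : ℝ) ≤ n := by positivity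
    nlinarith
  · have hF4 : (F.card : ℝ) ≤ Real.exp (δ * n / 32) := by
      refine hF3.trans ?_
      have h1 : (1 + 2 / (Real.exp s - 1)) ^ n ≤ Real.exp (n * (δ / 64)) := by
        rw [hes, Real.exp_nat_mul]
        refine pow_le_pow_left₀ (by positivity) ?_ n
        linarith [Real.add_one_le_exp (δ / 64)]
      have h2 : Real.exp (s * (n * (t * (4 / η + 1)))) ≤ Real.exp (n * (δ / 64)) := by
        refine Real.exp_le_exp.2 ?_
        have := mul_le_mul_of_nonneg_left ht2 (show (0 : ℝ) ≤ n by positivity)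
        linarith
      calc _ ≤ Real.exp (n * (δ / 64)) * Real.exp (n * (δ / 64)) :=
            mul_le_mul h2 h1 (by rw [hes]; positivity) (Real.exp_pos _).le
        _ = Real.exp (δ * n / 32) := by
            rw [← Real.exp_add]
            congr 1
            ring
    have h5 : 1 / η + 1 ≤ Real.exp (δ * n / 16) := by
      have h6 := Real.add_one_le_exp (δ * n / 16)
      have h7 := mul_le_mul_of_nonneg_left hn3 hδ0.le
      have h8 : δ * ((1 / η + 1) * (16 / δ)) = 16 * (1 / η + 1) := by
        field_simp
      linarith
    calc F.card * ((1 / η + 1) * Real.exp (-(δ * n / 8)))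
        ≤ Real.exp (δ * n / 32) * (Real.exp (δ * n / 16) * Real.exp (-(δ * n / 8))) :=
          mul_le_mul hF4 (mul_le_mul_of_nonneg_right h5 (Real.exp_pos _).le)
            (by positivity) (Real.exp_pos _).le
      _ = Real.exp (-(δ / 32) * n) := by
          rw [← Real.exp_add, ← Real.exp_add]
          congr 1
          ring


/-! ### Nets of vectors with small least common denominator -/

lemma lcd_set_nonempty {ι : Type*} [Fintype ι] {L : ℝ} (hL : 0 < L) (x : EuclideanSpace ℝ ι) :
    {θ : ℝ | 0 < θ ∧ Metric.infDist (θ • x) (integerLattice ι) <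
      L * Real.sqrt (Real.posLog (θ / L))}.Nonempty := by
  set w : ℝ := Fintype.card ι / L ^ 2 + 1 with hw
  have hwp : 0 < w := by positivity
  refine ⟨L * Real.exp w, by positivity, ?_⟩
  have h1 : L * Real.exp w / L = Real.exp w := by field_simp
  have h2 : Real.posLog (Real.exp w) = w := by
    simp [Real.posLog, hwp.le]
  rw [h1, h2]
  refine lt_of_pow_lt_pow_left₀ 2 (by positivity) ?_
  rw [mul_pow, Real.sq_sqrt hwp.le]
  have h3 := infDist_integerLattice_sq_le x (L * Real.exp w)
  have h4 : ∑ j, (1 - Real.cos (2 * Real.pi * (L * Real.exp w * x j))) ≤ ∑ _j : ι, (2 : ℝ) :=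
    Finset.sum_le_sum fun j _ => by
      linarith [Real.neg_one_le_cos (2 * Real.pi * (L * Real.exp w * x j))]
  rw [Finset.sum_const, Finset.card_univ, nsmul_eq_mul] at h4
  have h5 : L ^ 2 * w = Fintype.card ι + L ^ 2 := by
    rw [hw]
    field_simp
  have h6 : 0 < L ^ 2 := by positivity
  have h7 : (0 : ℝ) ≤ Fintype.card ι := by positivity
  linarith

/-- Below its least common denominator level, a unit vector with flat coordinates is close to a
multiple of an integer vector, and the multiple is not small since near the origin `θ x` is closest
to `0`. -/
lemma exists_integer_approx_of_lcd_lt {ι : Type*} [Fintype ι] {L D a : ℝ} (hL : 0 < L)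
    (ha : 0 < a) {x : EuclideanSpace ℝ ι} (hx : ‖x‖ = 1) (hxa : ∀ i, |x i| ≤ 1 / (2 * a))
    (h : lcd L x < D) :
    ∃ θ : ℝ, a ≤ θ ∧ θ < D ∧ ∃ p : ι → ℤ,
      ‖θ • x - WithLp.toLp 2 (fun i => (p i : ℝ))‖ ≤ L * Real.sqrt (Real.posLog (D / L)) := by
  obtain ⟨θ, ⟨hθ0, hθ⟩, hθD⟩ := exists_lt_of_csInf_lt (lcd_set_nonempty hL x) h
  have hne : (integerLattice ι).Nonempty := ⟨0, fun i => ⟨0, by simp⟩⟩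
  obtain ⟨z, hz, hdz⟩ := (Metric.infDist_lt_iff hne).1 hθ
  rw [dist_eq_norm] at hdz
  choose p hp using hz
  have hzp : z = WithLp.toLp 2 (fun i => (p i : ℝ)) := by
    ext i
    exact hp i
  refine ⟨θ, ?_, hθD, p, ?_⟩
  · by_contra hlt
    have hlt : θ < a := not_le.1 hlt
    have h1 : ‖θ • x‖ ≤ ‖θ • x - z‖ := by
      rw [EuclideanSpace.norm_eq, EuclideanSpace.norm_eq]
      refine Real.sqrt_le_sqrt (Finset.sum_le_sum fun i _ => ?_)
      refine pow_le_pow_left₀ (norm_nonneg _) ?_ 2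
      rw [PiLp.sub_apply, PiLp.smul_apply, hp i, smul_eq_mul, Real.norm_eq_abs, Real.norm_eq_abs]
      have h2 : |θ * x i| ≤ 1 / 2 := by
        rw [abs_mul, abs_of_pos hθ0]
        calc θ * |x i| ≤ a * (1 / (2 * a)) :=
              mul_le_mul hlt.le (hxa i) (abs_nonneg _) ha.le
          _ = 1 / 2 := by field_simp
      by_cases h0 : p i = 0
      · simp [h0]
      · have h3 : (1 : ℝ) ≤ |(p i : ℝ)| := by
          rw [← Int.cast_abs]
          exact_mod_cast Int.one_le_abs h0
        have h4 := abs_sub_abs_le_abs_sub (p i : ℝ) (θ * x i)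
        rw [abs_sub_comm] at h4
        linarith
    have h2 : L * Real.sqrt (Real.posLog (θ / L)) ≤ θ := by
      have ht : 0 < θ / L := by positivity
      have h3 : Real.posLog (θ / L) ≤ (θ / L) ^ 2 := by
        refine max_le (sq_nonneg _) ?_
        nlinarith [Real.log_le_sub_one_of_pos ht, sq_nonneg (θ / L - 1)]
      have h4 : Real.sqrt (Real.posLog (θ / L)) ≤ θ / L :=
        (Real.sqrt_le_sqrt h3).trans_eq (Real.sqrt_sq ht.le)
      calc L * Real.sqrt (Real.posLog (θ / L)) ≤ L * (θ / L) :=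
            mul_le_mul_of_nonneg_left h4 hL.le
        _ = θ := by field_simp
    rw [norm_smul, hx, mul_one, Real.norm_eq_abs, abs_of_pos hθ0] at h1
    linarith
  · rw [← hzp]
    refine hdz.le.trans (mul_le_mul_of_nonneg_left (Real.sqrt_le_sqrt ?_) hL.le)
    exact Real.posLog_le_posLog (by positivity) (div_le_div_of_nonneg_right hθD.le hL.le)

lemma le_lcd_of_flat {ι : Type*} [Fintype ι] {L a : ℝ} (hL : 0 < L)
    (ha : 0 < a) {x : EuclideanSpace ℝ ι} (hx : ‖x‖ = 1) (hxa : ∀ i, |x i| ≤ 1 / (2 * a)) :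
    a ≤ lcd L x := by
  by_contra h
  obtain ⟨θ, h1, h2, -⟩ := exists_integer_approx_of_lcd_lt hL ha hx hxa (not_le.1 h)
  linarith

set_option maxHeartbeats 1000000 in
/-- A net, in the supremum distance, of the vectors `x` in the unit ball for which some multiple
`θ x / ‖x‖` with `κ √m ≤ θ ≤ D` is within `r` of an integer vector `p`. A point of the net is
`τ p + h q` with `τ` a rounded value of `‖x‖ / θ` and `q` integer. For fixed `⌈θ⌉` the number
of pairs `(p, q)` does not depend on `θ`: a larger `θ` allows more `p` but fewer `q`. -/
lemma exists_net_of_integer_approx (ι : Type*) [Fintype ι] {κ r h D G : ℝ}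
    (hm : 0 < Fintype.card ι) (hκ : 0 < κ) (hr1 : 1 ≤ r) (hh : 0 < h)
    (hrκ : r ≤ κ * Real.sqrt (Fintype.card ι)) (hD : 1 ≤ D) (hDG : D ≤ G)
    (hG : r / (h * Real.sqrt (Fintype.card ι)) ≤ G) :
    ∃ F : Finset (ι → ℝ),
      (F.card : ℝ) ≤ 6 * D ^ 3 *
        (126 * (1 / κ + 4) * G / Real.sqrt (Fintype.card ι)) ^ Fintype.card ι ∧
      ∀ x : EuclideanSpace ℝ ι, ‖x‖ ≤ 1 → x ≠ 0 →
        (∃ θ : ℝ, κ * Real.sqrt (Fintype.card ι) ≤ θ ∧ θ ≤ D ∧ ∃ p : ι → ℤ,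
          ‖θ • normalize x - WithLp.toLp 2 (fun i => (p i : ℝ))‖ ≤ r) →
        ∃ y ∈ F, ∀ i, |x i - y i| ≤ h / 2 := by
  classical
  set m := Fintype.card ι with hmdef
  have hm' : (0 : ℝ) < m := by exact_mod_cast hm
  set w : ℝ := Real.sqrt m with hw
  have hwp : 0 < w := Real.sqrt_pos.2 hm'
  have hww : w * w = m := Real.mul_self_sqrt hm'.le
  have hGp : 0 < G := by linarith
  -- with step `σ`, rounding `τ ≤ 1 / θ` displaces `τ p` by at most `2 σ θ ≤ r / θ`
  set σ : ℝ := r / (2 * D ^ 2) with hσ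
  have hσp : 0 < σ := by positivity
  -- the integer vectors `p` and `q` for a given `T = ⌈θ⌉`
  have hFp : ∀ T : ℕ, ∃ F : Finset (ι → ℤ), 1 ≤ T →
      (∀ q : ι → ℤ, ∑ i, |(q i : ℝ)| ≤ 2 * T / w * m → q ∈ F) ∧
      (F.card : ℝ) ≤ (3 * (1 + 2 * (2 * T / w))) ^ m := by
    intro T
    by_cases hT : 1 ≤ T
    · have hT' : (0 : ℝ) < T := by exact_mod_cast hT
      obtain ⟨F, h1, h2⟩ := exists_finset_card_le_exp_one_mul ι
        (show 0 < 2 * (T : ℝ) / w by positivity)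
      exact ⟨F, fun _ => ⟨h1, h2⟩⟩
    · exact ⟨∅, fun h => absurd h hT⟩
  have hFq : ∀ T : ℕ, ∃ F : Finset (ι → ℤ), 1 ≤ T →
      (∀ q : ι → ℤ, ∑ i, |(q i : ℝ)| ≤ (4 * G / T + 1) * m → q ∈ F) ∧
      (F.card : ℝ) ≤ (3 * (1 + 2 * (4 * G / T + 1))) ^ m := by
    intro T
    by_cases hT : 1 ≤ T
    · have hT' : (0 : ℝ) < T := by exact_mod_cast hT
      obtain ⟨F, h1, h2⟩ := exists_finset_card_le_exp_one_mul ι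
        (show 0 < 4 * G / (T : ℝ) + 1 by positivity)
      exact ⟨F, fun _ => ⟨h1, h2⟩⟩
    · exact ⟨∅, fun h => absurd h hT⟩
  choose Fp hFp using hFp
  choose Fq hFq using hFq
  set C : ℝ := 126 * (1 / κ + 4) * G / w with hC
  set Ts : Finset ℕ := (Finset.Icc 1 ⌊2 * D⌋₊).filter fun T => κ * w ≤ T with hTs
  set As : Finset ℕ := Finset.range (⌊2 * D ^ 2⌋₊ + 1) with hAs
  set F : Finset (ι → ℝ) := Ts.biUnion fun T =>
    (As ×ˢ (Fp T ×ˢ Fq T)).image fun d => fun i => (d.1 * σ) * (d.2.1 i : ℝ) + h * (d.2.2 i : ℝ)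
    with hF
  refine ⟨F, ?_, ?_⟩
  · have hAc : (As.card : ℝ) ≤ 3 * D ^ 2 := by
      rw [hAs, Finset.card_range]
      push_cast
      have := Nat.floor_le (show 0 ≤ 2 * D ^ 2 by positivity)
      nlinarith
    have hTc : (Ts.card : ℝ) ≤ 2 * D := by
      have h1 : Ts.card ≤ ⌊2 * D⌋₊ := by
        refine (Finset.card_filter_le _ _).trans ?_
        simp
      have h2 : (Ts.card : ℝ) ≤ (⌊2 * D⌋₊ : ℝ) := by exact_mod_cast h1
      exact h2.trans (Nat.floor_le (by positivity))
    have hone : ∀ T ∈ Ts, ((((As ×ˢ (Fp T ×ˢ Fq T)).image fun d => fun i =>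
        (d.1 * σ) * (d.2.1 i : ℝ) + h * (d.2.2 i : ℝ)).card : ℕ) : ℝ) ≤
        3 * D ^ 2 * C ^ m := by
      intro T hT
      obtain ⟨hT1, hTκ⟩ := Finset.mem_filter.1 hT
      obtain ⟨hT1, hT2⟩ := Finset.mem_Icc.1 hT1
      have hT' : (0 : ℝ) < T := by exact_mod_cast hT1
      have hT2' : (T : ℝ) ≤ 2 * D :=
        (show (T : ℝ) ≤ (⌊2 * D⌋₊ : ℝ) by exact_mod_cast hT2).trans
          (Nat.floor_le (by positivity))
      have h1 : (((As ×ˢ (Fp T ×ˢ Fq T)).image fun d => fun i =>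
        (d.1 * σ) * (d.2.1 i : ℝ) + h * (d.2.2 i : ℝ)).card : ℝ) ≤
          As.card * ((Fp T).card * (Fq T).card) := by
        have : ((As ×ˢ (Fp T ×ˢ Fq T)).image fun d => fun i =>
          (d.1 * σ) * (d.2.1 i : ℝ) + h * (d.2.2 i : ℝ)).card ≤
            As.card * ((Fp T).card * (Fq T).card) := by
          refine Finset.card_image_le.trans ?_
          rw [Finset.card_product, Finset.card_product]
        exact_mod_cast this
      have h2 : (3 * (1 + 2 * (2 * T / w))) * (3 * (1 + 2 * (4 * G / T + 1))) ≤ C := by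
        have ha : 1 + 2 * (2 * T / w) ≤ (1 / κ + 4) * (T / w) := by
          have : 1 ≤ 1 / κ * (T / w) := by
            rw [div_mul_div_comm, one_mul, one_le_div (by positivity)]
            exact hTκ
          have e : 2 * (2 * (T : ℝ) / w) = 4 * (T / w) := by ring
          rw [e]
          linarith
        have hb : 1 + 2 * (4 * G / T + 1) ≤ 14 * (G / T) := by
          have : 1 ≤ 2 * (G / T) := by
            rw [← mul_div_assoc, one_le_div hT']
            linarith
          have e : 4 * G / T = 4 * (G / T) := by ring
          rw [e]
          linarith
        calc _ ≤ (3 * ((1 / κ + 4) * (T / w))) * (3 * (14 * (G / T))) :=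
              mul_le_mul (by linarith) (by linarith) (by positivity) (by positivity)
          _ = C := by
              rw [hC]
              field_simp
              ring
      have h3 : ((Fp T).card * (Fq T).card : ℝ) ≤ C ^ m := by
        refine (mul_le_mul (hFp T hT1).2 (hFq T hT1).2 (by positivity) (by positivity)).trans ?_
        rw [← mul_pow]
        exact pow_le_pow_left₀ (by positivity) h2 m
      refine h1.trans (mul_le_mul hAc h3 (by positivity) (by positivity))
    have h4 : (F.card : ℝ) ≤ ∑ T ∈ Ts, ((((As ×ˢ (Fp T ×ˢ Fq T)).image fun d => fun i =>
        (d.1 * σ) * (d.2.1 i : ℝ) + h * (d.2.2 i : ℝ)).card : ℕ) : ℝ) := by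
      exact_mod_cast Finset.card_biUnion_le
    refine h4.trans ((Finset.sum_le_card_nsmul _ _ _ hone).trans ?_)
    rw [nsmul_eq_mul]
    have hCp : 0 ≤ C ^ m := by positivity
    calc (Ts.card : ℝ) * (3 * D ^ 2 * C ^ m) ≤ (2 * D) * (3 * D ^ 2 * C ^ m) :=
          mul_le_mul_of_nonneg_right hTc (by positivity)
      _ = 6 * D ^ 3 * C ^ m := by ring
  · rintro x hx1 hx0 ⟨θ, hθ1, hθ2, p, hp⟩
    have hxn : 0 < ‖x‖ := norm_pos_iff.2 hx0
    have hθr : r ≤ θ := hrκ.trans hθ1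
    have hθp : 0 < θ := by linarith
    set T : ℕ := ⌈θ⌉₊ with hT
    have hTθ : θ ≤ T := Nat.le_ceil θ
    have hTθ2 : (T : ℝ) ≤ 2 * θ := by
      have := Nat.ceil_lt_add_one hθp.le
      linarith
    have hT1 : 1 ≤ T := Nat.one_le_ceil_iff.2 hθp
    have hTp : (0 : ℝ) < T := by linarith
    have hTm : T ∈ Ts := by
      refine Finset.mem_filter.2 ⟨Finset.mem_Icc.2 ⟨hT1, Nat.le_floor ?_⟩, hθ1.trans hTθ⟩
      linarith
    set pv : EuclideanSpace ℝ ι := WithLp.toLp 2 (fun i => (p i : ℝ)) with hpv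
    set e : EuclideanSpace ℝ ι := θ • normalize x - pv with he
    set τ : ℝ := ‖x‖ / θ with hτ
    have hτ0 : 0 ≤ τ := by positivity
    have hxe : x = τ • pv + τ • e := by
      rw [he, smul_sub, add_sub_cancel, smul_smul, normalize, smul_smul, hτ,
        div_mul_cancel₀ _ hθp.ne', mul_inv_cancel₀ hxn.ne', one_smul]
    set a : ℕ := ⌊τ / σ⌋₊ with ha
    have haA : a ∈ As := by
      refine Finset.mem_range.2 (Nat.lt_succ_of_le (Nat.floor_le_floor ?_))
      rw [div_le_iff₀ hσp]
      have h1 : 2 * D ^ 2 * σ = r := by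
        rw [hσ]
        field_simp
      have h2 : τ ≤ 1 := by
        rw [hτ, div_le_one hθp]
        linarith
      linarith
    have hτa : |τ - a * σ| ≤ σ := by
      have h1 : (a : ℝ) * σ ≤ τ := (le_div_iff₀ hσp).1 (Nat.floor_le (by positivity))
      have h2 := (div_lt_iff₀ hσp).1 (Nat.lt_floor_add_one (τ / σ))
      rw [abs_of_nonneg (by linarith)]
      linarith
    have hpvn : ‖pv‖ ≤ 2 * θ := by
      have h1 : pv = θ • normalize x - e := by rw [he, sub_sub_cancel]
      rw [h1]
      refine (norm_sub_le _ _).trans ?_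
      rw [norm_smul, normalize, norm_smul, norm_inv, norm_norm, inv_mul_cancel₀ hxn.ne', mul_one,
        Real.norm_eq_abs, abs_of_pos hθp]
      linarith
    set v : EuclideanSpace ℝ ι := x - (a * σ) • pv with hv
    have hvn : ‖v‖ ≤ 2 * r / θ := by
      have h1 : v = τ • e + (τ - a * σ) • pv := by
        rw [hv, sub_smul]
        nth_rewrite 1 [hxe]
        abel
      rw [h1]
      refine (norm_add_le _ _).trans ?_
      rw [norm_smul, norm_smul, Real.norm_eq_abs, Real.norm_eq_abs, abs_of_nonneg hτ0]
      have h2 : τ * ‖e‖ ≤ 1 / θ * r := by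
        refine mul_le_mul ?_ hp (norm_nonneg _) (by positivity)
        exact div_le_div_of_nonneg_right hx1 hθp.le
      have h3 : |τ - a * σ| * ‖pv‖ ≤ σ * (2 * θ) :=
        mul_le_mul hτa hpvn (norm_nonneg _) hσp.le
      have h4 : σ * (2 * θ) ≤ 1 / θ * r := by
        rw [hσ, div_mul_eq_mul_div, div_le_iff₀ (by positivity)]
        have h5 : 1 / θ * r * (2 * D ^ 2) = 2 * r * (D ^ 2 / θ) := by ring
        have h6 : θ ≤ D ^ 2 / θ := by
          rw [le_div_iff₀ hθp]
          nlinarith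
        rw [h5]
        nlinarith
      calc _ ≤ 1 / θ * r + 1 / θ * r := by linarith
        _ = 2 * r / θ := by ring
    set q : ι → ℤ := fun i => round (v i / h) with hq
    have hpF : p ∈ Fp T := by
      refine (hFp T hT1).1 p ?_
      have h1 := sum_abs_le_sqrt_card_mul Finset.univ (fun i => (p i : ℝ))
        (R := 2 * θ) (by positivity) (by
          have := pow_le_pow_left₀ (norm_nonneg _) hpvn 2
          rwa [EuclideanSpace.real_norm_sq_eq] at this)
      rw [Finset.card_univ, ← hmdef, ← hw] at h1
      refine h1.trans ?_
      have h2 : 2 * (T : ℝ) / w * m = w * (2 * T) := by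
        rw [← hww]
        field_simp
      rw [h2]
      nlinarith
    have hqF : q ∈ Fq T := by
      refine (hFq T hT1).1 q ?_
      have h1 := sum_abs_le_sqrt_card_mul Finset.univ (fun i => v i)
        (R := 2 * r / θ) (by positivity) (by
          have := pow_le_pow_left₀ (norm_nonneg _) hvn 2
          rwa [EuclideanSpace.real_norm_sq_eq] at this)
      rw [Finset.card_univ, ← hmdef, ← hw] at h1
      have h2 : ∑ i, |(q i : ℝ)| ≤ (∑ i, |v i|) / h + m := by
        rw [Finset.sum_div, hmdef, ← Finset.card_univ, Finset.card_eq_sum_ones, Nat.cast_sum,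
          ← Finset.sum_add_distrib]
        refine Finset.sum_le_sum fun i _ => ?_
        have := (abs_sub_round_mul_le hh (v i)).2
        simpa [hq] using this
      have h3 : (∑ i, |v i|) / h ≤ 4 * G / T * m := by
        rw [div_le_iff₀ hh]
        refine h1.trans ?_
        rw [div_le_iff₀ (by positivity)] at hG
        have h4 : w * (2 * r / θ) ≤ w * (4 * r / T) := by
          refine mul_le_mul_of_nonneg_left ?_ hwp.le
          rw [div_le_div_iff₀ hθp hTp]
          nlinarith
        have h5 : 4 * G / T * m * h = w * (4 * (G * (h * w)) / T) := by
          rw [← hww]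
          ring
        rw [h5]
        refine h4.trans (mul_le_mul_of_nonneg_left ?_ hwp.le)
        exact div_le_div_of_nonneg_right (by linarith) hTp.le
      linarith
    refine ⟨fun i => (a * σ) * (p i : ℝ) + h * (q i : ℝ), ?_, fun i => ?_⟩
    · refine Finset.mem_biUnion.2 ⟨T, hTm, Finset.mem_image.2 ⟨(a, p, q), ?_, rfl⟩⟩
      simp [haA, hpF, hqF]
    · have h1 := (abs_sub_round_mul_le hh (v i)).1
      have h2 : x i - ((a * σ) * (p i : ℝ) + h * (q i : ℝ)) = v i - h * round (v i / h) := by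
        simp only [hv, hpv, hq, PiLp.sub_apply, PiLp.smul_apply, smul_eq_mul]
        ring
      rw [h2]
      exact h1

/-- The net of the unit ball formed by grid points. -/
lemma exists_net_unit_ball (ι : Type*) [Fintype ι] {h g : ℝ} (hh : 0 < h) (hg : 0 < g)
    (hgc : Real.sqrt (Fintype.card ι) / h ≤ g * Fintype.card ι) :
    ∃ F : Finset (ι → ℝ), (F.card : ℝ) ≤ (3 * (3 + 2 * g)) ^ Fintype.card ι ∧
      ∀ x : ι → ℝ, ∑ i, x i ^ 2 ≤ 1 → ∃ y ∈ F, ∀ i, |x i - y i| ≤ h / 2 := by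
  classical
  obtain ⟨F, h1, h2⟩ := exists_finset_card_le_exp_one_mul ι (show 0 < g + 1 by positivity)
  refine ⟨F.image fun q i => h * (q i : ℝ), ?_, fun x hx => ?_⟩
  · have h3 : ((F.image fun q i => h * (q i : ℝ)).card : ℝ) ≤ F.card := by
      exact_mod_cast Finset.card_image_le
    refine (h3.trans h2).trans (le_of_eq ?_)
    ring
  · set q : ι → ℤ := fun i => round (x i / h) with hq
    suffices hqF : q ∈ F from ⟨fun i => h * (q i : ℝ), Finset.mem_image.2 ⟨q, hqF, rfl⟩,
      fun i => (abs_sub_round_mul_le hh (x i)).1⟩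
    refine h1 q ?_
    have h3 := sum_abs_le_sqrt_card_mul Finset.univ x zero_le_one (by simpa using hx)
    rw [Finset.card_univ, mul_one] at h3
    have h4 : ∑ i, |(q i : ℝ)| ≤ (∑ i, |x i|) / h + Fintype.card ι := by
      rw [Finset.sum_div, ← Finset.card_univ, Finset.card_eq_sum_ones, Nat.cast_sum,
        ← Finset.sum_add_distrib]
      refine Finset.sum_le_sum fun i _ => ?_
      simpa using (abs_sub_round_mul_le hh (x i)).2
    have h5 : (∑ i, |x i|) / h ≤ Real.sqrt (Fintype.card ι) / h :=
      div_le_div_of_nonneg_right h3 hh.le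
    linarith

/-- Nets on the blocks of a partition combine to a net. -/
lemma exists_net_of_blocks {n : ℕ} {β : Type*} [Fintype β] [DecidableEq β] (f : Fin n → β)
    (X : Set (EuclideanSpace ℝ (Fin n))) (ε : ℝ) (N : β → ℝ)
    (h : ∀ o, ∃ F : Finset (↥(Finset.univ.filter fun i => f i = o) → ℝ), (F.card : ℝ) ≤ N o ∧
      ∀ x ∈ X, ∃ y ∈ F, ∀ i, |restrict x (Finset.univ.filter fun i => f i = o) i - y i| ≤ ε) :
    ∃ F : Finset (Fin n → ℝ), (F.card : ℝ) ≤ ∏ o, N o ∧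
      ∀ x ∈ X, ∃ y ∈ F, ∀ i, |x i - y i| ≤ ε := by
  classical
  choose F hF1 hF2 using h
  refine ⟨(Fintype.piFinset F).image fun g i => g (f i) ⟨i, by simp⟩, ?_, fun x hx => ?_⟩
  · have h1 : (((Fintype.piFinset F).image fun g i => g (f i) ⟨i, by simp⟩).card : ℝ) ≤
        (Fintype.piFinset F).card := by
      exact_mod_cast Finset.card_image_le
    refine h1.trans ?_
    rw [Fintype.card_piFinset, Nat.cast_prod]
    exact Finset.prod_le_prod (fun _ _ => by positivity) fun o _ => hF1 o
  · choose y hy1 hy2 using fun o => hF2 o x hx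
    refine ⟨fun i => y (f i) ⟨i, by simp⟩, Finset.mem_image.2
      ⟨y, Fintype.mem_piFinset.2 hy1, rfl⟩, fun i => ?_⟩
    exact hy2 (f i) ⟨i, by simp⟩

lemma exists_labelling {n k m : ℕ} (s : Finset (Fin n)) (h : k * m ≤ s.card) :
    ∃ f : Fin n → Option (Fin k),
      (∀ j, (Finset.univ.filter fun i => f i = some j) ⊆ s) ∧
      (∀ j, (Finset.univ.filter fun i => f i = some j).card = m) := by
  classical
  obtain ⟨t, hts, htc⟩ := Finset.exists_subset_card_eq h
  have e : ↥t ≃ Fin k × Fin m := Fintype.equivOfCardEq (by simp [htc])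
  refine ⟨fun i => if hi : i ∈ t then some (e ⟨i, hi⟩).1 else none, fun j i hi => ?_, fun j => ?_⟩
  · by_contra his
    have : i ∉ t := fun h => his (hts h)
    simp [this] at hi
  · have h1 : (Finset.univ.filter fun i =>
        (if hi : i ∈ t then some (e ⟨i, hi⟩).1 else none) = some j) =
        Finset.univ.image fun b : Fin m => (e.symm (j, b) : Fin n) := by
      ext i
      simp only [Finset.mem_filter, Finset.mem_univ, true_and, Finset.mem_image]
      constructor
      · intro hi
        by_cases hit : i ∈ t
        · simp only [hit, dif_pos, Option.some.injEq] at hi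
          refine ⟨(e ⟨i, hit⟩).2, ?_⟩
          rw [← hi]
          simp
        · simp [hit] at hi
      · rintro ⟨b, rfl⟩
        simp
    rw [h1, Finset.card_image_of_injective _ fun a b hab => ?_]
    · simp
    · have := e.symm.injective (Subtype.ext hab)
      simpa using this


/-! ### Nets of the level sets of the regularized LCD -/

/-- The incompressible vectors whose regularized LCD lies in `[D, 2 D)`. -/
def levelSet {n : ℕ} (c0 c1 : ℝ) (spread : EuclideanSpace ℝ (Fin n) → Finset (Fin n))
    (L lam D : ℝ) : Set (EuclideanSpace ℝ (Fin n)) :=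
  {x | x ∈ incomp n c0 c1 ∧ D ≤ regLcd spread L lam x ∧ regLcd spread L lam x < 2 * D}

/-- The normalized restriction of an incompressible vector to `m` spread coordinates has all
coordinates at most `1 / (2 κ √m)` for this `κ`. -/
noncomputable def flatness (c0 c1 : ℝ) : ℝ := c1 * Real.sqrt c0 / (2 * Real.sqrt 2)

lemma flatness_pos {c0 c1 : ℝ} (hc0 : 0 < c0) (hc1 : 0 < c1) : 0 < flatness c0 c1 := by
  unfold flatness
  positivity

section

variable {n : ℕ} {c0 c1 coo : ℝ} {spread : EuclideanSpace ℝ (Fin n) → Finset (Fin n)}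
  {x : EuclideanSpace ℝ (Fin n)} {I : Finset (Fin n)}

lemma norm_restrict_sq (x : EuclideanSpace ℝ (Fin n)) (I : Finset (Fin n)) :
    ‖restrict x I‖ ^ 2 = ∑ i ∈ I, x i ^ 2 := by
  rw [EuclideanSpace.real_norm_sq_eq]
  exact Finset.sum_coe_sort I fun i => x i ^ 2

lemma norm_restrict_le (x : EuclideanSpace ℝ (Fin n)) (I : Finset (Fin n)) :
    ‖restrict x I‖ ≤ ‖x‖ := by
  refine (sq_le_sq₀ (norm_nonneg _) (norm_nonneg _)).1 ?_
  rw [norm_restrict_sq, EuclideanSpace.real_norm_sq_eq]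
  exact Finset.sum_le_univ_sum_of_nonneg fun i => sq_nonneg _

lemma IsSpreadAssignment.le_norm_restrict (hs : IsSpreadAssignment c0 c1 coo spread)
    (hc1 : 0 < c1) (hx : x ∈ incomp n c0 c1) (hI : I ⊆ spread x) :
    c1 / Real.sqrt (2 * n) * Real.sqrt I.card ≤ ‖restrict x I‖ := by
  refine (sq_le_sq₀ (by positivity) (norm_nonneg _)).1 ?_
  rw [norm_restrict_sq, mul_pow, Real.sq_sqrt (by positivity), mul_comm, ← nsmul_eq_mul]
  refine Finset.card_nsmul_le_sum _ _ _ fun i hi => ?_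
  rw [← sq_abs (x i)]
  exact pow_le_pow_left₀ (by positivity) ((hs x hx).2 i (hI hi)).1 2

lemma IsSpreadAssignment.restrict_ne_zero (hs : IsSpreadAssignment c0 c1 coo spread)
    (hc1 : 0 < c1) (hn : 0 < n) (hx : x ∈ incomp n c0 c1) (hI : I ⊆ spread x)
    (hI0 : 0 < I.card) : restrict x I ≠ 0 := by
  have h1 := hs.le_norm_restrict hc1 hx hI
  have hn' : (0 : ℝ) < n := by exact_mod_cast hn
  have hI' : (0 : ℝ) < I.card := by exact_mod_cast hI0
  have h2 : 0 < c1 / Real.sqrt (2 * n) * Real.sqrt I.card := by positivity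
  exact norm_pos_iff.1 (lt_of_lt_of_le h2 h1)

lemma norm_normalize {E : Type*} [NormedAddCommGroup E] [NormedSpace ℝ E] {x : E} (hx : x ≠ 0) :
    ‖normalize x‖ = 1 := by
  rw [normalize, norm_smul, norm_inv, norm_norm, inv_mul_cancel₀ (norm_ne_zero_iff.2 hx)]

lemma IsSpreadAssignment.abs_normalize_restrict_le (hs : IsSpreadAssignment c0 c1 coo spread)
    (hc0 : 0 < c0) (hc1 : 0 < c1) (hn : 0 < n) (hx : x ∈ incomp n c0 c1) (hI : I ⊆ spread x)
    (hI0 : 0 < I.card) (i : I) :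
    |normalize (restrict x I) i| ≤ 1 / (2 * (flatness c0 c1 * Real.sqrt I.card)) := by
  have hn' : (0 : ℝ) < n := by exact_mod_cast hn
  have hI' : (0 : ℝ) < I.card := by exact_mod_cast hI0
  have h1 := hs.le_norm_restrict hc1 hx hI
  have h2 := ((hs x hx).2 i (hI i.2)).2
  have hsn : 0 < Real.sqrt n := Real.sqrt_pos.2 hn'
  have hsI : 0 < Real.sqrt I.card := Real.sqrt_pos.2 hI'
  have hsc : 0 < Real.sqrt c0 := Real.sqrt_pos.2 hc0
  have hs2 : 0 < Real.sqrt 2 := Real.sqrt_pos.2 two_pos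
  have h3 : |normalize (restrict x I) i| = |x i| / ‖restrict x I‖ := by
    rw [normalize, PiLp.smul_apply, smul_eq_mul, abs_mul, abs_inv, abs_norm, inv_mul_eq_div]
    rfl
  rw [h3]
  refine (div_le_div₀ (by positivity) h2 (by positivity) h1).trans (le_of_eq ?_)
  rw [Real.sqrt_mul hc0.le, Real.sqrt_mul two_pos.le, flatness]
  field_simp

lemma finite_setOf_lcd (S : Finset (Fin n)) (L : ℝ) (m : ℕ) (x : EuclideanSpace ℝ (Fin n)) :
    {D : ℝ | ∃ I : Finset (Fin n), I ⊆ S ∧ I.card = m ∧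
      D = lcd L (normalize (restrict x I))}.Finite := by
  refine (Set.finite_range fun I : Finset (Fin n) =>
    lcd L (normalize (restrict x I))).subset ?_
  rintro D ⟨I, -, -, rfl⟩
  exact ⟨I, rfl⟩

lemma lcd_le_regLcd {L lam : ℝ} (hI : I ⊆ spread x) (hIc : I.card = ⌈lam * n⌉₊) :
    lcd L (normalize (restrict x I)) ≤ regLcd spread L lam x :=
  le_csSup (finite_setOf_lcd _ _ _ _).bddAbove ⟨I, hI, hIc, rfl⟩

lemma exists_lcd_eq_regLcd {L lam : ℝ} (h : ⌈lam * n⌉₊ ≤ (spread x).card) :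
    ∃ I : Finset (Fin n), I ⊆ spread x ∧ I.card = ⌈lam * n⌉₊ ∧
      lcd L (normalize (restrict x I)) = regLcd spread L lam x := by
  obtain ⟨I0, hI0, hI0c⟩ := Finset.exists_subset_card_eq h
  have hne : {D : ℝ | ∃ I : Finset (Fin n), I ⊆ spread x ∧ I.card = ⌈lam * n⌉₊ ∧
      D = lcd L (normalize (restrict x I))}.Nonempty := ⟨_, I0, hI0, hI0c, rfl⟩
  obtain ⟨I, h1, h2, h3⟩ := hne.csSup_mem (finite_setOf_lcd (spread x) L ⌈lam * n⌉₊ x)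
  exact ⟨I, h1, h2, h3.symm⟩

lemma IsSpreadAssignment.le_regLcd (hs : IsSpreadAssignment c0 c1 coo spread)
    (hc0 : 0 < c0) (hc1 : 0 < c1) (hn : 0 < n) (hx : x ∈ incomp n c0 c1) {L lam : ℝ} (hL : 0 < L)
    (hm : 0 < ⌈lam * n⌉₊) (h : ⌈lam * n⌉₊ ≤ ⌈coo * n⌉₊) :
    flatness c0 c1 * Real.sqrt ⌈lam * n⌉₊ ≤ regLcd spread L lam x := by
  rw [← (hs x hx).1] at h
  obtain ⟨I, hI, hIc, hIe⟩ := exists_lcd_eq_regLcd (L := L) (lam := lam) h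
  have hI0 : 0 < I.card := by rw [hIc]; exact hm
  have hI' : (0 : ℝ) < I.card := by exact_mod_cast hI0
  have hκ := flatness_pos hc0 hc1
  rw [← hIe, ← hIc]
  exact le_lcd_of_flat hL (by positivity) (norm_normalize (hs.restrict_ne_zero hc1 hn hx hI hI0))
    fun i => hs.abs_normalize_restrict_le hc0 hc1 hn hx hI hI0 i

end

/-- A net of the level set of the regularized LCD. The spread part of a vector is cut into `k`
blocks of size `m = ⌈lam n⌉`, each of which has small LCD and therefore a net gaining a factor
`√m` per coordinate over the net of a ball. -/
theorem exists_net_levelSet {n k : ℕ} {c0 c1 coo L lam D r G : ℝ}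
    {spread : EuclideanSpace ℝ (Fin n) → Finset (Fin n)}
    (hs : IsSpreadAssignment c0 c1 coo spread) (hn : 0 < n) (hc0 : 0 < c0) (hc1 : 0 < c1)
    (hL : 0 < L) (hm : 0 < ⌈lam * n⌉₊) (hk : k * ⌈lam * n⌉₊ ≤ ⌈coo * n⌉₊)
    (hk2 : 2 * (k * ⌈lam * n⌉₊) ≤ n) (hD : 1 ≤ D) (hr1 : 1 ≤ r)
    (hr : L * Real.sqrt (Real.posLog (2 * D / L)) ≤ r)
    (hrκ : r ≤ flatness c0 c1 * Real.sqrt ⌈lam * n⌉₊) (hG1 : 2 * D ≤ G)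
    (hG2 : D * Real.sqrt n / Real.sqrt ⌈lam * n⌉₊ ≤ G) :
    ∃ F : Finset (EuclideanSpace ℝ (Fin n)),
      (∀ x ∈ F, x ∈ levelSet c0 c1 spread L lam D) ∧
      (F.card : ℝ) ≤ (k + 1) ^ n * ((3 * (3 + 2 * (2 * D))) ^ (n - k * ⌈lam * n⌉₊) *
        (6 * (2 * D) ^ 3 * (126 * (1 / flatness c0 c1 + 4) * G / Real.sqrt ⌈lam * n⌉₊) ^
          ⌈lam * n⌉₊) ^ k) ∧
      ∀ x ∈ levelSet c0 c1 spread L lam D, ∃ y ∈ F, ‖x - y‖ ≤ r / D := by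
  classical
  set m := ⌈lam * n⌉₊ with hmdef
  set κ := flatness c0 c1 with hκdef
  have hκ : 0 < κ := flatness_pos hc0 hc1
  have hn' : (0 : ℝ) < n := by exact_mod_cast hn
  have hm' : (0 : ℝ) < m := by exact_mod_cast hm
  have hGp : 0 < G := by linarith
  have hsn : 0 < Real.sqrt n := Real.sqrt_pos.2 hn'
  have hsm : 0 < Real.sqrt m := Real.sqrt_pos.2 hm'
  set h : ℝ := r / (D * Real.sqrt n) with hh
  have hhp : 0 < h := by positivity
  set N1 : ℝ := 6 * (2 * D) ^ 3 * (126 * (1 / κ + 4) * G / Real.sqrt m) ^ m with hN1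
  set N0 : ℝ := (3 * (3 + 2 * (2 * D))) ^ (n - k * m) with hN0
  have hN1p : 0 ≤ N1 := by positivity
  have hN0p : 0 ≤ N0 := by positivity
  set X : (Fin n → Option (Fin k)) → Set (EuclideanSpace ℝ (Fin n)) := fun f =>
    {x | x ∈ levelSet c0 c1 spread L lam D ∧
      ∀ j, (Finset.univ.filter fun i => f i = some j) ⊆ spread x} with hX
  have hF : ∀ f : Fin n → Option (Fin k), ∃ F : Finset (Fin n → ℝ), (F.card : ℝ) ≤ N0 * N1 ^ k ∧
      ((∀ j, (Finset.univ.filter fun i => f i = some j).card = m) →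
        ∀ x ∈ X f, ∃ y ∈ F, ∀ i, |x i - y i| ≤ h / 2) := by
    intro f
    by_cases hf : ∀ j, (Finset.univ.filter fun i => f i = some j).card = m
    swap
    · exact ⟨∅, by simp; positivity, fun h => absurd h hf⟩
    have hnone : (Finset.univ.filter fun i => f i = none).card = n - k * m := by
      have h1 := Finset.card_eq_sum_card_fiberwise (f := f) (s := Finset.univ)
        (t := Finset.univ) (fun _ _ => Finset.mem_coe.2 (Finset.mem_univ _))
      rw [Finset.card_univ, Fintype.card_fin, Fintype.sum_option] at h1
      simp only [hf, Finset.sum_const, Finset.card_univ, Fintype.card_fin, smul_eq_mul] at h1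
      omega
    obtain ⟨F, hF1, hF2⟩ := exists_net_of_blocks f (X f) (h / 2)
      (fun o => o.elim N0 fun _ => N1) (fun o => by
        cases o with
        | none =>
          obtain ⟨F, h1, h2⟩ := exists_net_unit_ball
            (↥(Finset.univ.filter fun i => f i = none)) hhp (show 0 < 2 * D by positivity) (by
              rw [Fintype.card_coe, hnone]
              set n0 := n - k * m with hn0
              have h3 : n ≤ 4 * n0 := by omega
              have h4 : (n : ℝ) ≤ 4 * n0 := by exact_mod_cast h3
              have h5 : Real.sqrt n ≤ 2 * Real.sqrt n0 := by
                refine (Real.sqrt_le_sqrt h4).trans (le_of_eq ?_)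
                rw [Real.sqrt_mul (by norm_num), show (4 : ℝ) = 2 ^ 2 by norm_num,
                  Real.sqrt_sq two_pos.le]
              have h6 : Real.sqrt n0 * Real.sqrt n0 = n0 := Real.mul_self_sqrt (by positivity)
              rw [hh, div_div_eq_mul_div, div_le_iff₀ (by linarith)]
              have h7 : 0 ≤ Real.sqrt n0 := Real.sqrt_nonneg _
              calc Real.sqrt n0 * (D * Real.sqrt n)
                  ≤ Real.sqrt n0 * (D * (2 * Real.sqrt n0)) := by gcongr
                _ = 2 * D * (Real.sqrt n0 * Real.sqrt n0) * 1 := by ring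
                _ ≤ 2 * D * (Real.sqrt n0 * Real.sqrt n0) * r := by gcongr
                _ = 2 * D * n0 * r := by rw [h6])
          refine ⟨F, ?_, fun x hx => ?_⟩
          · rw [Fintype.card_coe, hnone] at h1
            exact h1
          · refine h2 (fun i => restrict x _ i) ?_
            rw [← EuclideanSpace.real_norm_sq_eq]
            refine pow_le_one₀ (norm_nonneg _) ((norm_restrict_le _ _).trans (le_of_eq ?_))
            exact hx.1.1.1
        | some j =>
          set I := Finset.univ.filter fun i => f i = some j with hI
          have hIc : I.card = m := hf j
          obtain ⟨F, h1, h2⟩ := exists_net_of_integer_approx (↥I) (κ := κ) (r := r) (h := h)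
            (D := 2 * D) (G := G) (by rw [Fintype.card_coe, hIc]; exact hm) hκ hr1 hhp
            (by rw [Fintype.card_coe, hIc]; exact hrκ) (by linarith) hG1 (by
              rw [Fintype.card_coe, hIc]
              refine le_trans (le_of_eq ?_) hG2
              rw [hh]
              field_simp)
          rw [Fintype.card_coe, hIc] at h1 h2
          refine ⟨F, h1, fun x hx => ?_⟩
          have hxi : x ∈ incomp n c0 c1 := hx.1.1
          have hIs : I ⊆ spread x := hx.2 j
          have hI0 : 0 < I.card := by rw [hIc]; exact hm
          have hne := hs.restrict_ne_zero hc1 hn hxi hIs hI0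
          have hlcd : lcd L (normalize (restrict x I)) < 2 * D :=
            (lcd_le_regLcd hIs hIc).trans_lt hx.1.2.2
          obtain ⟨θ, hθ1, hθ2, p, hp⟩ := exists_integer_approx_of_lcd_lt hL
            (show 0 < κ * Real.sqrt m by positivity) (norm_normalize hne)
            (fun i => by
              have := hs.abs_normalize_restrict_le hc0 hc1 hn hxi hIs hI0 i
              rwa [hIc] at this) hlcd
          exact h2 (restrict x I) ((norm_restrict_le _ _).trans (le_of_eq hxi.1)) hne
            ⟨θ, hθ1, hθ2.le, p, hp.trans hr⟩)
    refine ⟨F, hF1.trans (le_of_eq ?_), fun _ => hF2⟩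
    rw [Fintype.prod_option]
    simp
  choose F hF1 hF2 using hF
  obtain ⟨F', hF'1, hF'2, hF'3⟩ := exists_finset_subset_of_cover
    (levelSet c0 c1 spread L lam D) (Finset.univ.biUnion F)
    (fun x y => ∀ i, |x i - y i| ≤ h / 2) (fun x hx => by
      rw [← (hs x hx.1).1] at hk
      obtain ⟨f, hf1, hf2⟩ := exists_labelling (spread x) hk
      obtain ⟨y, hy, hxy⟩ := hF2 f hf2 x ⟨hx, hf1⟩
      exact ⟨y, Finset.mem_biUnion.2 ⟨f, Finset.mem_univ _, hy⟩, hxy⟩)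
  refine ⟨F', hF'1, ?_, fun x hx => ?_⟩
  · have h1 : (F'.card : ℝ) ≤ ∑ f, ((F f).card : ℝ) := by
      exact_mod_cast hF'2.trans Finset.card_biUnion_le
    refine h1.trans ((Finset.sum_le_card_nsmul _ _ _ fun f _ => hF1 f).trans (le_of_eq ?_))
    rw [nsmul_eq_mul, Finset.card_univ, Fintype.card_fun, Fintype.card_option, Fintype.card_fin,
      Fintype.card_fin]
    push_cast
    rfl
  · obtain ⟨x', hx', y, hxy, hx'y⟩ := hF'3 x hx
    refine ⟨x', hx', ?_⟩
    refine (sq_le_sq₀ (norm_nonneg _) (by positivity)).1 ?_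
    rw [EuclideanSpace.real_norm_sq_eq]
    have h1 : ∀ i, (x - x') i ^ 2 ≤ h ^ 2 := by
      intro i
      rw [← sq_abs, PiLp.sub_apply]
      refine pow_le_pow_left₀ (abs_nonneg _) ?_ 2
      have h2 := abs_sub_le (x i) (y i) (x' i)
      rw [abs_sub_comm (y i)] at h2
      linarith [hxy i, hx'y i]
    refine (Finset.sum_le_sum fun i _ => h1 i).trans (le_of_eq ?_)
    rw [Finset.sum_const, Finset.card_univ, Fintype.card_fin, nsmul_eq_mul, hh, div_pow, div_pow,
      mul_pow, Real.sq_sqrt hn'.le]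
    field_simp


/-! ### The union bound over a level set -/

section

variable {Ω : Type*} [MeasurableSpace Ω] {μ : Measure Ω} [IsProbabilityMeasure μ] {n : ℕ}
  {A : Ω → Matrix (Fin n) (Fin n) ℝ} {M4 : ℝ} {c0 c1 coo : ℝ}
  {spread : EuclideanSpace ℝ (Fin n) → Finset (Fin n)}

/-- The small ball estimate at a point of the level set, from the block of spread coordinates where
the regularized LCD is attained. -/
lemma SatisfiesA.measureReal_norm_sub_le_of_mem_levelSet (hA : SatisfiesA μ A M4)
    {ν : Measure ℝ} [IsProbabilityMeasure ν] (hνl : IsNormalizedLaw ν (M4 ^ 4))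
    (hν : ∀ i j, i < j → μ.map (fun ω => A ω i j) = ν)
    (hs : IsSpreadAssignment c0 c1 coo spread) (hn : 0 < n) (hc1 : 0 < c1)
    {B L lam D ε : ℝ} (hB : 0 < B) (hMB : 32 * M4 ^ 4 ≤ B ^ 2) (hBL : B ≤ L) (hD : 0 ≤ D)
    (hε : 0 < ε) (hm : 0 < ⌈lam * n⌉₊) (hmc : ⌈lam * n⌉₊ ≤ ⌈coo * n⌉₊)
    {x : EuclideanSpace ℝ (Fin n)} (hx : x ∈ levelSet c0 c1 spread L lam D)
    (v : EuclideanSpace ℝ (Fin n)) :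
    μ.real {ω | ‖Matrix.toEuclideanCLM (n := Fin n) (𝕜 := ℝ) (A ω) x - v‖ ≤ ε * Real.sqrt n} ≤
      Real.exp (n / 2) * (4 * Real.pi ^ 2 * L * ε *
        (Real.sqrt (2 * n) / (c1 * Real.sqrt ⌈lam * n⌉₊)) +
        2 * Real.exp (-((2 * Real.pi * D * ε / B) ^ 2 / 2))) ^ (n - ⌈lam * n⌉₊) := by
  obtain ⟨hxi, hxD, -⟩ := hx
  rw [← (hs x hxi).1] at hmc
  obtain ⟨I, hI, hIc, hIe⟩ := exists_lcd_eq_regLcd (L := L) hmc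
  have hI0 : 0 < I.card := by rw [hIc]; exact hm
  have hn' : (0 : ℝ) < n := by exact_mod_cast hn
  have hm' : (0 : ℝ) < (⌈lam * n⌉₊ : ℝ) := by exact_mod_cast hm
  have hne := hs.restrict_ne_zero hc1 hn hxi hI hI0
  have hL : 0 < L := hB.trans_le hBL
  have hpi := Real.pi_pos
  set R := ‖restrict x I‖ with hR
  have hRp : 0 < R := norm_pos_iff.2 hne
  have hR1 : R ≤ 1 := (norm_restrict_le x I).trans hxi.1.le
  have hRl := hs.le_norm_restrict hc1 hxi hI
  rw [hIc, ← hR] at hRl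
  have h1 := hA.measureReal_norm_sub_le hν I x v hε (ε * Real.sqrt n)
  have h2 := integral_prod_norm_charFun_le_of_lcd hνl hB hMB (normalize (restrict x I)) hL hBL
    (show 0 < R / ε by positivity) hD (hIe ▸ hxD)
  have h3 : ∀ g : ℝ, ∏ j ∈ I, ‖charFun ν (g * (x j / ε))‖ =
      ∏ j : I, ‖charFun ν (g * (R / ε * normalize (restrict x I) j))‖ := by
    intro g
    rw [← Finset.prod_coe_sort]
    refine Finset.prod_congr rfl fun j _ => ?_
    have : R / ε * normalize (restrict x I) j = x j / ε := by
      rw [normalize, PiLp.smul_apply, smul_eq_mul, ← hR]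
      change R / ε * (R⁻¹ * x j) = x j / ε
      field_simp
    rw [this]
  simp only [h3] at h1
  have h4 : (ε * Real.sqrt n) ^ 2 / (2 * ε ^ 2) = n / 2 := by
    rw [mul_pow, Real.sq_sqrt hn'.le]
    field_simp
  rw [h4, Finset.card_compl, Fintype.card_fin, hIc] at h1
  refine h1.trans (mul_le_mul_of_nonneg_left (pow_le_pow_left₀ (integral_nonneg fun g =>
    Finset.prod_nonneg fun _ _ => norm_nonneg _) (h2.trans (add_le_add ?_ ?_)) _)
    (Real.exp_pos _).le)
  · have h5 : 1 / R ≤ Real.sqrt (2 * n) / (c1 * Real.sqrt ⌈lam * n⌉₊) := by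
      rw [div_le_div_iff₀ hRp (by positivity), one_mul]
      rw [div_mul_eq_mul_div, div_le_iff₀ (by positivity)] at hRl
      linarith
    calc 4 * Real.pi ^ 2 * L / (R / ε) = 4 * Real.pi ^ 2 * L * ε * (1 / R) := by
          field_simp
      _ ≤ _ := mul_le_mul_of_nonneg_left h5 (by positivity)
  · refine mul_le_mul_of_nonneg_left (Real.exp_le_exp.2 (neg_le_neg ?_)) zero_le_two
    refine div_le_div_of_nonneg_right (pow_le_pow_left₀ (by positivity) ?_ 2) zero_le_two
    rw [div_le_div_iff₀ hB (by positivity)]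
    have h6 : 2 * Real.pi * D * ε * (R / ε * B) = 2 * Real.pi * D * B * R := by
      field_simp
    rw [h6]
    exact mul_le_of_le_one_right (by positivity) hR1

end

lemma net_size_le {n m k : ℕ} {Q D s w C : ℝ} (hQ : 48 ≤ Q) (hD : 1 ≤ D) (hs : 0 < s)
    (hw : 0 < w) (hsw : s ≤ Q * w) (hC0 : 0 ≤ C) (hC : 2 * C ≤ Q) (hkQ : (k : ℝ) ≤ Q)
    (hkm : k * m ≤ n) (hDk : (48 * D ^ 3) ^ k ≤ Q ^ n) :
    ((k : ℝ) + 1) ^ n * ((3 * (3 + 2 * (2 * D))) ^ (n - k * m) *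
      (6 * (2 * D) ^ 3 * (C * (2 * D * Q) / w) ^ m) ^ k) ≤
      Q ^ (6 * n) * D ^ n * s⁻¹ ^ (k * m) := by
  have hQ0 : 0 < Q := by linarith
  have h1 : ((k : ℝ) + 1) ^ n ≤ Q ^ (2 * n) := by
    rw [pow_mul]
    exact pow_le_pow_left₀ (by positivity) (by nlinarith) n
  have hQ3 : Q ≤ Q ^ 3 := le_self_pow₀ (by linarith) (by norm_num)
  have h2 : (3 * (3 + 2 * (2 * D))) ^ (n - k * m) ≤ (Q ^ 3 * D) ^ (n - k * m) := by
    refine pow_le_pow_left₀ (by positivity) ?_ _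
    nlinarith
  have h3 : (6 * (2 * D) ^ 3 * (C * (2 * D * Q) / w) ^ m) ^ k ≤
      Q ^ n * ((Q ^ 3 * D) ^ (k * m) * s⁻¹ ^ (k * m)) := by
    rw [mul_pow, ← pow_mul, mul_comm m k, ← mul_pow (Q ^ 3 * D)]
    have e : 6 * (2 * D) ^ 3 = 48 * D ^ 3 := by ring
    rw [e]
    refine mul_le_mul hDk (pow_le_pow_left₀ (by positivity) ?_ _) (by positivity) (by positivity)
    rw [← div_eq_mul_inv, div_le_div_iff₀ hw hs]
    calc C * (2 * D * Q) * s ≤ C * (2 * D * Q) * (Q * w) := by gcongr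
      _ = 2 * C * (Q ^ 2 * D * w) := by ring
      _ ≤ Q * (Q ^ 2 * D * w) := by gcongr
      _ = Q ^ 3 * D * w := by ring
  calc _ ≤ Q ^ (2 * n) * ((Q ^ 3 * D) ^ (n - k * m) *
        (Q ^ n * ((Q ^ 3 * D) ^ (k * m) * s⁻¹ ^ (k * m)))) := by gcongr
    _ = Q ^ (2 * n) * Q ^ n * ((Q ^ 3 * D) ^ (n - k * m) * (Q ^ 3 * D) ^ (k * m)) *
        s⁻¹ ^ (k * m) := by ring
    _ = Q ^ (6 * n) * D ^ n * s⁻¹ ^ (k * m) := by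
      rw [pow_sub_mul_pow _ hkm, mul_pow, ← pow_mul]
      ring

lemma level_bound_le {n m : ℕ} {Q D S X Y P : ℝ} (hQ : 1 ≤ Q) (hD : 1 ≤ D) (hS : 0 ≤ S)
    (hmn : m ≤ n) (hX : X ≤ Q ^ (6 * n) * D ^ n * S) (hY0 : 0 ≤ Y)
    (hY : Y ≤ Q ^ n) (hP0 : 0 ≤ P) (hP : P ≤ Q ^ n * (Q ^ 5 / D) ^ (n - m))
    (hDm : D ^ m ≤ Q ^ (2 * n)) : X * (Y * P) ≤ Q ^ (15 * n) * S := by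
  have hD0 : 0 < D := by linarith
  have h1 : D ^ n * (Q ^ 5 / D) ^ (n - m) ≤ Q ^ (7 * n) := by
    have e : D ^ n = D ^ m * D ^ (n - m) := by
      rw [← pow_add, Nat.add_sub_cancel' hmn]
    rw [e, div_pow, mul_assoc, mul_div_cancel₀ _ (by positivity), ← pow_mul]
    calc D ^ m * Q ^ (5 * (n - m)) ≤ Q ^ (2 * n) * Q ^ (5 * n) := by
          refine mul_le_mul hDm (pow_le_pow_right₀ hQ ?_) (by positivity) (by positivity)
          exact Nat.mul_le_mul_left _ (Nat.sub_le _ _)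
      _ = Q ^ (7 * n) := by ring
  calc X * (Y * P) ≤ (Q ^ (6 * n) * D ^ n * S) * (Q ^ n * (Q ^ n * (Q ^ 5 / D) ^ (n - m))) := by
        gcongr
    _ = Q ^ (8 * n) * (D ^ n * (Q ^ 5 / D) ^ (n - m)) * S := by ring
    _ ≤ Q ^ (8 * n) * Q ^ (7 * n) * S := by gcongr
    _ = Q ^ (15 * n) * S := by ring

/-- The numerical constraints under which the estimate for one level set is carried out. The
parameter `Q` bounds `L`, `1 / lam` and all constants; it is a small power of the dimension. -/
structure ScaleBounds (K c0 c1 coo B L lam Q : ℝ) (n : ℕ) : Prop where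
  c0_pos : 0 < c0
  c1_pos : 0 < c1
  coo_pos : 0 < coo
  coo_le : coo ≤ 1 / 4
  K_pos : 0 < K
  B_pos : 0 < B
  B_le : B ≤ L
  one_le_L : 1 ≤ L
  L_le : L ≤ Q
  inv_le_lam : Q⁻¹ ≤ lam
  lam_le : lam ≤ coo / 3
  le_Q : 48 ≤ Q
  flat_le : 1 ≤ flatness c0 c1 * Q
  net_le : 2 * (126 * (1 / flatness c0 c1 + 4)) ≤ Q
  ball_le : 24 * Real.sqrt 2 * Real.pi ^ 2 * K / c1 + 2 ≤ Q
  tail_le : 2 * B ≤ 12 * Real.pi * K * Q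
  coo_Q : 6 ≤ coo * Q
  pow_le : Q ^ 8 ≤ n

namespace ScaleBounds

variable {K c0 c1 coo B L lam Q : ℝ} {n : ℕ}

lemma lam_pos (h : ScaleBounds K c0 c1 coo B L lam Q n) : 0 < lam :=
  (inv_pos.2 (by linarith [h.le_Q])).trans_le h.inv_le_lam

lemma n_pos (h : ScaleBounds K c0 c1 coo B L lam Q n) : 0 < n := by
  have h1 : (0 : ℝ) < Q ^ 8 := pow_pos (by linarith [h.le_Q]) _
  exact_mod_cast h1.trans_le h.pow_le

lemma n_le (h : ScaleBounds K c0 c1 coo B L lam Q n) : (n : ℝ) ≤ Q * ⌈lam * n⌉₊ := by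
  have hQ : 0 < Q := by linarith [h.le_Q]
  have h1 : 1 ≤ Q * lam := by
    have := mul_le_mul_of_nonneg_left h.inv_le_lam hQ.le
    rwa [mul_inv_cancel₀ hQ.ne'] at this
  have h2 : Q * (lam * n) ≤ Q * ⌈lam * n⌉₊ := mul_le_mul_of_nonneg_left (Nat.le_ceil _) hQ.le
  have h3 : (0 : ℝ) ≤ n := by positivity
  nlinarith

lemma pow_seven_le (h : ScaleBounds K c0 c1 coo B L lam Q n) : Q ^ 7 ≤ (⌈lam * n⌉₊ : ℝ) := by
  have hQ : 0 < Q := by linarith [h.le_Q]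
  have h1 := h.pow_le.trans h.n_le
  have h2 : Q ^ 8 = Q * Q ^ 7 := by ring
  rw [h2] at h1
  exact le_of_mul_le_mul_left h1 hQ

lemma ceil_pos (h : ScaleBounds K c0 c1 coo B L lam Q n) : 0 < ⌈lam * n⌉₊ := by
  have h1 : (0 : ℝ) < Q ^ 7 := pow_pos (by linarith [h.le_Q]) _
  exact_mod_cast h1.trans_le h.pow_seven_le

lemma ceil_le_two_mul (h : ScaleBounds K c0 c1 coo B L lam Q n) :
    (⌈lam * n⌉₊ : ℝ) ≤ 2 * (lam * n) := by
  have hQ := h.le_Q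
  have h1 := Nat.ceil_lt_add_one (show 0 ≤ lam * n by have := h.lam_pos; positivity)
  have h2 : (1 : ℝ) ≤ Q ^ 7 := one_le_pow₀ (by linarith)
  have h3 := h.pow_seven_le
  have h4 : (48 : ℝ) ≤ Q ^ 7 := hQ.trans (le_self_pow₀ (by linarith) (by norm_num))
  linarith

lemma ceil_le_ceil (h : ScaleBounds K c0 c1 coo B L lam Q n) : ⌈lam * n⌉₊ ≤ ⌈coo * n⌉₊ := by
  refine Nat.ceil_le_ceil (mul_le_mul_of_nonneg_right ?_ (by positivity))
  linarith [h.lam_le, h.coo_pos]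

lemma big_n (h : ScaleBounds K c0 c1 coo B L lam Q n) : 6 ≤ coo * n ∧ 48 ≤ (n : ℝ) ∧
    5 * Q ^ 2 ≤ n := by
  have hQ := h.le_Q
  have h1 : Q ≤ Q ^ 8 := le_self_pow₀ (by linarith) (by norm_num)
  have h2 := h.pow_le
  have h3 := mul_le_mul_of_nonneg_left (h1.trans h2) h.coo_pos.le
  refine ⟨h.coo_Q.trans h3, by linarith, ?_⟩
  have h4 : Q ^ 3 ≤ Q ^ 8 := pow_le_pow_right₀ (by linarith) (by norm_num)
  nlinarith [sq_nonneg Q]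

lemma two_mul_ceil_coo_le (h : ScaleBounds K c0 c1 coo B L lam Q n) : 2 * ⌈coo * n⌉₊ ≤ n := by
  have h1 := Nat.ceil_lt_add_one (show 0 ≤ coo * n by have := h.coo_pos; positivity)
  have h2 := h.big_n.2.1
  have h3 : coo * n ≤ 1 / 4 * n := mul_le_mul_of_nonneg_right h.coo_le (by positivity)
  have h4 : (2 : ℝ) * ⌈coo * n⌉₊ ≤ n := by linarith
  exact_mod_cast h4

/-- The blocks fill at least half of the spread coordinates. -/
lemma half_le_blocks (h : ScaleBounds K c0 c1 coo B L lam Q n) :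
    coo * n / 2 ≤ ((⌈coo * n⌉₊ / ⌈lam * n⌉₊ * ⌈lam * n⌉₊ : ℕ) : ℝ) := by
  have h1 : ⌈coo * n⌉₊ ≤ ⌈coo * n⌉₊ / ⌈lam * n⌉₊ * ⌈lam * n⌉₊ + ⌈lam * n⌉₊ := by
    have := Nat.div_add_mod ⌈coo * n⌉₊ ⌈lam * n⌉₊
    have h2 := Nat.mod_lt ⌈coo * n⌉₊ h.ceil_pos
    rw [mul_comm] at this
    omega
  have h2 : (⌈coo * n⌉₊ : ℝ) ≤
      ((⌈coo * n⌉₊ / ⌈lam * n⌉₊ * ⌈lam * n⌉₊ : ℕ) : ℝ) + ⌈lam * n⌉₊ := by exact_mod_cast h1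
  have h3 := Nat.ceil_lt_add_one (show 0 ≤ lam * n by have := h.lam_pos; positivity)
  have h4 := Nat.le_ceil (coo * n)
  have h5 : lam * n ≤ coo / 3 * n := mul_le_mul_of_nonneg_right h.lam_le (by positivity)
  have h6 := h.big_n.1
  linarith

lemma card_blocks_le (h : ScaleBounds K c0 c1 coo B L lam Q n) :
    ((⌈coo * n⌉₊ / ⌈lam * n⌉₊ : ℕ) : ℝ) ≤ Q := by
  set k := ⌈coo * n⌉₊ / ⌈lam * n⌉₊ with hk
  have h1 : k * ⌈lam * n⌉₊ ≤ n :=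
    (Nat.div_mul_le_self _ _).trans (by have := h.two_mul_ceil_coo_le; omega)
  have h2 : (k : ℝ) * ⌈lam * n⌉₊ ≤ n := by exact_mod_cast h1
  have h3 : (0 : ℝ) < ⌈lam * n⌉₊ := by exact_mod_cast h.ceil_pos
  exact le_of_mul_le_mul_right (h2.trans h.n_le) h3

lemma sqrt_n_le (h : ScaleBounds K c0 c1 coo B L lam Q n) :
    Real.sqrt n ≤ Q * Real.sqrt ⌈lam * n⌉₊ := by
  have hQ := h.le_Q
  rw [← Real.sqrt_sq (show 0 ≤ Q by linarith), ← Real.sqrt_mul (by positivity)]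
  refine Real.sqrt_le_sqrt (h.n_le.trans (mul_le_mul_of_nonneg_right ?_ (by positivity)))
  exact le_self_pow₀ (by linarith) two_ne_zero

lemma sq_le_flatness (h : ScaleBounds K c0 c1 coo B L lam Q n) :
    Q ^ 2 ≤ flatness c0 c1 * Real.sqrt ⌈lam * n⌉₊ := by
  have hQ := h.le_Q
  have h1 : Q ^ 3 ≤ Real.sqrt ⌈lam * n⌉₊ := by
    refine Real.le_sqrt_of_sq_le (le_trans ?_ h.pow_seven_le)
    rw [← pow_mul]
    exact pow_le_pow_right₀ (by linarith) (by norm_num)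
  have hκ := flatness_pos h.c0_pos h.c1_pos
  calc Q ^ 2 ≤ flatness c0 c1 * Q * Q ^ 2 := le_mul_of_one_le_left (by positivity) h.flat_le
    _ = flatness c0 c1 * Q ^ 3 := by ring
    _ ≤ _ := mul_le_mul_of_nonneg_left h1 hκ.le

section level

variable {D : ℝ}

lemma le_rpow_self (h : ScaleBounds K c0 c1 coo B L lam Q n) (hDQ : D ≤ Q ^ (1 / lam)) :
    D ≤ Q ^ Q := by
  have hQ := h.le_Q
  refine hDQ.trans (Real.rpow_le_rpow_of_exponent_le (by linarith) ?_)
  rw [one_div]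
  exact inv_le_of_inv_le₀ (by linarith) h.inv_le_lam

lemma log_le (h : ScaleBounds K c0 c1 coo B L lam Q n) (hD : 1 ≤ D) (hDQ : D ≤ Q ^ (1 / lam)) :
    Real.log D ≤ Q * (Q - 1) := by
  have hQ := h.le_Q
  have h1 := Real.log_le_log (by linarith) (h.le_rpow_self hDQ)
  rw [Real.log_rpow (by linarith)] at h1
  have h2 := Real.log_le_sub_one_of_pos (show 0 < Q by linarith)
  nlinarith

lemma pow_ceil_le (h : ScaleBounds K c0 c1 coo B L lam Q n) (hD : 1 ≤ D)
    (hDQ : D ≤ Q ^ (1 / lam)) : D ^ ⌈lam * n⌉₊ ≤ Q ^ (2 * n) := by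
  have hQ := h.le_Q
  have hl := h.lam_pos
  refine (pow_le_pow_left₀ (by linarith) hDQ _).trans ?_
  rw [← Real.rpow_natCast, ← Real.rpow_mul (by linarith), ← Real.rpow_natCast]
  refine Real.rpow_le_rpow_of_exponent_le (by linarith) ?_
  rw [div_mul_eq_mul_div, one_mul, div_le_iff₀ hl]
  push_cast
  linarith [h.ceil_le_two_mul]

lemma mul_rpow_self_le (h : ScaleBounds K c0 c1 coo B L lam Q n) (hD : 1 ≤ D)
    (hDQ : D ≤ Q ^ (1 / lam)) :
    (48 * D ^ 3) ^ (⌈coo * n⌉₊ / ⌈lam * n⌉₊) ≤ Q ^ n := by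
  have hQ := h.le_Q
  set k := ⌈coo * n⌉₊ / ⌈lam * n⌉₊ with hk
  have hD3 := h.le_rpow_self hDQ
  have h1 : 48 * D ^ 3 ≤ Q ^ (3 * Q + 1) := by
    rw [Real.rpow_add (by linarith), Real.rpow_one, mul_comm (3 : ℝ) Q,
      Real.rpow_mul (by linarith), mul_comm]
    refine mul_le_mul ?_ hQ (by norm_num) (by positivity)
    have := pow_le_pow_left₀ (by linarith) hD3 3
    exact_mod_cast this
  refine (pow_le_pow_left₀ (by positivity) h1 _).trans ?_
  rw [← Real.rpow_natCast, ← Real.rpow_mul (by linarith), ← Real.rpow_natCast]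
  refine Real.rpow_le_rpow_of_exponent_le (by linarith) ?_
  have h2 := h.card_blocks_le
  have h3 := h.big_n.2.2
  have h4 : (0 : ℝ) ≤ k := by positivity
  nlinarith

lemma two_mul_le_pow (h : ScaleBounds K c0 c1 coo B L lam Q n)
    (hDQ : D ≤ Q ^ (1 / lam)) : 2 * D ≤ Q ^ n := by
  have hQ := h.le_Q
  have h1 : Q ^ (Q + 1) ≤ Q ^ (n : ℝ) := by
    refine Real.rpow_le_rpow_of_exponent_le (by linarith) ?_
    nlinarith [h.big_n.2.2]
  rw [Real.rpow_natCast] at h1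
  refine le_trans ?_ h1
  rw [Real.rpow_add (by linarith), Real.rpow_one]
  have h2 := h.le_rpow_self hDQ
  have h3 : 0 < Q ^ Q := by positivity
  nlinarith

lemma approx_le (h : ScaleBounds K c0 c1 coo B L lam Q n) (hD : 1 ≤ D)
    (hDQ : D ≤ Q ^ (1 / lam)) : L * Real.sqrt (Real.posLog (2 * D / L)) ≤ Q ^ 2 := by
  have hQ := h.le_Q
  have hL := h.one_le_L
  have h1 : Real.posLog (2 * D / L) ≤ Q ^ 2 := by
    refine max_le (by positivity) ?_
    have h2 : Real.log (2 * D / L) ≤ Real.log (2 * D) :=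
      Real.log_le_log (by positivity) (div_le_self (by positivity) hL)
    rw [Real.log_mul two_ne_zero (by linarith)] at h2
    have h3 := h.log_le hD hDQ
    have h4 := Real.log_two_lt_d9
    nlinarith
  have h2 : Real.sqrt (Real.posLog (2 * D / L)) ≤ Q :=
    Real.sqrt_le_iff.2 ⟨by linarith, h1⟩
  calc L * Real.sqrt (Real.posLog (2 * D / L)) ≤ Q * Q :=
        mul_le_mul h.L_le h2 (Real.sqrt_nonneg _) (by linarith)
    _ = Q ^ 2 := by ring

/-- The small ball bound at scale `Q ^ 2 / D`, simplified. -/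
lemma bracket_le (h : ScaleBounds K c0 c1 coo B L lam Q n) (hD : 1 ≤ D)
    (hDQ : D ≤ Q ^ (1 / lam)) :
    4 * Real.pi ^ 2 * L * (6 * K * (Q ^ 2 / D)) *
        (Real.sqrt (2 * n) / (c1 * Real.sqrt ⌈lam * n⌉₊)) +
        2 * Real.exp (-((2 * Real.pi * D * (6 * K * (Q ^ 2 / D)) / B) ^ 2 / 2)) ≤ Q ^ 5 / D := by
  have hQ := h.le_Q
  have hL := h.one_le_L
  have hK := h.K_pos
  have hc1 := h.c1_pos
  have hB := h.B_pos
  have hm : (0 : ℝ) < ⌈lam * n⌉₊ := by exact_mod_cast h.ceil_pos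
  have hpi := Real.pi_pos
  have hD0 : 0 < D := by linarith
  have hsm : 0 < Real.sqrt ⌈lam * n⌉₊ := Real.sqrt_pos.2 hm
  have h1 : Real.sqrt (2 * n) / (c1 * Real.sqrt ⌈lam * n⌉₊) ≤ Real.sqrt 2 * Q / c1 := by
    rw [div_le_div_iff₀ (by positivity) hc1, Real.sqrt_mul two_pos.le]
    have := mul_le_mul_of_nonneg_left h.sqrt_n_le (show 0 ≤ Real.sqrt 2 * c1 by positivity)
    linarith
  have h2 : 4 * Real.pi ^ 2 * L * (6 * K * (Q ^ 2 / D)) *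
      (Real.sqrt (2 * n) / (c1 * Real.sqrt ⌈lam * n⌉₊)) ≤
      24 * Real.sqrt 2 * Real.pi ^ 2 * K / c1 * (Q ^ 4 / D) := by
    calc _ ≤ 4 * Real.pi ^ 2 * Q * (6 * K * (Q ^ 2 / D)) * (Real.sqrt 2 * Q / c1) := by
          have := h.L_le
          gcongr
      _ = _ := by ring
  have h3 : Real.exp (-((2 * Real.pi * D * (6 * K * (Q ^ 2 / D)) / B) ^ 2 / 2)) ≤ 1 / D := by
    rw [one_div, ← Real.exp_log hD0, ← Real.exp_neg, Real.exp_log hD0]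
    refine Real.exp_le_exp.2 (neg_le_neg ?_)
    have e : 2 * Real.pi * D * (6 * K * (Q ^ 2 / D)) / B = 12 * Real.pi * K * Q / B * Q := by
      field_simp
      ring
    have h4 : 2 ≤ 12 * Real.pi * K * Q / B := by
      rw [le_div_iff₀ hB]
      exact h.tail_le
    have h5 : 2 * Q ≤ 12 * Real.pi * K * Q / B * Q := by nlinarith
    have h6 := pow_le_pow_left₀ (by linarith) h5 2
    rw [e]
    nlinarith [h.log_le hD hDQ]
  have h7 : 1 / D ≤ Q ^ 4 / D := by
    refine div_le_div_of_nonneg_right (one_le_pow₀ (by linarith)) hD0.le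
  have h8 : 0 ≤ Q ^ 4 / D := by positivity
  have h9 := mul_le_mul_of_nonneg_right h.ball_le h8
  have e : Q ^ 5 / D = Q * (Q ^ 4 / D) := by ring
  rw [e]
  linarith

end level

end ScaleBounds

/-- The solution lies in one level set with very small probability: the number of points of the net
is compensated by the small ball probabilities, up to powers of `Q`, and the blocks of the spread
part leave a gain of `√n` per coordinate. -/
theorem SatisfiesA.measureReal_unitSolution_mem_levelSet_le {Ω : Type*} [MeasurableSpace Ω]
    {μ : Measure Ω} [IsProbabilityMeasure μ] {n : ℕ} {A : Ω → Matrix (Fin n) (Fin n) ℝ} {M4 : ℝ}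
    (hA : SatisfiesA μ A M4) {K c0 c1 coo B L lam Q D : ℝ}
    (h : ScaleBounds K c0 c1 coo B L lam Q n) (hMB : 32 * M4 ^ 4 ≤ B ^ 2)
    {spread : EuclideanSpace ℝ (Fin n) → Finset (Fin n)}
    (hs : IsSpreadAssignment c0 c1 coo spread)
    {u : EuclideanSpace ℝ (Fin n)} (hu : u ≠ 0) (hD : 1 ≤ D) (hDQ : D ≤ Q ^ (1 / lam)) :
    μ.real ({ω | unitSolution (A ω) u ∈ levelSet c0 c1 spread L lam D} ∩
      {ω | spectralNorm (A ω) ≤ 3 * K * Real.sqrt n} ∩ {ω | IsUnit (A ω).det}) ≤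
      Q ^ (15 * n) * (Real.sqrt n)⁻¹ ^ (⌈coo * n⌉₊ / ⌈lam * n⌉₊ * ⌈lam * n⌉₊) := by
  have hQ := h.le_Q
  have hn := h.n_pos
  have hn' : (0 : ℝ) < n := by exact_mod_cast hn
  have hn2 : 2 ≤ n := by
    have : (2 : ℝ) ≤ n := by linarith [h.big_n.2.1]
    exact_mod_cast this
  have hm := h.ceil_pos
  have hm' : (0 : ℝ) < ⌈lam * n⌉₊ := by exact_mod_cast hm
  have hD0 : 0 < D := by linarith
  have hsm : 0 < Real.sqrt ⌈lam * n⌉₊ := Real.sqrt_pos.2 hm'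
  have hκ := flatness_pos h.c0_pos h.c1_pos
  have h2c := h.two_mul_ceil_coo_le
  have hkm := Nat.div_mul_le_self ⌈coo * n⌉₊ ⌈lam * n⌉₊
  obtain ⟨ν, hνp, hνl, hν⟩ := hA.exists_law hn2
  obtain ⟨F, hF1, hF2, hF3⟩ := exists_net_levelSet (G := 2 * D * Q) hs hn h.c0_pos h.c1_pos
    (by linarith [h.one_le_L]) hm hkm (by omega) hD (one_le_pow₀ (by linarith))
    (h.approx_le hD hDQ) h.sq_le_flatness (by nlinarith) (by
      rw [div_le_iff₀ hsm]
      have := mul_le_mul_of_nonneg_left h.sqrt_n_le hD0.le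
      nlinarith [mul_pos hD0 (mul_pos (show 0 < Q by linarith) hsm)])
  have hη : 0 < Q ^ 2 / D := by positivity
  set P : ℝ := Real.exp (n / 2) * (Q ^ 5 / D) ^ (n - ⌈lam * n⌉₊) with hP
  have hP0 : 0 ≤ P := by positivity
  have hK := h.K_pos
  have hL0 := h.one_le_L
  have hB0 := h.B_pos
  have hc1 := h.c1_pos
  refine (measureReal_unitSolution_mem_le (P := P) h.K_pos hη hn hu _ F (fun x hx _ => hF3 x hx)
    hP0 fun y hy v => ?_).trans ?_
  · refine (hA.measureReal_norm_sub_le_of_mem_levelSet hνl hν hs hn h.c1_pos h.B_pos hMB h.B_le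
      hD0.le (show 0 < 6 * K * (Q ^ 2 / D) by positivity) hm h.ceil_le_ceil (hF1 y hy) v).trans ?_
    exact mul_le_mul_of_nonneg_left (pow_le_pow_left₀ (by positivity) (h.bracket_le hD hDQ) _)
      (Real.exp_pos _).le
  · refine level_bound_le (by linarith) hD (by positivity) ?_
      (hF2.trans (net_size_le hQ hD (Real.sqrt_pos.2 hn') hsm h.sqrt_n_le (by positivity)
        h.net_le h.card_blocks_le (by omega) (h.mul_rpow_self_le hD hDQ)))
      (by positivity) ?_ hP0 ?_ (h.pow_ceil_le hD hDQ)
    · have := h.ceil_le_ceil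
      omega
    · refine le_trans ?_ (h.two_mul_le_pow hDQ)
      have h1 : 1 / (Q ^ 2 / D) ≤ D := by
        rw [one_div_div]
        exact div_le_self hD0.le (one_le_pow₀ (by linarith))
      linarith
    · refine mul_le_mul_of_nonneg_right ?_ (by positivity)
      rw [div_eq_mul_inv, Real.exp_nat_mul]
      refine pow_le_pow_left₀ (Real.exp_pos _).le ?_ n
      have h1 : Real.exp (2⁻¹) ≤ Real.exp 1 := Real.exp_le_exp.2 (by norm_num)
      linarith [Real.exp_one_lt_d9]


/-! ### Assembly of the structure theorem -/

lemma comp_subset_comp {n : ℕ} {c0 c1 c0' c1' : ℝ} (h00 : 0 ≤ c0) (h0 : c0 ≤ c0') (h1 : c1 ≤ c1') :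
    comp n c0 c1 ⊆ comp n c0' c1' := by
  rintro x ⟨hx, hd⟩
  have hsub : sparse n c0 ⊆ sparse n c0' := fun z hz =>
    le_trans (show _ ≤ c0 * (n : ℝ) from hz) (mul_le_mul_of_nonneg_right h0 (by positivity))
  have hne : (sparse n c0).Nonempty := ⟨0, by simp [sparse]; positivity⟩
  exact ⟨hx, (Metric.infDist_le_infDist_of_subset hsub hne).trans (hd.trans h1)⟩

/-- The losses `Q ^ (16 n)` are absorbed by the gain `n ^ (-coo n / 4)` once `Q = n ^ c` with `c`
small compared to `coo`. -/
lemma pow_mul_inv_sqrt_pow_le_exp {n l : ℕ} {c coo : ℝ} (hn : 3 ≤ n) (hc : 0 < c)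
    (hcc : 68 * c ≤ coo) (hl : coo * n / 2 ≤ l) :
    ((n : ℝ) ^ c) ^ (16 * n) * (Real.sqrt n)⁻¹ ^ l ≤ Real.exp (-c * n) := by
  have hn' : (0 : ℝ) < n := by
    have : 0 < n := by omega
    exact_mod_cast this
  have hlog : 1 ≤ Real.log n := by
    rw [Real.le_log_iff_exp_le hn']
    have : (3 : ℝ) ≤ n := by exact_mod_cast hn
    linarith [Real.exp_one_lt_d9]
  have h1 : ((n : ℝ) ^ c) ^ (16 * n) = Real.exp (Real.log n * (16 * c * n)) := by
    rw [Real.rpow_def_of_pos hn', ← Real.exp_nat_mul]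
    congr 1
    push_cast
    ring
  have h2 : (Real.sqrt n)⁻¹ ^ l = Real.exp (-(Real.log n * (l / 2))) := by
    rw [← Real.exp_log (Real.sqrt_pos.2 hn'), Real.log_sqrt hn'.le, ← Real.exp_neg,
      ← Real.exp_nat_mul]
    congr 1
    ring
  rw [h1, h2, ← Real.exp_add]
  refine Real.exp_le_exp.2 ?_
  have h3 : 68 * c * n ≤ coo * n := mul_le_mul_of_nonneg_right hcc hn'.le
  have h4 : c * n ≤ l / 2 - 16 * c * n := by linarith
  have h5 : 0 ≤ c * n := by positivity
  nlinarith

end SymmetricRandomMatrix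

open SymmetricRandomMatrix in
theorem mainTheorem4 (K M4 : ℝ) (hK : 0 < K) :
    ∃ c0max ∈ Set.Ioo (0 : ℝ) 1, ∃ c1max ∈ Set.Ioo (0 : ℝ) 1,
      ∀ c0 ∈ Set.Ioc 0 c0max, ∀ c1 ∈ Set.Ioc 0 c1max,
      ∀ coo ∈ Set.Icc (c0 * c1 ^ 2 / 4) (1 / 4 : ℝ),
      ∃ c : ℝ, 0 < c ∧ ∃ L0 : ℝ, 1 ≤ L0 ∧
      ∀ (n : ℕ) (Ω : Type*) [MeasurableSpace Ω] (μ : Measure Ω) [IsProbabilityMeasure μ]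
        (A : Ω → Matrix (Fin n) (Fin n) ℝ), SymmetricRandomMatrix.SatisfiesA μ A M4 →
      ∀ spread : EuclideanSpace ℝ (Fin n) → Finset (Fin n),
        SymmetricRandomMatrix.IsSpreadAssignment c0 c1 coo spread →
      ∀ u : EuclideanSpace ℝ (Fin n), u ≠ 0 →
      ∀ L lam : ℝ, L0 ≤ L → L ≤ (n : ℝ) ^ c → (n : ℝ) ^ (-c) ≤ lam → lam ≤ coo / 3 →
        μ ({ω | SymmetricRandomMatrix.unitSolution (A ω) u ∈
                  SymmetricRandomMatrix.incomp n c0 c1 ∧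
                L ^ (-2 : ℝ) * (n : ℝ) ^ (c / lam) ≤
                  SymmetricRandomMatrix.regLcd spread L lam
                    (SymmetricRandomMatrix.unitSolution (A ω) u)}ᶜ ∩
            {ω | SymmetricRandomMatrix.spectralNorm (A ω) ≤ 3 * K * Real.sqrt n} ∩
            {ω | IsUnit (A ω).det}) ≤
          ENNReal.ofReal (2 * Real.exp (-c * n)) := by
  classical
  obtain ⟨c0m, hc0m, c1m, hc1m, κ, hκ, n0, hcomp⟩ :=
    exists_measureReal_unitSolution_mem_comp_le K M4 hK
  refine ⟨c0m, hc0m, c1m, hc1m, fun c0 hc0 c1 hc1 coo hcoo => ?_⟩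
  have hc0p : 0 < c0 := hc0.1
  have hc1p : 0 < c1 := hc1.1
  have hcoop : 0 < coo := lt_of_lt_of_le (by positivity) hcoo.1
  have hfp := flatness_pos hc0p hc1p
  have hpi := Real.pi_pos
  set c : ℝ := min κ (coo / 68) with hc
  have hcp : 0 < c := lt_min hκ (by positivity)
  have hcκ : c ≤ κ := min_le_left _ _
  have hcc : c ≤ coo / 68 := min_le_right _ _
  have hcoo4 := hcoo.2
  set B : ℝ := 32 * M4 ^ 4 + 1 with hB
  have hM4 : 0 ≤ M4 ^ 4 := by positivity
  have hBp : 0 < B := by positivity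
  have hMB : 32 * M4 ^ 4 ≤ B ^ 2 := by nlinarith
  set t1 : ℝ := 1 / flatness c0 c1 with ht1
  set t2 : ℝ := 2 * (126 * (1 / flatness c0 c1 + 4)) with ht2
  set t3 : ℝ := 24 * Real.sqrt 2 * Real.pi ^ 2 * K / c1 + 2 with ht3
  set t4 : ℝ := 2 * B / (12 * Real.pi * K) with ht4
  set t5 : ℝ := 6 / coo with ht5
  have ht1p : 0 < t1 := by positivity
  have ht2p : 0 < t2 := by positivity
  have ht3p : 0 < t3 := by positivity
  have ht4p : 0 < t4 := by positivity
  have ht5p : 0 < t5 := by positivity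
  have hn0p : (0 : ℝ) ≤ n0 := by positivity
  -- `L0 ≤ L ≤ n ^ c` forces `Q = n ^ c`, and hence `n`, to exceed all the constants in this sum
  refine ⟨c, hcp, 48 + n0 + B + t1 + t2 + t3 + t4 + t5, by linarith, ?_⟩
  intro n Ω _ μ _ A hA spread hs u hu L lam hL0 hLn hlam1 hlam2
  set Q : ℝ := (n : ℝ) ^ c with hQ
  have hQ48 : 48 ≤ Q := by linarith
  have hnp : 0 < n := by
    rcases Nat.eq_zero_or_pos n with h | h
    · rw [hQ, h, Nat.cast_zero, Real.zero_rpow hcp.ne'] at hQ48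
      norm_num at hQ48
    · exact h
  have hn1 : (1 : ℝ) ≤ n := by exact_mod_cast hnp
  have hn' : (0 : ℝ) < n := by linarith
  have hQ8 : Q ^ 8 ≤ n := by
    rw [hQ, ← Real.rpow_natCast, ← Real.rpow_mul hn'.le]
    calc (n : ℝ) ^ (c * (8 : ℕ)) ≤ (n : ℝ) ^ (1 : ℝ) :=
          Real.rpow_le_rpow_of_exponent_le hn1 (by push_cast; linarith)
      _ = n := Real.rpow_one _
  have hQn : Q ≤ n := (le_self_pow₀ (by linarith) (by norm_num)).trans hQ8
  have hQpow : Q ^ (1 / lam) = (n : ℝ) ^ (c / lam) := by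
    rw [hQ, ← Real.rpow_mul hn'.le]
    congr 1
    ring
  have hS : ScaleBounds K c0 c1 coo B L lam Q n :=
    { c0_pos := hc0p
      c1_pos := hc1p
      coo_pos := hcoop
      coo_le := hcoo4
      K_pos := hK
      B_pos := hBp
      B_le := by linarith
      one_le_L := by linarith
      L_le := hLn
      inv_le_lam := by rwa [hQ, ← Real.rpow_neg hn'.le]
      lam_le := hlam2
      le_Q := hQ48
      flat_le := by
        have h1 : t1 ≤ Q := by linarith
        rw [ht1, div_le_iff₀ hfp] at h1
        linarith
      net_le := by linarith
      ball_le := by linarith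
      tail_le := by
        have h1 : t4 ≤ Q := by linarith
        rw [ht4, div_le_iff₀ (by positivity)] at h1
        linarith
      coo_Q := by
        have h1 : t5 ≤ Q := by linarith
        rw [ht5, div_le_iff₀ hcoop] at h1
        linarith
      pow_le := hQ8 }
  have hlamp := hS.lam_pos
  set EK : Set Ω := {ω | spectralNorm (A ω) ≤ 3 * K * Real.sqrt n} with hEK
  set EI : Set Ω := {ω | IsUnit (A ω).det} with hEI
  set E1 : Set Ω := {ω | unitSolution (A ω) u ∈ comp n c0m c1m} ∩ EK ∩ EI with hE1
  set E2 : ℕ → Set Ω := fun i =>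
    {ω | unitSolution (A ω) u ∈ levelSet c0 c1 spread L lam (2 ^ i)} ∩ EK ∩ EI with hE2
  -- the dyadic levels below `Q ^ (1 / lam)`; there are at most `Q ^ n` of them
  set W : Finset ℕ := (Finset.range (⌊Q ^ (1 / lam)⌋₊ + 1)).filter fun i =>
    (2 : ℝ) ^ i ≤ Q ^ (1 / lam) with hW
  set E : Set Ω := {ω | unitSolution (A ω) u ∈ incomp n c0 c1 ∧
    L ^ (-2 : ℝ) * (n : ℝ) ^ (c / lam) ≤ regLcd spread L lam (unitSolution (A ω) u)}ᶜ ∩ EK ∩ EI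
    with hE
  have hQlam : 1 ≤ Q ^ (1 / lam) := Real.one_le_rpow (by linarith) (by positivity)
  have hsub : E ⊆ E1 ∪ ⋃ i ∈ W, E2 i := by
    rintro ω ⟨⟨hω, hωK⟩, hωI⟩
    set x := unitSolution (A ω) u with hx
    have hx1 : ‖x‖ = 1 := (toEuclideanCLM_unitSolution hωI hu).1
    by_cases hxc : x ∈ comp n c0 c1
    · exact Or.inl ⟨⟨comp_subset_comp hc0p.le hc0.2 hc1.2 hxc, hωK⟩, hωI⟩
    · have hxi : x ∈ incomp n c0 c1 := ⟨hx1, hxc⟩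
      have hlt : regLcd spread L lam x < L ^ (-2 : ℝ) * (n : ℝ) ^ (c / lam) := by
        by_contra hge
        exact hω ⟨hxi, not_lt.1 hge⟩
      have hlt2 : regLcd spread L lam x < Q ^ (1 / lam) := by
        refine hlt.trans_le ?_
        rw [hQpow]
        exact mul_le_of_le_one_left (by positivity)
          (Real.rpow_le_one_of_one_le_of_nonpos hS.one_le_L (by norm_num))
      have hge1 : 1 ≤ regLcd spread L lam x := by
        refine le_trans (one_le_pow₀ (by linarith : (1 : ℝ) ≤ Q)) (hS.sq_le_flatness.trans ?_)
        exact hs.le_regLcd hc0p hc1p hnp hxi (by linarith [hS.one_le_L]) hS.ceil_pos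
          hS.ceil_le_ceil
      obtain ⟨i, hi1, hi2⟩ := exists_nat_pow_near hge1 one_lt_two
      have hi3 : (2 : ℝ) ^ i ≤ Q ^ (1 / lam) := hi1.trans hlt2.le
      refine Or.inr (Set.mem_biUnion (x := i) ?_ ⟨⟨⟨hxi, hi1, ?_⟩, hωK⟩, hωI⟩)
      · refine Finset.mem_coe.2 (Finset.mem_filter.2 ⟨Finset.mem_range.2
          (Nat.lt_succ_of_le (Nat.le_floor (le_trans ?_ hi3))), hi3⟩)
        exact_mod_cast (Nat.lt_two_pow_self (n := i)).le
      · rw [pow_succ] at hi2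
        linarith
  have hb1 : μ.real E1 ≤ Real.exp (-c * n) := by
    have hn0 : n0 ≤ n := by
      have : (n0 : ℝ) ≤ n := by linarith
      exact_mod_cast this
    refine (hcomp n hn0 Ω μ A hA u hu).trans (Real.exp_le_exp.2 ?_)
    nlinarith
  have hb2 : μ.real (⋃ i ∈ W, E2 i) ≤ Real.exp (-c * n) := by
    set l := ⌈coo * n⌉₊ / ⌈lam * n⌉₊ * ⌈lam * n⌉₊ with hl
    refine (measureReal_biUnion_finset_le _ _).trans
      ((Finset.sum_le_card_nsmul _ _ (Q ^ (15 * n) * (Real.sqrt n)⁻¹ ^ l) fun i hi => ?_).trans ?_)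
    · exact hA.measureReal_unitSolution_mem_levelSet_le hS hMB hs hu
        (one_le_pow₀ one_le_two) (Finset.mem_filter.1 hi).2
    · have hWc : (W.card : ℝ) ≤ Q ^ n := by
        have h1 : W.card ≤ ⌊Q ^ (1 / lam)⌋₊ + 1 :=
          (Finset.card_filter_le _ _).trans (Finset.card_range _).le
        have h2 : (W.card : ℝ) ≤ ⌊Q ^ (1 / lam)⌋₊ + 1 := by exact_mod_cast h1
        have h3 := Nat.floor_le (show 0 ≤ Q ^ (1 / lam) by linarith)
        exact le_trans (by linarith) (hS.two_mul_le_pow le_rfl)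
      have hn3 : 3 ≤ n := by
        have : (3 : ℝ) ≤ n := by linarith
        exact_mod_cast this
      rw [nsmul_eq_mul]
      calc (W.card : ℝ) * (Q ^ (15 * n) * (Real.sqrt n)⁻¹ ^ l)
          ≤ Q ^ n * (Q ^ (15 * n) * (Real.sqrt n)⁻¹ ^ l) := by gcongr
        _ = Q ^ (16 * n) * (Real.sqrt n)⁻¹ ^ l := by ring
        _ ≤ _ := pow_mul_inv_sqrt_pow_le_exp hn3 hcp (by linarith) hS.half_le_blocks
  rw [← ofReal_measureReal (measure_ne_top μ E)]
  refine ENNReal.ofReal_le_ofReal ?_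
  have h1 := (measureReal_mono hsub (measure_ne_top μ _)).trans (measureReal_union_le _ _)
  linarith
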